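/- Let $\mathrm{GF}(q)$ be a finite field with $q\neq 2$, and let $D,N$ be integers with $N>2D\ge 6$. Let $\Gamma$ be the bilinear forms graph $H_q(D,N-D)$: its vertex set $X$ is the set of $D\times(N-D)$ matrices over $\mathrm{GF}(q)$, and two vertices are adjacent when their difference has rank one. Let $\partial$ be the path-length distance, $\Gamma_i(x)=\{z\in X:\partial(x,z)=i\}$ and $\Gamma(x)=\Gamma_1(x)$. Let $V=\mathbb R^X$ have its standard inner product; $\hat x\in V$ is the standard basis vector of $x\in X$, and $\widehat\Omega=\sum_{z\in\Omega}\hat z$ for $\Omega\subseteq X$. Let $\theta_0>\theta_1>\cdots$ be the distinct eigenvalues of the adjacency matrix, and let $E$ be the primitive idempotent for $\theta_1$, i.e. the matrix that acts as the identity on the $\theta_1$-eigenspace and as $0$ on every other eigenspace. For $0\le i\le D$ put $$\theta^*_i=\frac{q^{N-i}+1-q^D-q^{N-D}}{q-1}.$$ Fix $x,y\in X$ such that $k=\partial(x,y)$ satisfies $2\le k\le D-1$. Define $O_1=\Gamma(x)\cap\Gamma_{k-1}(y)$, $O_6=\Gamma(x)\cap\Gamma_{k+1}(y)$, and let $O_2,O_3,O_4,O_5$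 be the sets of those $z\in\Gamma(x)\cap\Gamma_k(y)$ for which the pair $$\bigl(|\Gamma(x)\cap\Gamma(z)\cap\Gamma_{k-1}(y)|,\ |\Gamma(x)\cap\Gamma(z)\cap\Gamma_{k+1}(y)|\bigr)$$ equals, respectively, $(2q^{k-1},0)$, $(2q^{k-1}-1,0)$, $(q^{k-1},q^D-q^k)$, $(q^{k-1},q^{N-D}-q^k)$. Let $O'_1,\dots,O'_6$ be the sets obtained in the same way with $x$ and $y$ interchanged. Let $S=\mathrm{Span}\{E\widehat O_i: 1\le i\le 6\}$. Let $H$ be the $6\times 6$ matrix whose columns (written as row vectors, with entries for $i=1,\dots,6$) are as follows, where $a=\frac{q^D-q^k}{q-1}$, $b=\frac{q^{N-D}-q^k}{q-1}$, $c=\frac{q^k-1}{q-1}$, $d=q^{k-1}-1$ and $p=\frac{q^N-q^{N-D+1}-q^{D+1}+q^{k+1}-q^k+q}{(q-1)^2}$: - column 1: $(1,1,1,1,1,1)$; - column 2: $(a,a,a,a,-c,-c)$; - column 3: $(b,b,b,-c,b,-c)$; - column 4: $(q-2,0,-1,0,0,0)$; - column 5: $\bigl(p,\ \tfrac{q^k-q^N}{q-1},\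 p,\ -a,\ -b,\ c\bigr)$; - column 6: $\bigl(q^{-k}(q-1)abd,\ q^{-1}(q-1)ab,\ q^{-k}(q-1)abd,\ -ad,\ -bd,\ cd\bigr)$. For $1\le j\le 6$ put $h_j=\sum_{i=1}^6 H_{ij}E\widehat O_i$ and $h'_j=\sum_{i=1}^6 H_{ij}E\widehat O'_i$. Put $$\tau=\frac{(q^{N-D}-q)(q^{D-1}-1)+q^{N-k}(q^{k-1}-1)(q-1)}{(q-1)^2},\qquad \kappa=\frac{(q^D-1)(q^{N-D}-1)}{q-1},$$ $$\eta_1=\kappa,\quad \eta_2=\kappa ac,\quad \eta_3=\kappa bc,\quad \eta_4=(q-2)q^{k-1}(q^k-1),\quad \eta_5=\tau\kappa q^kc,\quad \eta_6=\tau\, q^{-1}(q-1)^2abcd,$$ $$\varepsilon_1=(\theta^*_1)^2,\quad \varepsilon_2=q^{2N-D-2},\quad \varepsilon_3=q^{N+D-2},\quad \varepsilon_4=q^{N-1},\quad \varepsilon_5=\varepsilon_6=q^{N-2}.$$ Further put $$\lambda_i=|O_i|\,\frac{\theta^*_1-\theta^*_{k+\varepsilon(i)}}{\theta^*_0-\theta^*_k},\qquad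 \varepsilon(1)=-1,\ \ \varepsilon(2)=\cdots=\varepsilon(5)=0,\ \ \varepsilon(6)=1,\qquad \mu_j=\sum_{i=1}^6\lambda_iH_{ij}.$$ Then the following hold. 1. $\theta_1=\theta^*_1$, and $|X|\,E_{u,v}=\theta^*_{\partial(u,v)}$ for all $u,v\in X$. 2. The vectors $E\widehat O_1,\dots,E\widehat O_6$ are linearly independent, hence form a basis of $S$. 3. Each of $\{h_j\}_{j=1}^6$ and $\{h'_j\}_{j=1}^6$ is a basis of $S$ consisting of mutually orthogonal vectors, and $$\|h_j\|^2=\|h'_j\|^2=|X|^{-1}\varepsilon_j\eta_j\qquad(1\le j\le 6).$$ 4. For $1\le j\le 6$, $$h_j-h'_j=\mu_j\,(E\hat x-E\hat y),$$ and the scalars $\mu_j$ are given by $$\mu_1=\theta^*_1,\quad \mu_2=-q^{N-D-1}a,\quad \mu_3=-q^{D-1}b,\quad \mu_4=-(q-2)q^{k-1},\quad \mu_5=-q^{k-1}\tau,\quad \mu_6=0.$$ -/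

import Mathlib

open scoped BigOperators

noncomputable section

namespace BilinearForms

/-! ### Adjacency operator, eigenvalues and primitive idempotents of a finite graph -/

section Graph

variable {X : Type*} [Fintype X] [DecidableEq X]

/-- The adjacency matrix of `G`, acting on the standard module `ℝ^X`. -/
def adjOp (G : SimpleGraph X) [DecidableRel G.Adj] :
    EuclideanSpace ℝ X →ₗ[ℝ] EuclideanSpace ℝ X :=
  Matrix.toEuclideanLin (G.adjMatrix ℝ)

/-- The distinct eigenvalues of `G`, listed in decreasing order `θ₀ > θ₁ > ⋯`;
`graphEigenvalue G i` is `θ_i` (and `0` past the end of the list). -/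
def graphEigenvalue (G : SimpleGraph X) [DecidableRel G.Adj] (i : ℕ) : ℝ :=
  ((Module.End.finite_hasEigenvalue (adjOp G)).toFinset.sort (· ≥ ·)).getD i 0

/-- The primitive idempotent of `G` associated with `θ`: the orthogonal projection onto the
`θ`-eigenspace of the adjacency matrix. As the adjacency matrix is symmetric, this is the map that
acts as the identity on the `θ`-eigenspace and as zero on every other eigenspace
(see the two lemmas below). -/
def primitiveIdempotent (G : SimpleGraph X) [DecidableRel G.Adj] (θ : ℝ) :
    EuclideanSpace ℝ X →L[ℝ] EuclideanSpace ℝ X :=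
  (Module.End.eigenspace (adjOp G) θ).starProjection

theorem primitiveIdempotent_apply_self (G : SimpleGraph X) [DecidableRel G.Adj] {θ : ℝ}
    {v : EuclideanSpace ℝ X} (hv : adjOp G v = θ • v) : primitiveIdempotent G θ v = v :=
  Submodule.starProjection_eq_self_iff.2 (Module.End.mem_eigenspace_iff.2 hv)

theorem primitiveIdempotent_apply_of_ne (G : SimpleGraph X) [DecidableRel G.Adj] {θ θ' : ℝ}
    (hne : θ' ≠ θ) {v : EuclideanSpace ℝ X} (hv : adjOp G v = θ' • v) :
    primitiveIdempotent G θ v = 0 := by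
  have hs : (adjOp G).IsSymmetric :=
    Matrix.isSymmetric_toEuclideanLin_iff.2 (by
      rw [Matrix.IsHermitian, Matrix.conjTranspose_eq_transpose_of_trivial]
      exact G.transpose_adjMatrix)
  refine (Submodule.starProjection_apply_eq_zero_iff _).2 ?_
  rw [Submodule.mem_orthogonal]
  intro u hu
  have hu' : adjOp G u = θ • u := Module.End.mem_eigenspace_iff.1 hu
  have h := hs u v
  rw [hu', hv, real_inner_smul_left, real_inner_smul_right] at h
  have h2 : (θ' - θ) * inner ℝ u v = 0 := by linarith
  exact (mul_eq_zero.1 h2).resolve_left (sub_ne_zero.2 hne)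

/-- The basis vector `x̂` of the standard module. -/
def hat (x : X) : EuclideanSpace ℝ X := EuclideanSpace.single x 1

/-- The vector `Ω̂ = ∑_{z ∈ Ω} ẑ`. -/
def hatSet (Ω : Finset X) : EuclideanSpace ℝ X := ∑ z ∈ Ω, hat z

end Graph

/-! ### The bilinear forms graph `H_q(D, N - D)` -/

/-- The vertices: the `D × (N - D)` matrices over `K`. -/
abbrev Vert (K : Type*) (D N : ℕ) : Type _ := Matrix (Fin D) (Fin (N - D)) K

section BFG

variable (K : Type*) [Field K] [Fintype K] [DecidableEq K] (D N : ℕ)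

/-- Two vertices are adjacent whenever their difference has rank one. -/
def graph : SimpleGraph (Vert K D N) where
  Adj u v := (u - v).rank = 1
  symm := ⟨fun u v h => by
    rw [← neg_sub, show -(u - v) = (-1 : K) • (u - v) by simp,
      Matrix.rank_smul_of_mem_nonZeroDivisors _
        (mem_nonZeroDivisors_of_ne_zero (neg_ne_zero.2 one_ne_zero))]
    exact h⟩
  loopless := ⟨fun u h => by simp at h⟩

instance : DecidableRel (graph K D N).Adj :=
  fun u v => inferInstanceAs (Decidable ((u - v).rank = 1))

/-- The primitive idempotent `E` associated with the second largest eigenvalue `θ₁`. -/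
def idem : EuclideanSpace ℝ (Vert K D N) →L[ℝ] EuclideanSpace ℝ (Vert K D N) :=
  primitiveIdempotent (graph K D N) (graphEigenvalue (graph K D N) 1)

variable {K D N}

/-- The vertices at distance `i` from `x`. -/
def sphere (x : Vert K D N) (i : ℕ) : Finset (Vert K D N) :=
  {z | (graph K D N).dist x z = i}

/-- The `y`-partition `O₁, …, O₆` of the neighbourhood `Γ(x)`, where `k` is the distance between
`x` and `y` (the sets are indexed from `0`). -/
def part (x y : Vert K D N) : Fin 6 → Finset (Vert K D N) :=
  let q := Fintype.card K
  let k := (graph K D N).dist x y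
  let lo := fun z => (sphere x 1 ∩ sphere z 1 ∩ sphere y (k - 1)).card
  let hi := fun z => (sphere x 1 ∩ sphere z 1 ∩ sphere y (k + 1)).card
  ![sphere x 1 ∩ sphere y (k - 1),
    {z ∈ sphere x 1 ∩ sphere y k | lo z = 2 * q ^ (k - 1) ∧ hi z = 0},
    {z ∈ sphere x 1 ∩ sphere y k | lo z = 2 * q ^ (k - 1) - 1 ∧ hi z = 0},
    {z ∈ sphere x 1 ∩ sphere y k | lo z = q ^ (k - 1) ∧ hi z = q ^ D - q ^ k},
    {z ∈ sphere x 1 ∩ sphere y k | lo z = q ^ (k - 1) ∧ hi z = q ^ (N - D) - q ^ k},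
    sphere x 1 ∩ sphere y (k + 1)]

/-- The vector `E Ô_i`. -/
def EO (x y : Vert K D N) (i : Fin 6) : EuclideanSpace ℝ (Vert K D N) :=
  idem K D N (hatSet (part x y i))

/-- The subspace `S = S(x,y)` spanned by `E Ô₁, …, E Ô₆`. -/
def subspaceS (x y : Vert K D N) : Submodule ℝ (EuclideanSpace ℝ (Vert K D N)) :=
  Submodule.span ℝ (Set.range (EO x y))

end BFG

/-! ### The explicit scalars -/

/-- `θ_i = θ*_i`, the `i`-th eigenvalue and `i`-th dual eigenvalue, explicitly. -/
def theta (q : ℝ) (D N i : ℕ) : ℝ :=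
  (q ^ (N - i) + 1 - q ^ D - q ^ (N - D)) / (q - 1)

/-- The matrix `H` (rows and columns are indexed from `0`). -/
def matH (q : ℝ) (D N k : ℕ) : Matrix (Fin 6) (Fin 6) ℝ :=
  !![1, (q ^ D - q ^ k) / (q - 1), (q ^ (N - D) - q ^ k) / (q - 1), q - 2,
      (q ^ N - q ^ (N - D + 1) - q ^ (D + 1) + q ^ (k + 1) - q ^ k + q) / (q - 1) ^ 2,
      (q ^ D - q ^ k) * (q ^ (N - D) - q ^ k) * (q ^ (k - 1) - 1) / (q ^ k * (q - 1));
    1, (q ^ D - q ^ k) / (q - 1), (q ^ (N - D) - q ^ k) / (q - 1), 0,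
      (q ^ k - q ^ N) / (q - 1),
      (q ^ D - q ^ k) * (q ^ (N - D) - q ^ k) / (q * (q - 1));
    1, (q ^ D - q ^ k) / (q - 1), (q ^ (N - D) - q ^ k) / (q - 1), -1,
      (q ^ N - q ^ (N - D + 1) - q ^ (D + 1) + q ^ (k + 1) - q ^ k + q) / (q - 1) ^ 2,
      (q ^ D - q ^ k) * (q ^ (N - D) - q ^ k) * (q ^ (k - 1) - 1) / (q ^ k * (q - 1));
    1, (q ^ D - q ^ k) / (q - 1), -((q ^ k - 1) / (q - 1)), 0,
      (q ^ k - q ^ D) / (q - 1),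
      -((q ^ D - q ^ k) * (q ^ (k - 1) - 1) / (q - 1));
    1, -((q ^ k - 1) / (q - 1)), (q ^ (N - D) - q ^ k) / (q - 1), 0,
      (q ^ k - q ^ (N - D)) / (q - 1),
      -((q ^ (N - D) - q ^ k) * (q ^ (k - 1) - 1) / (q - 1));
    1, -((q ^ k - 1) / (q - 1)), -((q ^ k - 1) / (q - 1)), 0,
      (q ^ k - 1) / (q - 1),
      (q ^ k - 1) * (q ^ (k - 1) - 1) / (q - 1)]

/-- The common factor of `η₅`, `η₆` and `μ₅`. -/
def tau (q : ℝ) (D N k : ℕ) : ℝ :=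
  ((q ^ (N - D) - q) * (q ^ (D - 1) - 1) + q ^ (N - k) * (q ^ (k - 1) - 1) * (q - 1))
    / (q - 1) ^ 2

/-- The scalars `η₁, …, η₆`. -/
def eta (q : ℝ) (D N k : ℕ) : Fin 6 → ℝ :=
  ![(q ^ D - 1) * (q ^ (N - D) - 1) / (q - 1),
    (q ^ D - q ^ k) * (q ^ k - 1) * (q ^ D - 1) * (q ^ (N - D) - 1) / (q - 1) ^ 3,
    (q ^ (N - D) - q ^ k) * (q ^ k - 1) * (q ^ D - 1) * (q ^ (N - D) - 1) / (q - 1) ^ 3,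
    (q - 2) * q ^ (k - 1) * (q ^ k - 1),
    tau q D N k *
      (q ^ k * (q ^ k - 1) * (q ^ D - 1) * (q ^ (N - D) - 1) / (q - 1) ^ 2),
    tau q D N k *
      ((q ^ k - 1) * (q ^ (k - 1) - 1) * (q ^ D - q ^ k) * (q ^ (N - D) - q ^ k)
        / ((q - 1) * q))]

/-- The scalars `ε₁, …, ε₆`. -/
def eps (q : ℝ) (D N : ℕ) : Fin 6 → ℝ :=
  ![theta q D N 1 ^ 2, q ^ (2 * N - D - 2), q ^ (N + D - 2), q ^ (N - 1), q ^ (N - 2),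
    q ^ (N - 2)]

/-- The closed forms of the scalars `μ₁, …, μ₆`. -/
def muClosed (q : ℝ) (D N k : ℕ) : Fin 6 → ℝ :=
  ![theta q D N 1,
    -(q ^ (N - D - 1) * ((q ^ D - q ^ k) / (q - 1))),
    -(q ^ (D - 1) * ((q ^ (N - D) - q ^ k) / (q - 1))),
    -((q - 2) * q ^ (k - 1)),
    -(q ^ (k - 1) * tau q D N k),
    0]

section Vectors

variable {K : Type*} [Field K] [Fintype K] [DecidableEq K] {D N : ℕ}

/-- `h_j = ∑ i, H_{i,j} E Ô_i`, for the ordered pair `(x, y)`; the vectors `h'_j` are those for the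
ordered pair `(y, x)`. -/
def h (x y : Vert K D N) (j : Fin 6) : EuclideanSpace ℝ (Vert K D N) :=
  ∑ i, matH (Fintype.card K) D N ((graph K D N).dist x y) i j • EO x y i

/-- The scalars `λ₁, …, λ₆`, in terms of the sizes `|O_i|` and the dual eigenvalues. -/
def lam (x y : Vert K D N) (i : Fin 6) : ℝ :=
  let θs := theta (Fintype.card K) D N
  let k := (graph K D N).dist x y
  (part x y i).card *
    ((θs 1 - θs ((![k - 1, k, k, k, k, k + 1] : Fin 6 → ℕ) i)) / (θs 0 - θs k))

/-- `μ_j = ∑ i, λ_i H_{i,j}`. -/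
def mu (x y : Vert K D N) (j : Fin 6) : ℝ :=
  ∑ i, lam x y i * matH (Fintype.card K) D N ((graph K D N).dist x y) i j

end Vectors

end BilinearForms

end

set_option linter.unusedSectionVars false

noncomputable section

namespace BilinearForms

/-! ### Rank-one perturbations of a matrix -/

section Rank

open Matrix

variable {K ι κ : Type*} [Field K] [Fintype ι] [Fintype κ]

/-! Put M = y − x, of rank k. Distance is the rank of the difference (`dist_eq_rank`), and the
neighbours of x are x + W with W = a bᵗ of rank one. The rank of M − W depends only on whether a
lies in the column space of M, whether b lies in its row space and, if both do, on the scalar b ·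
Ga, where MGM = M. Splitting that scalar into 1, 0 and the rest gives six classes (`cls`), and
counting triangles shows that they are the sets O_i (`mem_part`).

The additive characters of the matrix space are eigenvectors: the one attached to A has eigenvalue
θ*_{rank A}. Hence |X| E_{u,v} is a character sum over the rank-one matrices, which is the same
function of rank(u − v). This self-duality gives θ₁ = θ*₁ and the entries of E.

The inner product of E(x + W) and E(x + W') is therefore θ*_{rank(W − W')} / |X|, and rank(W − W')
is 0, 1 or 2 according to which row and column lines W and W' share. So the Gram operator preserves
functions of the class (`sum_rankOne_theta_cls`) and becomes a 6 × 6 matrix. The columns of H are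
its eigenvectors for the ε_j, orthogonal for the class sizes with square norms η_j
(`matHParam_eigen`, `matHParam_orthogonal`). As ε_j η_j > 0, the h_j are nonzero and orthogonal, so
they and the six spanning vectors of S are independent.

To compare with h'_j, take Fourier transforms at A = p rᵗ. If F is the transform of a class, then
O_i has transform ψ(A, x) F and O'_i has ψ(A, y) times the conjugate of F, since O'_i consists of
the y − W. With s = p · Mr one finds F = ρ + σ ψ(s), where ρ and σ are real and independent of A as
long as s ≠ 0. Then F − ψ(s) F̄ = (ρ − σ)(1 − ψ(s)), which puts EO_i − EO'_i on the line of Ex − Ey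
(`balanced_eq_top`, `exists_EO_sub_EO`). An inner product with Ex − Ey identifies the coefficient as
λ_i, so h_j − h'_j = μ_j (Ex − Ey).

Finally Ex − Ey lies in S, because its projection onto the h_j has its full norm (`sum_muParam_sq`);
hence every h'_j lies in S as well. -/

theorem rank_add_finrank_ker_mulVecLin (M : Matrix ι κ K) :
    M.rank + Module.finrank K (LinearMap.ker M.mulVecLin) = Fintype.card κ := by
  rw [Matrix.rank, LinearMap.finrank_range_add_finrank_ker, Module.finrank_fintype_fun_eq_card]

theorem rank_add_le (A B : Matrix ι κ K) : (A + B).rank ≤ A.rank + B.rank := by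
  unfold Matrix.rank
  rw [Matrix.mulVecLin_add]
  exact (Submodule.finrank_mono (LinearMap.range_add_le _ _)).trans
    (Submodule.finrank_add_le_finrank_add_finrank _ _)

theorem eq_zero_of_rank_eq_zero {M : Matrix ι κ K} (h : M.rank = 0) : M = 0 := by
  have h1 : LinearMap.range M.mulVecLin = ⊥ := Submodule.finrank_eq_zero.1 h
  have h2 := LinearMap.range_eq_bot.1 h1
  classical
  refine Matrix.ext_of_mulVec_single fun i => ?_
  rw [Matrix.zero_mulVec]
  exact LinearMap.congr_fun h2 (Pi.single i 1)

theorem rank_neg (M : Matrix ι κ K) : (-M).rank = M.rank := by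
  rw [show -M = (-1 : K) • M by simp, Matrix.rank_smul_of_mem_nonZeroDivisors _
    (mem_nonZeroDivisors_of_ne_zero (neg_ne_zero.2 one_ne_zero))]

theorem rank_vecMulVec_of_ne_zero {a : ι → K} {b : κ → K} (ha : a ≠ 0) (hb : b ≠ 0) :
    (vecMulVec a b).rank = 1 := by
  have h1 := Matrix.rank_vecMulVec_le a b
  have h2 : (vecMulVec a b).rank ≠ 0 := fun h => by
    obtain ⟨i, hi⟩ := Function.ne_iff.1 ha
    obtain ⟨j, hj⟩ := Function.ne_iff.1 hb
    exact mul_ne_zero hi hj (congrFun (congrFun (eq_zero_of_rank_eq_zero h) i) j)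
  omega

theorem rank_sub_vecMulVec_le (M : Matrix ι κ K) (a : ι → K) (b : κ → K) :
    (M - vecMulVec a b).rank ≤ M.rank + 1 := by
  have h := rank_add_le M (-vecMulVec a b)
  rw [rank_neg, ← sub_eq_add_neg] at h
  exact h.trans (Nat.add_le_add_left (Matrix.rank_vecMulVec_le a b) _)

theorem rank_le_rank_sub_vecMulVec (M : Matrix ι κ K) (a : ι → K) (b : κ → K) :
    M.rank ≤ (M - vecMulVec a b).rank + 1 := by
  have h := rank_add_le (M - vecMulVec a b) (vecMulVec a b)
  rw [sub_add_cancel] at h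
  exact h.trans (Nat.add_le_add_left (Matrix.rank_vecMulVec_le a b) _)

/-- A linear section of M over its range, extended to the whole space. It turns membership in the
column or row space into an equation. -/
theorem exists_generalized_inverse (M : Matrix ι κ K) : ∃ G : Matrix κ ι K, M * G * M = M := by
  classical
  obtain ⟨s, hs⟩ := (M.mulVecLin.rangeRestrict).exists_rightInverse_of_surjective
    (LinearMap.range_eq_top.2 M.mulVecLin.surjective_rangeRestrict)
  obtain ⟨g, hg⟩ := LinearMap.exists_extend s
  refine ⟨LinearMap.toMatrix' g, ?_⟩
  have key : ∀ v, M *ᵥ (g (M *ᵥ v)) = M *ᵥ v := fun v => by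
    have h1 := LinearMap.congr_fun hg (M.mulVecLin.rangeRestrict v)
    have h2 := LinearMap.congr_fun hs (M.mulVecLin.rangeRestrict v)
    have h3 := congrArg Subtype.val h2
    simp only [LinearMap.comp_apply, LinearMap.id_apply] at h1 h3
    rw [← h1] at h3
    simpa using h3
  refine Matrix.ext_of_mulVec_single fun i => ?_
  rw [← Matrix.mulVec_mulVec, ← Matrix.mulVec_mulVec, LinearMap.toMatrix'_mulVec]
  exact key _

/-- With a = Mv the difference factors as M (1 − v bᵗ), and the second factor is singular only when
b · v = 1. -/
theorem rank_sub_vecMulVec_of_mulVec {M : Matrix ι κ K} {a : ι → K} {b v : κ → K}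
    (hv : M *ᵥ v = a) (h : b ⬝ᵥ v ≠ 1) : (M - vecMulVec a b).rank = M.rank := by
  classical
  have h1 : M - vecMulVec a b = M * (1 - vecMulVec v b) := by
    rw [Matrix.mul_sub, Matrix.mul_one, Matrix.mul_vecMulVec, hv]
  rw [h1]
  refine Matrix.rank_mul_eq_left_of_isUnit_det _ _ ?_
  rw [isUnit_iff_ne_zero]
  intro h0
  obtain ⟨w, hw, hw2⟩ := Matrix.exists_mulVec_eq_zero_iff.2 h0
  rw [Matrix.sub_mulVec, Matrix.one_mulVec, Matrix.vecMulVec_mulVec, sub_eq_zero] at hw2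
  have h3 : (b ⬝ᵥ w) * (1 - b ⬝ᵥ v) = 0 := by
    have : b ⬝ᵥ w = (b ⬝ᵥ w) * (b ⬝ᵥ v) := by
      conv_lhs => rw [hw2]
      simp [mul_comm]
    linear_combination this
  rcases mul_eq_zero.1 h3 with h4 | h4
  · rw [h4] at hw2; simp at hw2; exact hw hw2
  · exact h (sub_eq_zero.1 h4).symm

/-- A kernel vector w of the difference satisfies Mw = (b · w) a; if b · w were nonzero, a would lie
in the column space. -/
theorem ker_sub_vecMulVec_le {M : Matrix ι κ K} {a : ι → K} (b : κ → K)
    (ha : ∀ v, M *ᵥ v ≠ a) :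
    LinearMap.ker (M - vecMulVec a b).mulVecLin ≤ LinearMap.ker M.mulVecLin := by
  intro w hw
  rw [LinearMap.mem_ker, Matrix.mulVecLin_apply] at hw ⊢
  rw [Matrix.sub_mulVec, Matrix.vecMulVec_mulVec, sub_eq_zero] at hw
  by_cases h : b ⬝ᵥ w = 0
  · simpa [h] using hw
  · refine absurd ?_ (ha ((b ⬝ᵥ w)⁻¹ • w))
    rw [Matrix.mulVec_smul, hw]
    ext i
    simp
    field_simp

/-- A functional vanishing on the row space but not at b is the dot product with some w, and
vanishing on the row space means Mw = 0. -/
theorem exists_ker_of_forall_vecMul_ne {M : Matrix ι κ K} {b : κ → K}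
    (hb : ∀ u, u ᵥ* M ≠ b) : ∃ w, M *ᵥ w = 0 ∧ b ⬝ᵥ w ≠ 0 := by
  classical
  have h1 : b ∉ LinearMap.range M.vecMulLinear := by
    rintro ⟨u, hu⟩
    exact hb u hu
  obtain ⟨f, hf, hle⟩ := Submodule.exists_le_ker_of_notMem h1
  obtain ⟨w, rfl⟩ := (dotProductEquiv K κ).surjective f
  refine ⟨w, ?_, ?_⟩
  · refine dotProduct_eq_zero _ fun u => ?_
    have : u ᵥ* M ∈ LinearMap.range M.vecMulLinear := ⟨u, rfl⟩
    have h2 := hle this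
    rw [LinearMap.mem_ker, dotProductEquiv_apply_apply] at h2
    rw [dotProduct_comm, Matrix.dotProduct_mulVec, dotProduct_comm, h2]
  · rw [dotProductEquiv_apply_apply, dotProduct_comm] at hf
    exact hf

theorem dotProduct_eq_zero_of_vecMul {M : Matrix ι κ K} {w : κ → K} (hw : M *ᵥ w = 0)
    (u : ι → K) : (u ᵥ* M) ⬝ᵥ w = 0 := by
  rw [← Matrix.dotProduct_mulVec, hw, dotProduct_zero]

theorem rank_sub_vecMulVec_row_notMem {M : Matrix ι κ K} {b v : κ → K}
    (hb : ∀ u, u ᵥ* M ≠ b) : (M - vecMulVec (M *ᵥ v) b).rank = M.rank := by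
  obtain ⟨w, hw, hbw⟩ := exists_ker_of_forall_vecMul_ne hb
  -- Moving the preimage along the kernel vector w makes its product with b zero, in particular
  -- different from 1.
  refine rank_sub_vecMulVec_of_mulVec (v := v - ((b ⬝ᵥ v) / (b ⬝ᵥ w)) • w) ?_ ?_
  · rw [Matrix.mulVec_sub, Matrix.mulVec_smul, hw, smul_zero, sub_zero]
  · rw [dotProduct_sub, dotProduct_smul, smul_eq_mul, div_mul_cancel₀ _ hbw, sub_self]
    exact zero_ne_one

theorem rank_sub_vecMulVec_col_notMem {M : Matrix ι κ K} {a u : ι → K}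
    (ha : ∀ v, M *ᵥ v ≠ a) : (M - vecMulVec a (u ᵥ* M)).rank = M.rank := by
  have h := rank_sub_vecMulVec_row_notMem (M := Mᵀ) (b := a) (v := u) (fun v hv =>
    ha v (by rw [← hv, Matrix.vecMul_transpose]))
  rw [Matrix.mulVec_transpose, Matrix.rank_transpose] at h
  rw [← h, ← Matrix.rank_transpose, Matrix.transpose_sub, transpose_vecMulVec]

/-- The kernel can only shrink, and it does lose a vector w with b · w ≠ 0; the rank rises, but by
at most one. -/
theorem rank_sub_vecMulVec_notMem {M : Matrix ι κ K} {a : ι → K} {b : κ → K}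
    (ha : ∀ v, M *ᵥ v ≠ a) (hb : ∀ u, u ᵥ* M ≠ b) :
    (M - vecMulVec a b).rank = M.rank + 1 := by
  obtain ⟨w, hw, hbw⟩ := exists_ker_of_forall_vecMul_ne hb
  have ha0 : a ≠ 0 := fun h => ha 0 (by rw [h, Matrix.mulVec_zero])
  have hlt : LinearMap.ker (M - vecMulVec a b).mulVecLin < LinearMap.ker M.mulVecLin := by
    refine lt_of_le_of_ne (ker_sub_vecMulVec_le b ha) fun h => ?_
    have h1 : w ∈ LinearMap.ker M.mulVecLin := hw
    rw [← h, LinearMap.mem_ker, Matrix.mulVecLin_apply, Matrix.sub_mulVec,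
      Matrix.vecMulVec_mulVec, hw, zero_sub, neg_eq_zero] at h1
    obtain ⟨i, hi⟩ := Function.ne_iff.1 ha0
    have := congrFun h1 i
    simp at this
    exact this.elim hi hbw
  have h2 := Submodule.finrank_lt_finrank_of_lt hlt
  have h3 := rank_add_finrank_ker_mulVecLin M
  have h4 := rank_add_finrank_ker_mulVecLin (M - vecMulVec a b)
  have h5 := rank_sub_vecMulVec_le M a b
  omega

/-- Wedderburn's rank reduction: the kernel of M survives and v joins it, while the rank drops by at
most one. -/
theorem rank_sub_vecMulVec_eq_one {M : Matrix ι κ K} {u : ι → K} {v : κ → K}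
    (h1 : (u ᵥ* M) ⬝ᵥ v = 1) :
    (M - vecMulVec (M *ᵥ v) (u ᵥ* M)).rank + 1 = M.rank := by
  have hlt : LinearMap.ker M.mulVecLin
      < LinearMap.ker (M - vecMulVec (M *ᵥ v) (u ᵥ* M)).mulVecLin := by
    refine lt_of_le_of_ne (fun w hw => ?_) fun h => ?_
    · have hw' : M *ᵥ w = 0 := hw
      rw [LinearMap.mem_ker, Matrix.mulVecLin_apply, Matrix.sub_mulVec,
        Matrix.vecMulVec_mulVec, hw', dotProduct_eq_zero_of_vecMul hw']
      simp
    · have h2 : v ∈ LinearMap.ker M.mulVecLin := by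
        rw [h, LinearMap.mem_ker, Matrix.mulVecLin_apply, Matrix.sub_mulVec,
          Matrix.vecMulVec_mulVec, h1]
        simp
      have h3 : M *ᵥ v = 0 := h2
      rw [dotProduct_eq_zero_of_vecMul h3] at h1
      exact zero_ne_one h1
  have h2 := Submodule.finrank_lt_finrank_of_lt hlt
  have h3 := rank_add_finrank_ker_mulVecLin M
  have h4 := rank_add_finrank_ker_mulVecLin (M - vecMulVec (M *ᵥ v) (u ᵥ* M))
  have h5 := rank_le_rank_sub_vecMulVec M (M *ᵥ v) (u ᵥ* M)
  omega

theorem exists_rank_sub_vecMulVec {M : Matrix ι κ K} (hM : M ≠ 0) :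
    ∃ a b, a ≠ 0 ∧ b ≠ 0 ∧ (M - vecMulVec a b).rank + 1 = M.rank := by
  classical
  obtain ⟨i, j, hij⟩ : ∃ i j, M i j ≠ 0 := by
    by_contra! h
    exact hM (Matrix.ext h)
  -- A nonzero entry of M serves as pivot, scaled so that uMv = 1.
  set u : ι → K := Pi.single i (M i j)⁻¹
  set v : κ → K := Pi.single j 1
  have h1 : (u ᵥ* M) ⬝ᵥ v = 1 := by
    simp [u, v, hij]
  refine ⟨_, _, ?_, ?_, rank_sub_vecMulVec_eq_one h1⟩
  · intro h0
    rw [dotProduct_eq_zero_of_vecMul h0] at h1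
    exact zero_ne_one h1
  · intro h0
    rw [h0, zero_dotProduct] at h1
    exact zero_ne_one h1

theorem rank_eq_one_iff {M : Matrix ι κ K} :
    M.rank = 1 ↔ ∃ a b, a ≠ 0 ∧ b ≠ 0 ∧ M = vecMulVec a b := by
  constructor
  · intro h
    have hM : M ≠ 0 := by
      rintro rfl
      simp at h
    obtain ⟨a, b, ha, hb, hab⟩ := exists_rank_sub_vecMulVec hM
    exact ⟨a, b, ha, hb, sub_eq_zero.1 (eq_zero_of_rank_eq_zero (by omega))⟩
  · rintro ⟨a, b, ha, hb, rfl⟩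
    exact rank_vecMulVec_of_ne_zero ha hb

end Rank

/-! ### The distance in the bilinear forms graph -/

section Distance

variable {K : Type*} [Field K] [Fintype K] [DecidableEq K] {D N : ℕ}

theorem rank_sub_comm {ι κ : Type*} [Fintype ι] [Fintype κ] (u v : Matrix ι κ K) :
    (u - v).rank = (v - u).rank := by
  rw [← rank_neg, neg_sub]

theorem rank_sub_le_length {u v : Vert K D N} (p : (graph K D N).Walk u v) :
    (u - v).rank ≤ p.length := by
  induction p with
  | nil => simp
  | @cons u v w h p ih =>
    have h1 : (u - v).rank = 1 := h
    have h2 := rank_add_le (u - v) (v - w)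
    rw [sub_add_sub_cancel] at h2
    rw [SimpleGraph.Walk.length_cons]
    omega

/-- Each Wedderburn reduction of u − v is one edge of a walk from u towards v. -/
theorem exists_walk_length_eq_rank (r : ℕ) : ∀ u v : Vert K D N, (u - v).rank = r →
    ∃ p : (graph K D N).Walk u v, p.length = r := by
  induction r with
  | zero =>
    intro u v h
    obtain rfl := sub_eq_zero.1 (eq_zero_of_rank_eq_zero h)
    exact ⟨SimpleGraph.Walk.nil, rfl⟩
  | succ r ih =>
    intro u v h
    have hne : u - v ≠ 0 := by
      intro h0
      rw [h0, Matrix.rank_zero] at h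
      omega
    obtain ⟨a, b, ha, hb, hab⟩ := exists_rank_sub_vecMulVec hne
    obtain ⟨p, hp⟩ := ih (u - Matrix.vecMulVec a b) v (by
      rw [sub_right_comm]; omega)
    have hadj : (graph K D N).Adj u (u - Matrix.vecMulVec a b) := by
      change (u - (u - Matrix.vecMulVec a b)).rank = 1
      rw [sub_sub_cancel]
      exact rank_vecMulVec_of_ne_zero ha hb
    exact ⟨SimpleGraph.Walk.cons hadj p, by rw [SimpleGraph.Walk.length_cons, hp]⟩

theorem dist_eq_rank (u v : Vert K D N) : (graph K D N).dist u v = (u - v).rank := by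
  obtain ⟨p, hp⟩ := exists_walk_length_eq_rank _ u v rfl
  obtain ⟨p', hp'⟩ := (SimpleGraph.Walk.reachable p).exists_walk_length_eq_dist
  have h1 := rank_sub_le_length p'
  have h2 := SimpleGraph.dist_le p
  omega

end Distance

/-! ### Counting over a finite field -/

section Counting

open Matrix Finset

variable {K V E : Type*} [Field K] [Fintype K] [DecidableEq K] [AddCommGroup V] [Module K V]
  [Fintype V] [DecidableEq V]

open Classical in
theorem card_filter_mem_submodule (U : Submodule K V) :
    #{v | v ∈ U} = Fintype.card K ^ Module.finrank K U := by
  rw [← Module.card_eq_pow_finrank (K := K) (V := U), Fintype.card_subtype]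

open Classical in
-- The fibres over U of a functional nonzero on U are translates of one another along a vector u
-- with f u ≠ 0, so all have the same size c.
theorem sum_submodule_comp_linear [AddCommMonoid E] (U : Submodule K V) (f : V →ₗ[K] K)
    (hf : ∃ u ∈ U, f u ≠ 0) {c : ℕ} (hc : #{v | v ∈ U} = Fintype.card K * c) (F : K → E) :
    ∑ v with v ∈ U, F (f v) = c • ∑ t, F t := by
  have hfib : ∀ t, #{v ∈ ({v | v ∈ U} : Finset V) | f v = t} = c := by
    obtain ⟨u, hu, hfu⟩ := hf
    have hconst : ∀ t, #{v ∈ ({v | v ∈ U} : Finset V) | f v = t}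
        = #{v ∈ ({v | v ∈ U} : Finset V) | f v = 0} := by
      intro t
      refine Finset.card_bij' (fun v _ => v - (t / f u) • u) (fun v _ => v + (t / f u) • u)
        ?_ ?_ ?_ ?_
      · intro v hv
        simp only [mem_filter, mem_univ, true_and] at hv ⊢
        refine ⟨U.sub_mem hv.1 (U.smul_mem _ hu), ?_⟩
        rw [map_sub, map_smul, smul_eq_mul, div_mul_cancel₀ _ hfu, hv.2, sub_self]
      · intro v hv
        simp only [mem_filter, mem_univ, true_and] at hv ⊢
        refine ⟨U.add_mem hv.1 (U.smul_mem _ hu), ?_⟩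
        rw [map_add, map_smul, smul_eq_mul, div_mul_cancel₀ _ hfu, hv.2, zero_add]
      · intro v _
        simp
      · intro v _
        simp
    have htot := Finset.card_eq_sum_card_fiberwise (s := ({v | v ∈ U} : Finset V)) (f := f)
      (t := Finset.univ) (fun _ _ => by simp)
    rw [hc, Finset.sum_congr rfl (fun t _ => hconst t), Finset.sum_const, Finset.card_univ,
      smul_eq_mul] at htot
    intro t
    rw [hconst t]
    exact (Nat.eq_of_mul_eq_mul_left Fintype.card_pos htot).symm
  rw [← Finset.sum_fiberwise_of_maps_to (s := ({v | v ∈ U} : Finset V)) (t := Finset.univ)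
    (g := f) (fun _ _ => Finset.mem_univ _), Finset.smul_sum]
  refine Finset.sum_congr rfl fun t _ => ?_
  rw [Finset.sum_congr rfl (g := fun _ => F t) (fun v hv => by rw [(Finset.mem_filter.1 hv).2]),
    Finset.sum_const, hfib]

variable {ι κ : Type*} [Fintype ι] [Fintype κ] [DecidableEq ι] [DecidableEq κ]

theorem smul_vecMulVec_inj {a a' : ι → K} {b b' : κ → K} (ha' : a' ≠ 0) (hb' : b' ≠ 0)
    (h : vecMulVec a b = vecMulVec a' b') : ∃ c : Kˣ, a = c • a' ∧ b = c⁻¹ • b' := by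
  obtain ⟨i, hi⟩ := Function.ne_iff.1 ha'
  obtain ⟨j, hj⟩ := Function.ne_iff.1 hb'
  simp only [Pi.zero_apply] at hi hj
  have h' : ∀ i j, a i * b j = a' i * b' j := fun i j => congrFun (congrFun h i) j
  have hij := h' i j
  have hne : a i * b j ≠ 0 := by rw [hij]; exact mul_ne_zero hi hj
  have hai := left_ne_zero_of_mul hne
  have hbj := right_ne_zero_of_mul hne
  refine ⟨Units.mk0 (b' j / b j) (div_ne_zero hj hbj), ?_, ?_⟩
  · ext l
    simp only [Units.smul_def, Units.val_mk0, Pi.smul_apply, smul_eq_mul]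
    field_simp
    linear_combination h' l j
  · ext l
    simp only [Units.smul_def, Units.val_inv_eq_inv_val, Units.val_mk0, Pi.smul_apply, smul_eq_mul]
    field_simp
    have e : a i * (b l * b' j - b j * b' l) = 0 := by
      have := h' i l
      linear_combination b' j * this - b' l * hij
    exact sub_eq_zero.1 ((mul_eq_zero.1 e).resolve_left hai)

theorem units_smul_vecMulVec (c : Kˣ) (a : ι → K) (b : κ → K) :
    vecMulVec (c • a) (c⁻¹ • b) = vecMulVec a b := by
  ext i j
  simp only [vecMulVec_apply, Units.smul_def, Pi.smul_apply, smul_eq_mul,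
    Units.val_inv_eq_inv_val]
  field_simp

/-- The rank-one matrices. -/
def rankOne (ι κ K : Type*) [Field K] [Fintype K] [DecidableEq K] [Fintype ι] [Fintype κ]
    [DecidableEq ι] [DecidableEq κ] : Finset (Matrix ι κ K) :=
  {W | W.rank = 1}

theorem mem_rankOne {W : Matrix ι κ K} : W ∈ rankOne ι κ K ↔ W.rank = 1 := by
  simp [rankOne]

/-- The factorisations of a rank-one matrix form one free orbit of the q − 1 units under (a, b) ↦
(ca, c⁻¹b). Sums over rank-one matrices thus become double sums over nonzero vectors, without
division. -/
theorem card_sub_one_nsmul_sum_rankOne [AddCommMonoid E] (F : Matrix ι κ K → E) :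
    (Fintype.card K - 1) • ∑ W ∈ rankOne ι κ K, F W
      = ∑ a ∈ univ.erase (0 : ι → K), ∑ b ∈ univ.erase (0 : κ → K), F (vecMulVec a b) := by
  rw [← Finset.sum_product', ← Finset.sum_fiberwise_of_maps_to (t := rankOne ι κ K)
    (g := fun p : (ι → K) × (κ → K) => vecMulVec p.1 p.2), Finset.smul_sum]
  · refine Finset.sum_congr rfl fun W hW => ?_
    rw [Finset.sum_congr rfl (g := fun _ => F W)
      (fun v hv => by rw [(Finset.mem_filter.1 hv).2]), Finset.sum_const]
    congr 1
    obtain ⟨a, b, ha, hb, rfl⟩ := rank_eq_one_iff.1 (mem_rankOne.1 hW)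
    rw [← Fintype.card_units, ← Finset.card_univ]
    refine Finset.card_bij (fun c _ => (c • a, c⁻¹ • b)) ?_ ?_ ?_
    · intro c _
      simp only [mem_filter, mem_product, mem_erase, mem_univ, and_true, units_smul_vecMulVec]
      exact ⟨(smul_ne_zero_iff_ne c).2 ha, (smul_ne_zero_iff_ne _).2 hb⟩
    · intro c _ c' _ h
      obtain ⟨i, hi⟩ := Function.ne_iff.1 ha
      have h1 := congrFun (Prod.mk.inj h).1 i
      simp only [Units.smul_def, Pi.smul_apply, smul_eq_mul] at h1
      exact Units.ext (mul_right_cancel₀ hi h1)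
    · rintro ⟨a', b'⟩ hp
      simp only [mem_filter, mem_product, mem_erase, mem_univ, and_true] at hp
      obtain ⟨c, h1, h2⟩ := smul_vecMulVec_inj ha hb hp.2
      exact ⟨c, Finset.mem_univ _, by rw [h1, h2]⟩
  · rintro ⟨a, b⟩ hp
    simp only [mem_product, mem_erase, mem_univ, and_true] at hp
    exact mem_rankOne.2 (rank_vecMulVec_of_ne_zero hp.1 hp.2)

/-- The rank of the difference of two rank-one matrices is 0 if they agree, 1 if they differ but
share the column line or the row line, and 2 otherwise. Inclusion and exclusion applies to the two
sharing families, which meet in the nonzero multiples of the given matrix. -/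
theorem sum_rankOne_theta_rank_sub (θ : ℕ → ℝ) (φ : Matrix ι κ K → ℝ) {a : ι → K} {b : κ → K}
    (ha : a ≠ 0) (hb : b ≠ 0) :
    ∑ W ∈ rankOne ι κ K, θ (vecMulVec a b - W).rank * φ W
      = θ 2 * ∑ W ∈ rankOne ι κ K, φ W
        + (θ 1 - θ 2) * (∑ b' ∈ univ.erase (0 : κ → K), φ (vecMulVec a b')
          + ∑ a' ∈ univ.erase (0 : ι → K), φ (vecMulVec a' b)
          - ∑ c ∈ univ.erase (0 : K), φ (c • vecMulVec a b))
        + (θ 0 - θ 1) * φ (vecMulVec a b) := by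
  obtain ⟨i, hi⟩ := Function.ne_iff.1 ha
  obtain ⟨j, hj⟩ := Function.ne_iff.1 hb
  simp only [Pi.zero_apply] at hi hj
  have injA : ∀ b₁ b₂ : κ → K, vecMulVec a b₁ = vecMulVec a b₂ → b₁ = b₂ := fun b₁ b₂ h => by
    ext l
    exact mul_left_cancel₀ hi (congrFun (congrFun h i) l)
  have injB : ∀ a₁ a₂ : ι → K, vecMulVec a₁ b = vecMulVec a₂ b → a₁ = a₂ := fun a₁ a₂ h => by
    ext l
    exact mul_right_cancel₀ hj (congrFun (congrFun h l) j)
  set A := (univ.erase (0 : κ → K)).image (fun b' => vecMulVec a b') with hA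
  set B := (univ.erase (0 : ι → K)).image (fun a' => vecMulVec a' b) with hB
  have hAsub : A ⊆ rankOne ι κ K := by
    intro W hW
    obtain ⟨b', hb', rfl⟩ := Finset.mem_image.1 hW
    exact mem_rankOne.2 (rank_vecMulVec_of_ne_zero ha (Finset.ne_of_mem_erase hb'))
  have hBsub : B ⊆ rankOne ι κ K := by
    intro W hW
    obtain ⟨b', hb', rfl⟩ := Finset.mem_image.1 hW
    exact mem_rankOne.2 (rank_vecMulVec_of_ne_zero (Finset.ne_of_mem_erase hb') hb)
  have hAB : A ∩ B = (univ.erase (0 : K)).image (fun c => c • vecMulVec a b) := by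
    ext W
    simp only [hA, hB, Finset.mem_inter, Finset.mem_image, mem_erase, mem_univ, and_true]
    constructor
    · rintro ⟨⟨b', hb', rfl⟩, a', ha', h⟩
      obtain ⟨c, h1, h2⟩ := smul_vecMulVec_inj ha hb' h
      refine ⟨c, c.ne_zero, ?_⟩
      rw [← vecMulVec_smul, h2, Units.smul_def, smul_smul]
      simp
    · rintro ⟨c, hc, rfl⟩
      exact ⟨⟨c • b, smul_ne_zero hc hb, vecMulVec_smul _ _ _⟩,
        ⟨c • a, smul_ne_zero hc ha, smul_vecMulVec _ _ _⟩⟩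
  have hz : vecMulVec a b ∈ rankOne ι κ K := mem_rankOne.2 (rank_vecMulVec_of_ne_zero ha hb)
  have key : ∀ W ∈ rankOne ι κ K, θ (vecMulVec a b - W).rank * φ W
      = θ 2 * φ W + (θ 1 - θ 2) * ((if W ∈ A then φ W else 0) + (if W ∈ B then φ W else 0)
        - (if W ∈ A ∩ B then φ W else 0))
        + (θ 0 - θ 1) * (if W = vecMulVec a b then φ W else 0) := by
    intro W hW
    by_cases hWz : W = vecMulVec a b
    · have h1 : W ∈ A := Finset.mem_image.2 ⟨b, by simp [hb], hWz.symm⟩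
      have h2 : W ∈ B := Finset.mem_image.2 ⟨a, by simp [ha], hWz.symm⟩
      rw [if_pos h1, if_pos h2, if_pos (Finset.mem_inter.2 ⟨h1, h2⟩), if_pos hWz, hWz, sub_self,
        Matrix.rank_zero]
      ring
    · rw [if_neg hWz]
      by_cases h1 : W ∈ A
      · have hr : (vecMulVec a b - W).rank = 1 := by
          obtain ⟨b', hb', rfl⟩ := Finset.mem_image.1 h1
          rw [← vecMulVec_sub]
          refine rank_vecMulVec_of_ne_zero ha (sub_ne_zero.2 ?_)
          rintro rfl
          exact hWz rfl
        rw [hr]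
        by_cases h2 : W ∈ B
        · rw [if_pos h1, if_pos h2, if_pos (Finset.mem_inter.2 ⟨h1, h2⟩)]
          ring
        · rw [if_pos h1, if_neg h2, if_neg (fun h => h2 (Finset.mem_inter.1 h).2)]
          ring
      · by_cases h2 : W ∈ B
        · have hr : (vecMulVec a b - W).rank = 1 := by
            obtain ⟨a', ha', rfl⟩ := Finset.mem_image.1 h2
            rw [← sub_vecMulVec]
            refine rank_vecMulVec_of_ne_zero (sub_ne_zero.2 ?_) hb
            rintro rfl
            exact hWz rfl
          rw [hr, if_neg h1, if_pos h2, if_neg (fun h => h1 (Finset.mem_inter.1 h).1)]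
          ring
        · have hr : (vecMulVec a b - W).rank = 2 := by
            obtain ⟨a', b', ha', hb', rfl⟩ := rank_eq_one_iff.1 (mem_rankOne.1 hW)
            rw [rank_sub_vecMulVec_notMem, rank_vecMulVec_of_ne_zero ha hb]
            · intro v hv
              rw [vecMulVec_mulVec] at hv
              refine h1 (Finset.mem_image.2 ⟨(b ⬝ᵥ v) • b', ?_, ?_⟩)
              · simp only [mem_erase, mem_univ, and_true]
                refine smul_ne_zero (fun h0 => ha' ?_) hb'
                rw [← hv, h0]
                simp
              · rw [← hv]
                ext; simp [vecMulVec_apply]; ring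
            · intro u hu
              rw [vecMul_vecMulVec] at hu
              refine h2 (Finset.mem_image.2 ⟨(u ⬝ᵥ a) • a', ?_, ?_⟩)
              · simp only [mem_erase, mem_univ, and_true]
                refine smul_ne_zero (fun h0 => hb' ?_) ha'
                rw [← hu, h0]
                simp
              · rw [← hu]
                ext; simp [vecMulVec_apply]; ring
          rw [hr, if_neg h1, if_neg h2, if_neg (fun h => h1 (Finset.mem_inter.1 h).1)]
          ring
  rw [Finset.sum_congr rfl key, Finset.sum_add_distrib, Finset.sum_add_distrib, ← Finset.mul_sum,
    ← Finset.mul_sum, ← Finset.mul_sum, Finset.sum_sub_distrib, Finset.sum_add_distrib,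
    Finset.sum_ite_mem, Finset.sum_ite_mem, Finset.sum_ite_mem, Finset.sum_ite_eq', if_pos hz,
    Finset.inter_eq_right.2 hAsub, Finset.inter_eq_right.2 hBsub,
    Finset.inter_eq_right.2 (Finset.inter_subset_left.trans hAsub), hAB, hA, hB,
    Finset.sum_image (fun _ _ _ _ h => injA _ _ h), Finset.sum_image (fun _ _ _ _ h => injB _ _ h),
    Finset.sum_image]
  intro c _ c' _ h
  have := congrFun (congrFun h i) j
  simp only [Matrix.smul_apply, vecMulVec_apply, smul_eq_mul] at this
  exact mul_right_cancel₀ (mul_ne_zero hi hj) this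

end Counting

/-! ### Classes of rank-one matrices relative to a fixed matrix -/

section Classes

open Matrix Finset

variable {K ι κ : Type*} [Field K] [Fintype K] [DecidableEq K] [Fintype ι] [Fintype κ]
  [DecidableEq ι] [DecidableEq κ]

/-- The class of `W` relative to a matrix `M` with generalized inverse `G`: it records whether the
column space and the row space of `W` lie in those of `M` and, if both do, the trace of `G * W`. -/
def cls (M : Matrix ι κ K) (G : Matrix κ ι K) (W : Matrix ι κ K) : Fin 6 :=
  if M * G * W = W then
    if W * G * M = W then if (G * W).trace = 1 then 0 else if (G * W).trace = 0 then 1 else 2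
    else 3
  else if W * G * M = W then 4 else 5

/-- Transposition exchanges the column and row conditions, so column sums can be deduced from row
sums. -/
theorem cls_transpose (M : Matrix ι κ K) (G : Matrix κ ι K) (W : Matrix ι κ K) :
    cls Mᵀ Gᵀ Wᵀ = Equiv.swap 3 4 (cls M G W) := by
  have h1 : Mᵀ * Gᵀ * Wᵀ = Wᵀ ↔ W * G * M = W := by
    rw [← Matrix.transpose_mul, ← Matrix.transpose_mul, Matrix.transpose_inj, ← Matrix.mul_assoc]
  have h2 : Wᵀ * Gᵀ * Mᵀ = Wᵀ ↔ M * G * W = W := by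
    rw [← Matrix.transpose_mul, ← Matrix.transpose_mul, Matrix.transpose_inj, ← Matrix.mul_assoc]
  have h3 : (Gᵀ * Wᵀ).trace = (G * W).trace := by
    rw [← Matrix.transpose_mul, Matrix.trace_transpose, Matrix.trace_mul_comm]
  unfold cls
  rw [h3]
  simp only [h1, h2]
  split_ifs <;> rfl

theorem cls_neg (M : Matrix ι κ K) (G : Matrix κ ι K) (W : Matrix ι κ K) :
    cls (-M) (-G) (-W) = cls M G W := by
  simp [cls]

variable {M : Matrix ι κ K} {G : Matrix κ ι K}

theorem mulVec_mulVec_eq_iff (hG : M * G * M = M) {a : ι → K} :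
    M *ᵥ (G *ᵥ a) = a ↔ a ∈ LinearMap.range M.mulVecLin := by
  constructor
  · exact fun h => ⟨_, h⟩
  · rintro ⟨v, rfl⟩
    rw [Matrix.mulVecLin_apply, Matrix.mulVec_mulVec, Matrix.mulVec_mulVec, hG]

theorem vecMul_vecMul_eq_iff (hG : M * G * M = M) {b : κ → K} :
    (b ᵥ* G) ᵥ* M = b ↔ b ∈ LinearMap.range M.vecMulLinear := by
  constructor
  · exact fun h => ⟨_, h⟩
  · rintro ⟨v, rfl⟩
    rw [Matrix.vecMulLinear_apply, Matrix.vecMul_vecMul, Matrix.vecMul_vecMul, ← Matrix.mul_assoc, hG]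

theorem mul_mul_vecMulVec_eq_iff (hG : M * G * M = M) {a : ι → K} {b : κ → K} (hb : b ≠ 0) :
    M * G * vecMulVec a b = vecMulVec a b ↔ a ∈ LinearMap.range M.mulVecLin := by
  rw [← mulVec_mulVec_eq_iff hG, Matrix.mul_vecMulVec, Matrix.mulVec_mulVec]
  constructor
  · intro h
    obtain ⟨j, hj⟩ := Function.ne_iff.1 hb
    ext i
    exact mul_right_cancel₀ hj (congrFun (congrFun h i) j)
  · intro h
    rw [h]

theorem vecMulVec_mul_mul_eq_iff (hG : M * G * M = M) {a : ι → K} {b : κ → K} (ha : a ≠ 0) :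
    vecMulVec a b * G * M = vecMulVec a b ↔ b ∈ LinearMap.range M.vecMulLinear := by
  rw [← vecMul_vecMul_eq_iff hG, Matrix.vecMulVec_mul, Matrix.vecMulVec_mul]
  constructor
  · intro h
    obtain ⟨i, hi⟩ := Function.ne_iff.1 ha
    ext j
    exact mul_left_cancel₀ hi (congrFun (congrFun h i) j)
  · intro h
    rw [h]

theorem trace_mul_vecMulVec (G : Matrix κ ι K) (a : ι → K) (b : κ → K) :
    (G * vecMulVec a b).trace = b ⬝ᵥ (G *ᵥ a) := by
  rw [Matrix.mul_vecMulVec, Matrix.trace_vecMulVec, dotProduct_comm]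

open Classical in
-- For a = Mv and b = uM the scalar b · Ga equals uMv, so the class of a rank-one matrix does not
-- depend on the choice of G.
theorem cls_vecMulVec (hG : M * G * M = M) {a : ι → K} {b : κ → K} (ha : a ≠ 0) (hb : b ≠ 0) :
    cls M G (vecMulVec a b) =
      if a ∈ LinearMap.range M.mulVecLin then
        if b ∈ LinearMap.range M.vecMulLinear then
          if b ⬝ᵥ (G *ᵥ a) = 1 then 0 else if b ⬝ᵥ (G *ᵥ a) = 0 then 1 else 2
        else 3
      else if b ∈ LinearMap.range M.vecMulLinear then 4 else 5 := by
  simp only [cls, mul_mul_vecMulVec_eq_iff hG hb, vecMulVec_mul_mul_eq_iff hG ha,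
    trace_mul_vecMulVec]

/-- Only class 0 lowers the rank and only class 5 raises it; the four middle classes are
indistinguishable by distance alone. -/
theorem rank_sub_of_cls (hG : M * G * M = M) {W : Matrix ι κ K} (hW : W ∈ rankOne ι κ K) :
    (M - W).rank = (![M.rank - 1, M.rank, M.rank, M.rank, M.rank, M.rank + 1] : Fin 6 → ℕ)
      (cls M G W) := by
  obtain ⟨a, b, ha, hb, rfl⟩ := rank_eq_one_iff.1 (mem_rankOne.1 hW)
  rw [cls_vecMulVec hG ha hb]
  have hC : ¬ a ∈ LinearMap.range M.mulVecLin → ∀ v, M *ᵥ v ≠ a := fun h v hv => h ⟨v, hv⟩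
  have hR : ¬ b ∈ LinearMap.range M.vecMulLinear → ∀ u, u ᵥ* M ≠ b := fun h u hu => h ⟨u, hu⟩
  split_ifs with h1 h2 h3 h4 h2
  · have e1 := (mulVec_mulVec_eq_iff hG).2 h1
    have e2 := (vecMul_vecMul_eq_iff hG).2 h2
    have h := rank_sub_vecMulVec_eq_one (M := M) (u := b ᵥ* G) (v := G *ᵥ a) (by rw [e2, h3])
    rw [e1, e2] at h
    simp only [Matrix.cons_val_zero]
    omega
  · exact rank_sub_vecMulVec_of_mulVec ((mulVec_mulVec_eq_iff hG).2 h1) h3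
  · exact rank_sub_vecMulVec_of_mulVec ((mulVec_mulVec_eq_iff hG).2 h1) h3
  · obtain ⟨v, rfl⟩ := h1
    exact rank_sub_vecMulVec_row_notMem (hR h2)
  · obtain ⟨u, rfl⟩ := h2
    exact rank_sub_vecMulVec_col_notMem (hC h1)
  · exact rank_sub_vecMulVec_notMem (hC h1) (hR h2)

theorem finrank_range_vecMulLinear (M : Matrix ι κ K) :
    Module.finrank K (LinearMap.range M.vecMulLinear) = M.rank := by
  rw [← Matrix.rank_transpose, Matrix.rank, Matrix.mulVecLin_transpose]

theorem sum_trace_class (g : Fin 6 → ℝ) :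
    ∑ t : K, g (if t = 1 then 0 else if t = 0 then 1 else 2)
      = g 0 + g 1 + (Fintype.card K - 2) * g 2 := by
  have h : ∀ t : K, g (if t = 1 then 0 else if t = 0 then 1 else 2)
      = g 2 + ((if t = 1 then g 0 - g 2 else 0) + (if t = 0 then g 1 - g 2 else 0)) := by
    intro t
    by_cases h1 : t = 1
    · subst h1; simp
    · by_cases h0 : t = 0
      · subst h0; simp
      · simp [h1, h0]
  rw [Finset.sum_congr rfl (fun t _ => h t), Finset.sum_add_distrib, Finset.sum_add_distrib,
    Finset.sum_ite_eq', Finset.sum_ite_eq', Finset.sum_const, Finset.card_univ]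
  simp
  ring

/-- On the row space, of dimension r + 1, the functional b ↦ b · Ga is nonzero because a ≠ 0 lies in
the column space; hence it takes each value q ^ r times. Every b outside the row space gives class
3. -/
theorem sum_cls_row_of_mem (hG : M * G * M = M) {r : ℕ} (hr : M.rank = r + 1) {a : ι → K}
    (ha : a ≠ 0) (hC : a ∈ LinearMap.range M.mulVecLin) (g : Fin 6 → ℝ) :
    ∑ b ∈ univ.erase (0 : κ → K), g (cls M G (vecMulVec a b))
      = (Fintype.card K : ℝ) ^ r * g 0 + ((Fintype.card K : ℝ) ^ r - 1) * g 1
        + (Fintype.card K - 2) * (Fintype.card K : ℝ) ^ r * g 2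
        + ((Fintype.card K : ℝ) ^ Fintype.card κ - (Fintype.card K : ℝ) ^ (r + 1)) * g 3 := by
  classical
  set F : K → ℝ := fun t => g (if t = 1 then 0 else if t = 0 then 1 else 2) with hF
  set R := LinearMap.range M.vecMulLinear with hRdef
  set f : (κ → K) →ₗ[K] K := dotProductEquiv K κ (G *ᵥ a) with hf
  have hfb : ∀ b, f b = b ⬝ᵥ (G *ᵥ a) := fun b => by
    rw [hf, dotProductEquiv_apply_apply, dotProduct_comm]
  have hcard : #{b | b ∈ R} = Fintype.card K * Fintype.card K ^ r := by
    rw [card_filter_mem_submodule, hRdef, finrank_range_vecMulLinear, hr, pow_succ, mul_comm]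
  have hne : ∃ b ∈ R, f b ≠ 0 := by
    obtain ⟨i, hi⟩ := Function.ne_iff.1 ha
    refine ⟨Pi.single i 1 ᵥ* M, ⟨_, rfl⟩, ?_⟩
    rw [hfb, ← Matrix.dotProduct_mulVec, (mulVec_mulVec_eq_iff hG).2 hC]
    simpa using hi
  have hsumR := sum_submodule_comp_linear R f hne hcard F
  have h1 : ∀ b ∈ univ.erase (0 : κ → K), g (cls M G (vecMulVec a b))
      = if b ∈ R then F (f b) else g 3 := by
    intro b hb
    rw [cls_vecMulVec hG ha (Finset.ne_of_mem_erase hb), if_pos hC, hfb, hF]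
    dsimp only
    split_ifs <;> rfl
  -- The excluded vector b = 0 lies in the row space with scalar 0, whence the −1 in the coefficient
  -- of `g 1`.
  rw [Finset.sum_congr rfl h1, Finset.sum_erase_eq_sub (Finset.mem_univ _), if_pos R.zero_mem,
    Finset.sum_ite, hsumR, Finset.sum_const, Finset.filter_not,
    Finset.card_sdiff_of_subset (Finset.filter_subset _ _), Finset.card_univ, hcard,
    Fintype.card_fun, hF, sum_trace_class]
  have hle : Fintype.card K * Fintype.card K ^ r ≤ Fintype.card K ^ Fintype.card κ := by
    rw [← hcard]
    exact (Finset.card_le_univ _).trans (by rw [Fintype.card_fun])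
  simp only [map_zero, zero_ne_one, if_false, if_true, nsmul_eq_mul]
  rw [Nat.cast_sub hle]
  push_cast
  ring

theorem sum_cls_row_of_notMem (hG : M * G * M = M) {a : ι → K}
    (hC : a ∉ LinearMap.range M.mulVecLin) (g : Fin 6 → ℝ) :
    ∑ b ∈ univ.erase (0 : κ → K), g (cls M G (vecMulVec a b))
      = ((Fintype.card K : ℝ) ^ M.rank - 1) * g 4
        + ((Fintype.card K : ℝ) ^ Fintype.card κ - (Fintype.card K : ℝ) ^ M.rank) * g 5 := by
  classical
  have ha : a ≠ 0 := fun h => hC (h ▸ Submodule.zero_mem _)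
  set R := LinearMap.range M.vecMulLinear with hRdef
  have hcard : #{b | b ∈ R} = Fintype.card K ^ M.rank := by
    rw [card_filter_mem_submodule, hRdef, finrank_range_vecMulLinear]
  have h1 : ∀ b ∈ univ.erase (0 : κ → K), g (cls M G (vecMulVec a b))
      = if b ∈ R then g 4 else g 5 := by
    intro b hb
    rw [cls_vecMulVec hG ha (Finset.ne_of_mem_erase hb), if_neg hC]
    split_ifs <;> rfl
  have hle : Fintype.card K ^ M.rank ≤ Fintype.card K ^ Fintype.card κ := by
    rw [← hcard]
    exact (Finset.card_le_univ _).trans (by rw [Fintype.card_fun])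
  rw [Finset.sum_congr rfl h1, Finset.sum_erase_eq_sub (Finset.mem_univ _), if_pos R.zero_mem,
    Finset.sum_ite, Finset.sum_const, Finset.sum_const, Finset.filter_not,
    Finset.card_sdiff_of_subset (Finset.filter_subset _ _), Finset.card_univ, hcard,
    Fintype.card_fun, nsmul_eq_mul, nsmul_eq_mul, Nat.cast_sub hle]
  push_cast
  ring

/-- The sum of `g` over the classes of the rank-one matrices `vecMulVec a b`, `b ≠ 0`, as a function
of the class of one of them; here `u` is `q ^ (rank M - 1)` and `n` is the number of row vectors. -/
def rowSum (q u n : ℝ) (g : Fin 6 → ℝ) : Fin 6 → ℝ :=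
  let r := u * g 0 + (u - 1) * g 1 + (q - 2) * u * g 2 + (n - q * u) * g 3
  let s := (q * u - 1) * g 4 + (n - q * u) * g 5
  ![r, r, r, r, s, s]

/-- The analogue of `rowSum` for the matrices `vecMulVec a b`, `a ≠ 0`. -/
def colSum (q u m : ℝ) (g : Fin 6 → ℝ) : Fin 6 → ℝ :=
  let r := u * g 0 + (u - 1) * g 1 + (q - 2) * u * g 2 + (m - q * u) * g 4
  let s := (q * u - 1) * g 3 + (m - q * u) * g 5
  ![r, r, r, s, r, s]

/-- The sum of `g` over the classes of the nonzero multiples of a matrix. -/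
def lineSum (q : ℝ) (g : Fin 6 → ℝ) : Fin 6 → ℝ :=
  ![g 0 + (q - 2) * g 2, (q - 1) * g 1, g 0 + (q - 2) * g 2, (q - 1) * g 3, (q - 1) * g 4,
    (q - 1) * g 5]

/-- The number of rank-one matrices in each class. -/
def clsCard (q u m n : ℝ) : Fin 6 → ℝ :=
  ![(q * u - 1) * u / (q - 1), (q * u - 1) * (u - 1) / (q - 1),
    (q * u - 1) * ((q - 2) * u) / (q - 1), (q * u - 1) * (n - q * u) / (q - 1),
    (m - q * u) * (q * u - 1) / (q - 1), (m - q * u) * (n - q * u) / (q - 1)]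

theorem sum_cls_row (hG : M * G * M = M) {r : ℕ} (hr : M.rank = r + 1) {a : ι → K} {b : κ → K}
    (ha : a ≠ 0) (hb : b ≠ 0) (g : Fin 6 → ℝ) :
    ∑ b' ∈ univ.erase (0 : κ → K), g (cls M G (vecMulVec a b'))
      = rowSum (Fintype.card K) (Fintype.card K ^ r) (Fintype.card K ^ Fintype.card κ) g
        (cls M G (vecMulVec a b)) := by
  rw [cls_vecMulVec hG ha hb]
  by_cases hC : a ∈ LinearMap.range M.mulVecLin
  · rw [sum_cls_row_of_mem hG hr ha hC, if_pos hC]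
    split_ifs <;> simp [rowSum, pow_succ']
  · rw [sum_cls_row_of_notMem hG hC, if_neg hC, hr]
    split_ifs <;> simp [rowSum, pow_succ']

theorem sum_cls_col (hG : M * G * M = M) {r : ℕ} (hr : M.rank = r + 1) {a : ι → K} {b : κ → K}
    (ha : a ≠ 0) (hb : b ≠ 0) (g : Fin 6 → ℝ) :
    ∑ a' ∈ univ.erase (0 : ι → K), g (cls M G (vecMulVec a' b))
      = colSum (Fintype.card K) (Fintype.card K ^ r) (Fintype.card K ^ Fintype.card ι) g
        (cls M G (vecMulVec a b)) := by
  have h := sum_cls_row (M := Mᵀ) (G := Gᵀ) (r := r)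
    (by rw [← Matrix.transpose_mul, ← Matrix.transpose_mul, ← Matrix.mul_assoc, hG])
    (by rw [Matrix.rank_transpose, hr]) hb ha (g ∘ Equiv.swap 3 4)
  have e : ∀ a', cls Mᵀ Gᵀ (vecMulVec b a') = Equiv.swap 3 4 (cls M G (vecMulVec a' b)) := by
    intro a'
    rw [← cls_transpose, transpose_vecMulVec]
  simp only [e, Function.comp_apply, Equiv.swap_apply_self] at h
  rw [h]
  generalize cls M G (vecMulVec a b) = i
  have e0 : Equiv.swap (3 : Fin 6) 4 0 = 0 := by decide
  have e1 : Equiv.swap (3 : Fin 6) 4 1 = 1 := by decide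
  have e2 : Equiv.swap (3 : Fin 6) 4 2 = 2 := by decide
  have e5 : Equiv.swap (3 : Fin 6) 4 5 = 5 := by decide
  fin_cases i <;> simp [rowSum, colSum, e0, e1, e2, e5]

theorem cls_smul {c : K} (hc : c ≠ 0) (W : Matrix ι κ K) :
    cls M G (c • W) = if M * G * W = W then
        if W * G * M = W then
          if c * (G * W).trace = 1 then 0 else if c * (G * W).trace = 0 then 1 else 2
        else 3
      else if W * G * M = W then 4 else 5 := by
  simp only [cls, Matrix.mul_smul, Matrix.smul_mul, Matrix.trace_smul, smul_eq_mul,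
    (smul_right_injective _ hc).eq_iff]

theorem sum_cls_line (W : Matrix ι κ K) (g : Fin 6 → ℝ) :
    ∑ c ∈ univ.erase (0 : K), g (cls M G (c • W))
      = lineSum (Fintype.card K) g (cls M G W) := by
  have hcard : ∀ x : ℝ, ∑ _c ∈ univ.erase (0 : K), x = (Fintype.card K - 1) * x := by
    intro x
    rw [Finset.sum_const, Finset.card_erase_of_mem (Finset.mem_univ _), Finset.card_univ,
      nsmul_eq_mul, Nat.cast_sub Fintype.card_pos, Nat.cast_one]
  rw [Finset.sum_congr rfl (fun c hc => by rw [cls_smul (Finset.ne_of_mem_erase hc)])]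
  unfold cls
  by_cases h1 : M * G * W = W
  · by_cases h2 : W * G * M = W
    · simp only [h1, h2, if_true]
      by_cases h0 : (G * W).trace = 0
      · simp [h0, hcard, lineSum]
      -- For nonzero trace, the scalars c times the trace run once over K, so each nonzero trace is
      -- met exactly once.
      · have hinj := Equiv.sum_comp (Equiv.mulRight₀ _ h0)
          (fun t : K => g (if t = 1 then 0 else if t = 0 then 1 else 2))
        rw [sum_trace_class] at hinj
        simp only [Equiv.mulRight₀_apply] at hinj
        rw [Finset.sum_erase_eq_sub (Finset.mem_univ _), hinj, zero_mul, if_neg zero_ne_one,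
          if_pos rfl, if_neg h0]
        split_ifs <;> simp [lineSum] <;> ring
    · simp [h1, h2, hcard, lineSum]
  · by_cases h2 : W * G * M = W
    · simp [h1, h2, hcard, lineSum]
    · simp [h1, h2, hcard, lineSum]

theorem sum_rankOne_cls (hG : M * G * M = M) {r : ℕ} (hr : M.rank = r + 1) (g : Fin 6 → ℝ) :
    ∑ W ∈ rankOne ι κ K, g (cls M G W)
      = ∑ i, clsCard (Fintype.card K) (Fintype.card K ^ r) (Fintype.card K ^ Fintype.card ι)
        (Fintype.card K ^ Fintype.card κ) i * g i := by
  classical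
  have hq : (1 : ℝ) < Fintype.card K := by exact_mod_cast Fintype.one_lt_card
  have hq' : (Fintype.card K : ℝ) - 1 ≠ 0 := by linarith
  have h := card_sub_one_nsmul_sum_rankOne (fun W : Matrix ι κ K => g (cls M G W))
  set C := LinearMap.range M.mulVecLin with hCdef
  have hcard : #{a | a ∈ C} = Fintype.card K ^ (r + 1) := by
    rw [card_filter_mem_submodule, hCdef, ← hr, Matrix.rank]
  have hle : Fintype.card K ^ (r + 1) ≤ Fintype.card K ^ Fintype.card ι := by
    rw [← hcard]
    exact (Finset.card_le_univ _).trans (by rw [Fintype.card_fun])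
  have h1 : ∀ a ∈ univ.erase (0 : ι → K),
      ∑ b ∈ univ.erase (0 : κ → K), g (cls M G (vecMulVec a b))
      = if a ∈ C then _ else _ := fun a ha => by
    split_ifs with hC
    · exact sum_cls_row_of_mem hG hr (Finset.ne_of_mem_erase ha) hC g
    · exact sum_cls_row_of_notMem hG hC g
  rw [Finset.sum_congr rfl h1, Finset.sum_erase_eq_sub (Finset.mem_univ _), if_pos C.zero_mem,
    Finset.sum_ite, Finset.sum_const, Finset.sum_const, Finset.filter_not,
    Finset.card_sdiff_of_subset (Finset.filter_subset _ _), Finset.card_univ, hcard,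
    Fintype.card_fun, nsmul_eq_mul, nsmul_eq_mul, nsmul_eq_mul, Nat.cast_sub hle,
    Nat.cast_sub Fintype.card_pos, hr, Nat.cast_one] at h
  rw [← mul_right_inj' hq', h]
  simp only [clsCard, Fin.sum_univ_six]
  simp only [Matrix.cons_val]
  push_cast
  field_simp
  ring

theorem card_filter_cls (hG : M * G * M = M) {r : ℕ} (hr : M.rank = r + 1) (i : Fin 6) :
    (#{W ∈ rankOne ι κ K | cls M G W = i} : ℝ)
      = clsCard (Fintype.card K) (Fintype.card K ^ r) (Fintype.card K ^ Fintype.card ι)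
        (Fintype.card K ^ Fintype.card κ) i := by
  have h := sum_rankOne_cls hG hr (fun j => if j = i then 1 else 0)
  rw [Finset.sum_boole] at h
  rw [h]
  simp

/-- A kernel depending on rank(W − W') preserves functions of the class. Used twice: with an
indicator for θ to count triangles, and with the dual eigenvalues to compute the Gram matrix. -/
theorem sum_rankOne_theta_cls (hG : M * G * M = M) {r : ℕ} (hr : M.rank = r + 1) (θ : ℕ → ℝ)
    (g : Fin 6 → ℝ) {W : Matrix ι κ K} (hW : W ∈ rankOne ι κ K) :
    ∑ W' ∈ rankOne ι κ K, θ (W - W').rank * g (cls M G W')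
      = θ 2 * ∑ i, clsCard (Fintype.card K) (Fintype.card K ^ r)
          (Fintype.card K ^ Fintype.card ι) (Fintype.card K ^ Fintype.card κ) i * g i
        + (θ 1 - θ 2) *
          (rowSum (Fintype.card K) (Fintype.card K ^ r) (Fintype.card K ^ Fintype.card κ) g
              (cls M G W)
            + colSum (Fintype.card K) (Fintype.card K ^ r) (Fintype.card K ^ Fintype.card ι) g
              (cls M G W)
            - lineSum (Fintype.card K) g (cls M G W))
        + (θ 0 - θ 1) * g (cls M G W) := by
  obtain ⟨a, b, ha, hb, rfl⟩ := rank_eq_one_iff.1 (mem_rankOne.1 hW)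
  rw [sum_rankOne_theta_rank_sub θ (fun W => g (cls M G W)) ha hb, sum_rankOne_cls hG hr,
    sum_cls_row hG hr ha hb, sum_cls_col hG hr ha hb, sum_cls_line]

end Classes

/-! ### The partition of a neighbourhood in terms of classes -/

section Partition

open Matrix Finset

variable {K : Type*} [Field K] [Fintype K] [DecidableEq K] {D N : ℕ}

theorem mem_sphere {x z : Vert K D N} {i : ℕ} : z ∈ sphere x i ↔ (z - x).rank = i := by
  rw [sphere, Finset.mem_filter, dist_eq_rank, rank_sub_comm]
  simp

theorem card_sphere_inter (x y z : Vert K D N) (j : ℕ) :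
    (#(sphere x 1 ∩ sphere z 1 ∩ sphere y j) : ℝ)
      = ∑ W ∈ rankOne (Fin D) (Fin (N - D)) K,
        (if ((z - x) - W).rank = 1 then 1 else 0) * (if ((y - x) - W).rank = j then 1 else 0) := by
  simp only [← ite_and, ite_mul, one_mul, zero_mul]
  rw [Finset.sum_boole]
  congr 1
  refine Finset.card_bij (fun w _ => w - x) ?_ ?_ ?_
  · intro w hw
    simp only [Finset.mem_inter, mem_sphere, Finset.mem_filter, mem_rankOne,
      sub_sub_sub_cancel_right] at hw ⊢
    rw [rank_sub_comm z, rank_sub_comm y]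
    exact ⟨hw.1.1, hw.1.2, hw.2⟩
  · intro w _ w' _ h
    exact sub_left_injective h
  · intro W hW
    refine ⟨W + x, ?_, by simp⟩
    simp only [Finset.mem_inter, mem_sphere, Finset.mem_filter, mem_rankOne] at hW ⊢
    rw [rank_sub_comm _ z, rank_sub_comm _ y, sub_add_eq_sub_sub_swap, sub_add_eq_sub_sub_swap,
      add_sub_cancel_right]
    exact ⟨⟨hW.1, hW.2.1⟩, hW.2.2⟩

/-- Distances to y single out classes 0 and 5. The middle classes are separated by the triangle
counts, which are class sums of the indicators of classes 0 and 5. -/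
theorem mem_part {x y : Vert K D N} {G : Matrix (Fin (N - D)) (Fin D) K}
    (hG : (y - x) * G * (y - x) = y - x) (h1 : 1 ≤ (graph K D N).dist x y)
    (h2 : (graph K D N).dist x y < D) (hN : 2 * D < N) (z : Vert K D N) (i : Fin 6) :
    z ∈ part x y i ↔ z - x ∈ rankOne (Fin D) (Fin (N - D)) K ∧ cls (y - x) G (z - x) = i := by
  have hk : (graph K D N).dist x y = (y - x).rank := by rw [dist_eq_rank, rank_sub_comm]
  obtain ⟨r, hr⟩ : ∃ r, (y - x).rank = r + 1 := ⟨(y - x).rank - 1, by omega⟩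
  rw [hk, hr] at h2
  unfold part
  simp only [hk, hr, Nat.add_sub_cancel]
  set q := Fintype.card K with hq
  have hq2 : 1 < q := Fintype.one_lt_card
  by_cases hz : z - x ∈ rankOne (Fin D) (Fin (N - D)) K
  swap
  · have hz' : z ∉ sphere x 1 := fun h => hz (mem_rankOne.2 (mem_sphere.1 h))
    fin_cases i <;> simp [hz, hz']
  have hzs : z ∈ sphere x 1 := mem_sphere.2 (mem_rankOne.1 hz)
  have hrank : ∀ W ∈ rankOne (Fin D) (Fin (N - D)) K, ((y - x) - W).rank
      = (![r, r + 1, r + 1, r + 1, r + 1, r + 2] : Fin 6 → ℕ) (cls (y - x) G W) := by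
    intro W hW
    rw [rank_sub_of_cls hG hW, hr]
    rfl
  have hzy : (z - y).rank
      = (![r, r + 1, r + 1, r + 1, r + 1, r + 2] : Fin 6 → ℕ) (cls (y - x) G (z - x)) := by
    rw [← hrank _ hz, sub_sub_sub_cancel_right, rank_sub_comm]
  have hcount : ∀ (j : ℕ) (l : Fin 6), (∀ i : Fin 6,
      (![r, r + 1, r + 1, r + 1, r + 1, r + 2] : Fin 6 → ℕ) i = j ↔ i = l) →
      (#(sphere x 1 ∩ sphere z 1 ∩ sphere y j) : ℝ)
        = rowSum q (q ^ r) (q ^ (N - D)) (fun i => if i = l then 1 else 0) (cls (y - x) G (z - x))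
          + colSum q (q ^ r) (q ^ D) (fun i => if i = l then 1 else 0) (cls (y - x) G (z - x))
          - lineSum q (fun i => if i = l then 1 else 0) (cls (y - x) G (z - x))
          - if cls (y - x) G (z - x) = l then 1 else 0 := by
    intro j l hl
    -- With θ the indicator of 1 one has θ 0 = θ 2 = 0, leaving the row sum plus the column sum
    -- minus the line sum, less the value at z itself.
    have h := sum_rankOne_theta_cls hG hr (fun n => if n = 1 then 1 else 0)
      (fun i => if i = l then 1 else 0) hz
    rw [card_sphere_inter, Finset.sum_congr rfl (fun W hW => by rw [hrank W hW])]
    simp only [hl]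
    rw [h]
    simp only [Fintype.card_fin]
    norm_num
    split_ifs <;> ring
  have hlo := hcount r 0 (by intro i; fin_cases i <;> simp)
  have hhi := hcount (r + 2) 5 (by intro i; fin_cases i <;> simp)
  have hmem : ∀ j, z ∈ sphere x 1 ∩ sphere y j ↔
      (![r, r + 1, r + 1, r + 1, r + 1, r + 2] : Fin 6 → ℕ) (cls (y - x) G (z - x)) = j := by
    intro j
    rw [Finset.mem_inter, mem_sphere (x := y), hzy]
    simp [hzs]
  -- These inequalities tell the count pairs apart: 2u ≠ 2u − 1 separates classes 1 and 2, a nonzero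
  -- upper count separates them from 3 and 4, and q ^ D ≠ q ^ (N − D) separates 3 from 4.
  have hu : 0 < q ^ r := pow_pos (by omega) _
  have hA : q ^ (r + 1) < q ^ D := Nat.pow_lt_pow_right hq2 h2
  have hB : q ^ D < q ^ (N - D) := Nat.pow_lt_pow_right hq2 (by omega)
  simp only [hz, true_and]
  set lo := #(sphere x 1 ∩ sphere z 1 ∩ sphere y r) with hlodef
  set hi := #(sphere x 1 ∩ sphere z 1 ∩ sphere y (r + 2)) with hhidef
  generalize cls (y - x) G (z - x) = c at *
  have cast_eq : ∀ {a b : ℕ}, (a : ℝ) = b → a = b := fun h => by exact_mod_cast h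
  have hlo1 : c = 1 → lo = 2 * q ^ r := by
    rintro rfl
    exact cast_eq (by rw [hlo]; simp [rowSum, colSum, lineSum]; ring)
  have hlo2 : c = 2 → lo = 2 * q ^ r - 1 := by
    rintro rfl
    exact cast_eq (by
      rw [hlo, Nat.cast_sub (by omega)]; simp [rowSum, colSum, lineSum]; ring)
  have hlo3 : c = 3 → lo = q ^ r := by
    rintro rfl
    exact cast_eq (by rw [hlo]; simp [rowSum, colSum, lineSum])
  have hlo4 : c = 4 → lo = q ^ r := by
    rintro rfl
    exact cast_eq (by rw [hlo]; simp [rowSum, colSum, lineSum])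
  have hhi1 : c = 1 → hi = 0 := by
    rintro rfl
    exact cast_eq (by rw [hhi]; simp [rowSum, colSum, lineSum])
  have hhi2 : c = 2 → hi = 0 := by
    rintro rfl
    exact cast_eq (by rw [hhi]; simp [rowSum, colSum, lineSum])
  have hhi3 : c = 3 → hi = q ^ D - q ^ (r + 1) := by
    rintro rfl
    exact cast_eq (by
      rw [hhi, Nat.cast_sub hA.le]; simp [rowSum, colSum, lineSum, pow_succ'])
  have hhi4 : c = 4 → hi = q ^ (N - D) - q ^ (r + 1) := by
    rintro rfl
    exact cast_eq (by
      rw [hhi, Nat.cast_sub (hA.le.trans hB.le)]; simp [rowSum, colSum, lineSum, pow_succ'])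
  clear_value lo hi
  generalize q ^ r = u at *
  generalize q ^ (r + 1) = v at *
  generalize q ^ D = A at *
  generalize q ^ (N - D) = B at *
  clear hlo hhi hcount hrank hzy
  have hc : c = 0 ∨ c = 1 ∨ c = 2 ∨ c = 3 ∨ c = 4 ∨ c = 5 := by
    clear * -
    revert c
    decide
  fin_cases i <;>
    simp only [Fin.reduceFinMk, Fin.zero_eta, Fin.mk_one, Fin.isValue, Matrix.cons_val,
      Finset.mem_filter, hmem, ← hlodef, ← hhidef] <;>
    rcases hc with rfl | rfl | rfl | rfl | rfl | rfl <;>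
    simp at hlo1 hlo2 hlo3 hlo4 hhi1 hhi2 hhi3 hhi4 ⊢ <;> omega

end Partition

/-! ### Characters of the space of matrices -/

section Characters

open Matrix Finset

variable {K V : Type*} [Field K] [Fintype K] [DecidableEq K] [AddCommGroup V] [Module K V]
  [Fintype V] [DecidableEq V]

/-- A nontrivial additive character of a finite field. -/
def psi (K : Type*) [Field K] [Fintype K] : AddChar K ℂ :=
  AddChar.FiniteField.primitiveChar_to_Complex K

theorem sum_psi : ∑ t : K, psi K t = 0 := by
  classical
  have h := AddChar.sum_mulShift (R := K) (1 : K)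
    (AddChar.FiniteField.primitiveChar_to_Complex_isPrimitive K)
  simpa [psi] using h

theorem star_psi (t : K) : starRingEnd ℂ (psi K t) = psi K (-t) :=
  (AddChar.map_neg_eq_conj _ _).symm

open Classical in
theorem sum_submodule_psi_of_ne (U : Submodule K V) (f : V →ₗ[K] K) (hf : ∃ u ∈ U, f u ≠ 0) :
    ∑ v with v ∈ U, psi K (f v) = 0 := by
  have hne : Module.finrank K U ≠ 0 := by
    obtain ⟨u, hu, hfu⟩ := hf
    intro h0
    rw [Submodule.finrank_eq_zero.1 h0, Submodule.mem_bot] at hu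
    exact hfu (by rw [hu, map_zero])
  rw [sum_submodule_comp_linear U f hf (c := Fintype.card K ^ (Module.finrank K U - 1)) ?_,
    sum_psi, smul_zero]
  rw [card_filter_mem_submodule, ← pow_succ', Nat.sub_add_cancel (by omega)]

open Classical in
theorem sum_submodule_psi (U : Submodule K V) (f : V →ₗ[K] K) :
    ∑ v with v ∈ U, psi K (f v) = if ∀ u ∈ U, f u = 0 then (#{v | v ∈ U} : ℂ) else 0 := by
  split_ifs with h
  · rw [Finset.sum_congr rfl (g := fun _ => (1 : ℂ))]
    · simp
    · intro v hv
      rw [h v (by simpa using hv), AddChar.map_zero_eq_one]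
  · push Not at h
    exact sum_submodule_psi_of_ne U f h

variable {ι κ : Type*} [Fintype ι] [Fintype κ] [DecidableEq ι] [DecidableEq κ]

/-- The standard bilinear form on matrices. -/
def pair (A B : Matrix ι κ K) : K := ∑ i, ∑ j, A i j * B i j

theorem pair_comm (A B : Matrix ι κ K) : pair A B = pair B A := by
  simp [pair, mul_comm]

theorem pair_add (A B C : Matrix ι κ K) : pair A (B + C) = pair A B + pair A C := by
  simp [pair, mul_add, Finset.sum_add_distrib]

theorem pair_neg (A B : Matrix ι κ K) : pair A (-B) = -pair A B := by
  simp [pair]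

theorem pair_sub (A B C : Matrix ι κ K) : pair A (B - C) = pair A B - pair A C := by
  rw [sub_eq_add_neg, pair_add, pair_neg, sub_eq_add_neg]

theorem pair_vecMulVec (A : Matrix ι κ K) (a : ι → K) (b : κ → K) :
    pair A (vecMulVec a b) = (a ᵥ* A) ⬝ᵥ b := by
  rw [← Matrix.dotProduct_mulVec]
  simp only [pair, vecMulVec_apply, dotProduct, Matrix.mulVec, Finset.mul_sum]
  refine Finset.sum_congr rfl fun i _ => Finset.sum_congr rfl fun j _ => by ring

theorem pair_zero_right (A : Matrix ι κ K) : pair A 0 = 0 := by simp [pair]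

theorem sum_psi_pair (B : Matrix ι κ K) :
    ∑ A : Matrix ι κ K, psi K (pair A B) = if B = 0 then (Fintype.card (Matrix ι κ K) : ℂ) else 0 := by
  classical
  let f : Matrix ι κ K →ₗ[K] K :=
    { toFun := fun A => pair A B
      map_add' := fun A A' => by simp only [pair_comm _ B, pair_add]
      map_smul' := fun c A => by
        simp [pair, Finset.mul_sum, mul_assoc] }
  have h := sum_submodule_psi (⊤ : Submodule K (Matrix ι κ K)) f
  simp only [Submodule.mem_top, Finset.filter_true, Finset.card_univ, true_implies] at h
  have h' : (∀ A, f A = 0) ↔ B = 0 := by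
    constructor
    · intro hA
      ext i j
      have := hA (Matrix.single i j 1)
      simpa [f, pair, Matrix.single_apply, ite_and] using this
    · rintro rfl A
      exact pair_zero_right A
  rw [if_congr h' rfl rfl] at h
  exact h

theorem sum_psi_dotProduct (w : κ → K) :
    ∑ b : κ → K, psi K (w ⬝ᵥ b)
      = if w = 0 then (Fintype.card K : ℂ) ^ Fintype.card κ else 0 := by
  classical
  have h := sum_submodule_psi (⊤ : Submodule K (κ → K)) (dotProductEquiv K κ w)
  simp only [Submodule.mem_top, Finset.filter_true, Finset.card_univ, true_implies,
    dotProductEquiv_apply_apply, Fintype.card_fun, dotProduct_eq_zero_iff] at h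
  rw [h]
  push_cast
  rfl

theorem card_vecMul_eq_zero (A : Matrix ι κ K) :
    #{a : ι → K | a ᵥ* A = 0} = Fintype.card K ^ (Fintype.card ι - A.rank) := by
  classical
  have h := card_filter_mem_submodule (LinearMap.ker A.vecMulLinear)
  have h2 := LinearMap.finrank_range_add_finrank_ker A.vecMulLinear
  rw [finrank_range_vecMulLinear, Module.finrank_fintype_fun_eq_card] at h2
  rw [show Fintype.card ι - A.rank = Module.finrank K (LinearMap.ker A.vecMulLinear) by omega, ← h]
  congr 1
  ext a
  simp

/-- For fixed a the sum over all b of ψ(aA · b) vanishes unless aA = 0, so only the left kernel of A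
contributes beyond the corrections for the zero vectors. -/
theorem sum_rankOne_psi (A : Matrix ι κ K) :
    ∑ B ∈ rankOne ι κ K, psi K (pair A B)
      = ((Fintype.card K : ℂ) ^ (Fintype.card κ + (Fintype.card ι - A.rank)) + 1
          - (Fintype.card K : ℂ) ^ Fintype.card ι - (Fintype.card K : ℂ) ^ Fintype.card κ)
        / (Fintype.card K - 1) := by
  have hq : (Fintype.card K : ℂ) - 1 ≠ 0 := by
    rw [sub_ne_zero]
    exact_mod_cast Fintype.one_lt_card.ne'
  have h := card_sub_one_nsmul_sum_rankOne (fun B : Matrix ι κ K => psi K (pair A B))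
  rw [eq_div_iff hq, mul_comm]
  rw [nsmul_eq_mul, Nat.cast_sub Fintype.card_pos, Nat.cast_one] at h
  rw [h]
  have h1 : ∀ a : ι → K, ∑ b ∈ univ.erase (0 : κ → K), psi K (pair A (vecMulVec a b))
      = (if a ᵥ* A = 0 then (Fintype.card K : ℂ) ^ Fintype.card κ else 0) - 1 := by
    intro a
    simp only [pair_vecMulVec]
    rw [Finset.sum_erase_eq_sub (Finset.mem_univ _), sum_psi_dotProduct, dotProduct_zero,
      AddChar.map_zero_eq_one]
  rw [Finset.sum_congr rfl (fun a _ => h1 a), Finset.sum_erase_eq_sub (Finset.mem_univ _),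
    Finset.sum_sub_distrib, ← Finset.sum_filter, Finset.sum_const, card_vecMul_eq_zero,
    Matrix.zero_vecMul, if_pos rfl]
  simp only [Finset.sum_const, Finset.card_univ, Fintype.card_fun, nsmul_eq_mul]
  push_cast
  rw [pow_add]
  ring

end Characters

/-! ### The spectrum of the bilinear forms graph -/

section Spectrum

open Matrix Finset

variable {K : Type*} [Field K] [Fintype K] [DecidableEq K] {D N : ℕ}

theorem sum_rankOne_psi_eq_theta (hDN : D ≤ N) (A : Vert K D N) :
    ∑ B ∈ rankOne (Fin D) (Fin (N - D)) K, psi K (pair A B)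
      = (theta (Fintype.card K) D N A.rank : ℂ) := by
  have hr : A.rank ≤ D := by simpa using A.rank_le_card_height
  rw [sum_rankOne_psi, theta]
  simp only [Fintype.card_fin]
  rw [show N - D + (D - A.rank) = N - A.rank by omega]
  push_cast
  rfl

/-- The real part of the character of the space of matrices attached to `A`. -/
def reChar (A : Vert K D N) : EuclideanSpace ℝ (Vert K D N) :=
  WithLp.toLp 2 fun u => (psi K (pair A u)).re

/-- The imaginary part of the character of the space of matrices attached to `A`. -/
def imChar (A : Vert K D N) : EuclideanSpace ℝ (Vert K D N) :=
  WithLp.toLp 2 fun u => (psi K (pair A u)).im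

theorem adjOp_apply (f : EuclideanSpace ℝ (Vert K D N)) (u : Vert K D N) :
    adjOp (graph K D N) f u = ∑ B ∈ rankOne (Fin D) (Fin (N - D)) K, f (u + B) := by
  rw [adjOp, Matrix.toLpLin_apply]
  change ((graph K D N).adjMatrix ℝ *ᵥ WithLp.ofLp f) u = _
  rw [SimpleGraph.adjMatrix_mulVec_apply]
  refine Finset.sum_bij' (fun w _ => w - u) (fun B _ => u + B) ?_ ?_ ?_ ?_ ?_
  · intro w hw
    rw [SimpleGraph.mem_neighborFinset] at hw
    rw [mem_rankOne, rank_sub_comm]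
    exact hw
  · intro B hB
    rw [SimpleGraph.mem_neighborFinset]
    change (u - (u + B)).rank = 1
    rw [sub_add_cancel_left, rank_neg]
    exact mem_rankOne.1 hB
  · intro w _
    simp
  · intro B _
    simp
  · intro w _
    simp

theorem sum_rankOne_psi_add (hDN : D ≤ N) (A u : Vert K D N) :
    ∑ B ∈ rankOne (Fin D) (Fin (N - D)) K, psi K (pair A (u + B))
      = (theta (Fintype.card K) D N A.rank : ℂ) * psi K (pair A u) := by
  simp only [pair_add, AddChar.map_add_eq_mul]
  rw [← Finset.mul_sum, sum_rankOne_psi_eq_theta hDN, mul_comm]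

theorem adjOp_reChar (hDN : D ≤ N) (A : Vert K D N) :
    adjOp (graph K D N) (reChar A) = theta (Fintype.card K) D N A.rank • reChar A := by
  ext u
  rw [adjOp_apply]
  simp only [reChar, PiLp.smul_apply, smul_eq_mul]
  rw [← Complex.re_sum, sum_rankOne_psi_add hDN, Complex.re_ofReal_mul]

theorem adjOp_imChar (hDN : D ≤ N) (A : Vert K D N) :
    adjOp (graph K D N) (imChar A) = theta (Fintype.card K) D N A.rank • imChar A := by
  ext u
  rw [adjOp_apply]
  simp only [imChar, PiLp.smul_apply, smul_eq_mul]
  rw [← Complex.im_sum, sum_rankOne_psi_add hDN, Complex.im_ofReal_mul]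

theorem re_psi_pair_sub (A u v : Vert K D N) :
    (psi K (pair A (u - v))).re = (psi K (pair A v)).re * (psi K (pair A u)).re
      + (psi K (pair A v)).im * (psi K (pair A u)).im := by
  rw [pair_sub, sub_eq_add_neg, AddChar.map_add_eq_mul, ← star_psi, Complex.mul_re,
    Complex.conj_re, Complex.conj_im]
  ring

theorem hat_apply (v u : Vert K D N) : hat v u = if u = v then 1 else 0 := by
  simp [hat]

/-- Fourier inversion, split into real and imaginary parts because the standard module is real. -/
theorem card_smul_hat (v : Vert K D N) :
    (Fintype.card (Vert K D N) : ℝ) • hat v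
      = ∑ A : Vert K D N, ((psi K (pair A v)).re • reChar A + (psi K (pair A v)).im • imChar A) := by
  ext u
  have h := congrArg Complex.re (sum_psi_pair (u - v))
  rw [Complex.re_sum] at h
  simp only [re_psi_pair_sub] at h
  simp only [PiLp.smul_apply, WithLp.ofLp_sum, Finset.sum_apply, PiLp.add_apply, reChar, imChar,
    smul_eq_mul, hat_apply]
  rw [h]
  simp only [sub_eq_zero]
  split_ifs <;> simp

theorem card_vert_ne_zero : (Fintype.card (Vert K D N) : ℝ) ≠ 0 :=
  Nat.cast_ne_zero.2 Fintype.card_ne_zero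

theorem primitiveIdempotent_reChar (hDN : D ≤ N) (θ : ℝ) (A : Vert K D N) :
    primitiveIdempotent (graph K D N) θ (reChar A)
      = if theta (Fintype.card K) D N A.rank = θ then reChar A else 0 := by
  split_ifs with h
  · exact primitiveIdempotent_apply_self _ (h ▸ adjOp_reChar hDN A)
  · exact primitiveIdempotent_apply_of_ne _ h (adjOp_reChar hDN A)

theorem primitiveIdempotent_imChar (hDN : D ≤ N) (θ : ℝ) (A : Vert K D N) :
    primitiveIdempotent (graph K D N) θ (imChar A)
      = if theta (Fintype.card K) D N A.rank = θ then imChar A else 0 := by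
  split_ifs with h
  · exact primitiveIdempotent_apply_self _ (h ▸ adjOp_imChar hDN A)
  · exact primitiveIdempotent_apply_of_ne _ h (adjOp_imChar hDN A)

theorem card_smul_primitiveIdempotent_hat (hDN : D ≤ N) (θ : ℝ) (v : Vert K D N) :
    (Fintype.card (Vert K D N) : ℝ) • primitiveIdempotent (graph K D N) θ (hat v)
      = ∑ A : Vert K D N with theta (Fintype.card K) D N A.rank = θ,
        ((psi K (pair A v)).re • reChar A + (psi K (pair A v)).im • imChar A) := by
  rw [← map_smul, card_smul_hat, map_sum, Finset.sum_filter]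
  refine Finset.sum_congr rfl fun A _ => ?_
  rw [map_add, map_smul, map_smul, primitiveIdempotent_reChar hDN, primitiveIdempotent_imChar hDN]
  split_ifs <;> simp

theorem eq_sum_smul_hat (f : EuclideanSpace ℝ (Vert K D N)) : f = ∑ v, f v • hat v := by
  ext u
  simp [hat_apply]

theorem exists_theta_of_hasEigenvalue (hDN : D ≤ N) {θ : ℝ}
    (h : Module.End.HasEigenvalue (adjOp (graph K D N)) θ) :
    ∃ r ≤ D, theta (Fintype.card K) D N r = θ := by
  by_contra! hne
  obtain ⟨f, hf⟩ := h.exists_hasEigenvector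
  -- If no matrix A has eigenvalue θ, the projection onto the θ-eigenspace kills every basis vector,
  -- hence everything.
  have hz : ∀ v : Vert K D N, primitiveIdempotent (graph K D N) θ (hat v) = 0 := by
    intro v
    have h1 := card_smul_primitiveIdempotent_hat hDN θ v
    rw [Finset.filter_false_of_mem, Finset.sum_empty] at h1
    · exact (smul_eq_zero.1 h1).resolve_left card_vert_ne_zero
    · intro A _
      exact hne _ (by simpa using A.rank_le_card_height)
  have h2 := primitiveIdempotent_apply_self (graph K D N) (Module.End.mem_eigenspace_iff.1 hf.1)
  rw [eq_sum_smul_hat f, map_sum] at h2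
  simp only [map_smul, hz, smul_zero, Finset.sum_const_zero] at h2
  rw [← eq_sum_smul_hat f] at h2
  exact hf.2 h2.symm

theorem reChar_ne_zero (A : Vert K D N) : reChar A ≠ 0 := by
  intro h
  have h1 := congrArg (fun f : EuclideanSpace ℝ (Vert K D N) => f 0) h
  simp [reChar, pair_zero_right] at h1

theorem hasEigenvalue_theta (hDN : D ≤ N) (A : Vert K D N) :
    Module.End.HasEigenvalue (adjOp (graph K D N)) (theta (Fintype.card K) D N A.rank) :=
  Module.End.hasEigenvalue_of_hasEigenvector
    ⟨Module.End.mem_eigenspace_iff.2 (adjOp_reChar hDN A), reChar_ne_zero A⟩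

theorem theta_lt_theta {q : ℝ} (hq : 1 < q) {D N i j : ℕ} (hij : i < j) (hj : j ≤ N) :
    theta q D N j < theta q D N i := by
  unfold theta
  have h1 : q ^ (N - j) < q ^ (N - i) := pow_lt_pow_right₀ hq (by omega)
  exact div_lt_div_of_pos_right (by linarith) (by linarith)

theorem theta_inj {q : ℝ} (hq : 1 < q) {D N i j : ℕ} (hi : i ≤ N) (hj : j ≤ N)
    (h : theta q D N i = theta q D N j) : i = j := by
  rcases lt_trichotomy i j with hij | hij | hij
  · exact absurd h (theta_lt_theta hq hij hj).ne'
  · exact hij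
  · exact absurd h (theta_lt_theta hq hij hi).ne

theorem one_lt_card_real (K : Type*) [Field K] [Fintype K] : (1 : ℝ) < Fintype.card K := by
  exact_mod_cast Fintype.one_lt_card

theorem graphEigenvalue_one (hD : 0 < D) (hDN : D < N) :
    graphEigenvalue (graph K D N) 1 = theta (Fintype.card K) D N 1 := by
  classical
  have hq := one_lt_card_real K
  set S := (Module.End.finite_hasEigenvalue (adjOp (graph K D N))).toFinset with hS
  have mem : ∀ θ, θ ∈ S ↔ Module.End.HasEigenvalue (adjOp (graph K D N)) θ := fun θ => by
    rw [hS, Set.Finite.mem_toFinset]; rfl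
  have h0 : theta (Fintype.card K) D N 0 ∈ S := by
    rw [mem]
    simpa using hasEigenvalue_theta hDN.le (0 : Vert K D N)
  have h1 : theta (Fintype.card K) D N 1 ∈ S := by
    rw [mem]
    have := hasEigenvalue_theta hDN.le (K := K)
      (Matrix.vecMulVec (Pi.single ⟨0, hD⟩ 1) (Pi.single ⟨0, by omega⟩ 1) : Vert K D N)
    rwa [rank_vecMulVec_of_ne_zero (by simp) (by simp)] at this
  have h01 := theta_lt_theta hq (D := D) (N := N) (i := 0) (j := 1) one_pos (by omega)
  have hrest : ∀ θ ∈ S, θ ≠ theta (Fintype.card K) D N 0 → θ ≠ theta (Fintype.card K) D N 1 →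
      θ < theta (Fintype.card K) D N 1 := by
    intro θ hθ hn0 hn1
    obtain ⟨r, hr, rfl⟩ := exists_theta_of_hasEigenvalue hDN.le ((mem θ).1 hθ)
    refine theta_lt_theta hq ?_ (by omega)
    have : r ≠ 0 := by rintro rfl; exact hn0 rfl
    have : r ≠ 1 := by rintro rfl; exact hn1 rfl
    omega
  -- Peeling the two largest elements off the set of eigenvalues exposes θ₁ as the second entry of
  -- the sorted list.
  set T := (S.erase (theta (Fintype.card K) D N 0)).erase (theta (Fintype.card K) D N 1) with hT
  have hT1 : theta (Fintype.card K) D N 1 ∉ T := Finset.notMem_erase _ _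
  have hT' : S.erase (theta (Fintype.card K) D N 0)
      = Finset.cons (theta (Fintype.card K) D N 1) T hT1 := by
    rw [Finset.cons_eq_insert, hT, Finset.insert_erase]
    exact Finset.mem_erase.2 ⟨h01.ne, h1⟩
  have hlt : ∀ θ ∈ T, θ < theta (Fintype.card K) D N 1 := by
    intro θ hθ
    rw [hT, Finset.mem_erase, Finset.mem_erase] at hθ
    exact hrest θ hθ.2.2 hθ.2.1 hθ.1
  have hS' : S = Finset.cons (theta (Fintype.card K) D N 0) (S.erase (theta (Fintype.card K) D N 0))
      (Finset.notMem_erase _ _) := by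
    rw [Finset.cons_eq_insert, Finset.insert_erase h0]
  unfold graphEigenvalue
  rw [← hS, hS', Finset.sort_cons, hT', Finset.sort_cons]
  · rfl
  · exact fun θ hθ => (hlt θ hθ).le
  · intro θ hθ
    rw [hT', Finset.mem_cons] at hθ
    rcases hθ with rfl | hθ
    · exact h01.le
    · exact ((hlt θ hθ).trans h01).le

theorem card_smul_idem_hat (hD : 0 < D) (hDN : D < N) (v : Vert K D N) :
    (Fintype.card (Vert K D N) : ℝ) • idem K D N (hat v)
      = ∑ A ∈ rankOne (Fin D) (Fin (N - D)) K,
        ((psi K (pair A v)).re • reChar A + (psi K (pair A v)).im • imChar A) := by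
  rw [idem, graphEigenvalue_one hD hDN, card_smul_primitiveIdempotent_hat hDN.le]
  refine Finset.sum_congr ?_ fun _ _ => rfl
  ext A
  have hr : A.rank ≤ D := by simpa using A.rank_le_card_height
  simp only [Finset.mem_filter, Finset.mem_univ, true_and, mem_rankOne]
  exact ⟨fun h => theta_inj (one_lt_card_real K) (by omega) (by omega) h, fun h => by rw [h]⟩

/-- Self-duality: pairing is symmetric, so the character sum giving an entry of E is the one that
gives an eigenvalue of the graph. -/
theorem card_mul_idem_hat_apply (hD : 0 < D) (hDN : D < N) (u v : Vert K D N) :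
    (Fintype.card (Vert K D N) : ℝ) * idem K D N (hat v) u
      = theta (Fintype.card K) D N (u - v).rank := by
  have h := congrArg (fun f : EuclideanSpace ℝ (Vert K D N) => f u) (card_smul_idem_hat hD hDN v)
  have h2 := congrArg Complex.re (sum_rankOne_psi_eq_theta hDN.le (u - v))
  rw [Complex.re_sum, Complex.ofReal_re] at h2
  simp only [pair_comm (u - v), re_psi_pair_sub] at h2
  rw [← h2]
  simpa [reChar, imChar] using h

theorem inner_idem_hat (hD : 0 < D) (hDN : D < N) (u v : Vert K D N) :
    inner ℝ (idem K D N (hat u)) (idem K D N (hat v))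
      = (Fintype.card (Vert K D N) : ℝ)⁻¹ * theta (Fintype.card K) D N (u - v).rank := by
  rw [← card_mul_idem_hat_apply hD hDN, inv_mul_cancel_left₀ card_vert_ne_zero, idem,
    primitiveIdempotent, Submodule.inner_starProjection_left_eq_right,
    Submodule.starProjection_eq_self_iff.2 (Submodule.starProjection_apply_mem _ _), hat,
    EuclideanSpace.inner_single_left]
  simp

/-- The value of the Fourier transform of `f` at `A`. -/
def fourier (A : Vert K D N) : EuclideanSpace ℝ (Vert K D N) →ₗ[ℝ] ℂ where
  toFun f := ∑ v, (f v : ℂ) * psi K (pair A v)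
  map_add' f g := by simp [add_mul, Finset.sum_add_distrib]
  map_smul' c f := by simp [Finset.mul_sum, mul_assoc]

theorem fourier_hat (A v : Vert K D N) : fourier A (hat v) = psi K (pair A v) := by
  simp [fourier, hat_apply, apply_ite Complex.ofReal]

/-- The coefficients of Ef along the rank-one characters are the real and imaginary parts of the
Fourier coefficients of f. -/
theorem idem_eq_zero_of_fourier (hD : 0 < D) (hDN : D < N) {f : EuclideanSpace ℝ (Vert K D N)}
    (hf : ∀ A ∈ rankOne (Fin D) (Fin (N - D)) K, fourier A f = 0) : idem K D N f = 0 := by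
  have h : (Fintype.card (Vert K D N) : ℝ) • idem K D N f
      = ∑ A ∈ rankOne (Fin D) (Fin (N - D)) K,
        ((fourier A f).re • reChar A + (fourier A f).im • imChar A) := by
    conv_lhs => rw [eq_sum_smul_hat f]
    rw [map_sum, Finset.smul_sum]
    simp only [map_smul, smul_comm _ (f _), card_smul_idem_hat hD hDN, Finset.smul_sum]
    rw [Finset.sum_comm]
    refine Finset.sum_congr rfl fun A _ => ?_
    simp only [fourier, LinearMap.coe_mk, AddHom.coe_mk, Complex.re_sum, Complex.im_sum,
      Complex.re_ofReal_mul, Complex.im_ofReal_mul, smul_add, Finset.sum_add_distrib,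
      Finset.sum_smul, smul_smul]
  rw [Finset.sum_eq_zero (fun A hA => by simp [hf A hA])] at h
  exact (smul_eq_zero.1 h).resolve_left card_vert_ne_zero

end Spectrum

/-! ### Algebraic identities

In this section `u = q ^ (k - 1)`, `v = q ^ (D - k)` and `w = q ^ (N - D - 1)`. -/

section Algebra

/-- The matrix `matH` in terms of the parameters `u`, `v`, `w`. -/
def matHParam (q u v w : ℝ) : Matrix (Fin 6) (Fin 6) ℝ :=
  let a := q * u * (v - 1) / (q - 1)
  let b := q * (w - u) / (q - 1)
  let c := (q * u - 1) / (q - 1)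
  let p := (q ^ 2 * u * v * w - q ^ 2 * w - q ^ 2 * u * v + q ^ 2 * u - q * u + q) / (q - 1) ^ 2
  !![1, a, b, q - 2, p, q * (v - 1) * (w - u) * (u - 1) / (q - 1);
     1, a, b, 0, q * u * (1 - q * v * w) / (q - 1), q * u * (v - 1) * (w - u) / (q - 1);
     1, a, b, -1, p, q * (v - 1) * (w - u) * (u - 1) / (q - 1);
     1, a, -c, 0, -a, -(q * u * (v - 1) * (u - 1) / (q - 1));
     1, -c, b, 0, -b, -(q * (w - u) * (u - 1) / (q - 1));
     1, -c, -c, 0, c, (q * u - 1) * (u - 1) / (q - 1)]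

/-- The scalar `tau` in terms of the parameters. -/
def tauParam (q u v w : ℝ) : ℝ :=
  ((q * w - q) * (u * v - 1) + q * v * w * (u - 1) * (q - 1)) / (q - 1) ^ 2

/-- The scalars `eta` in terms of the parameters. -/
def etaParam (q u v w : ℝ) : Fin 6 → ℝ :=
  ![(q * u * v - 1) * (q * w - 1) / (q - 1),
    q * u * (v - 1) * (q * u - 1) * (q * u * v - 1) * (q * w - 1) / (q - 1) ^ 3,
    q * (w - u) * (q * u - 1) * (q * u * v - 1) * (q * w - 1) / (q - 1) ^ 3,
    (q - 2) * u * (q * u - 1),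
    tauParam q u v w * (q * u * (q * u - 1) * (q * u * v - 1) * (q * w - 1) / (q - 1) ^ 2),
    tauParam q u v w * ((q * u - 1) * (u - 1) * (q * u * (v - 1)) * (w - u) / (q - 1))]

/-- The scalars `eps` in terms of the parameters. -/
def epsParam (q u v w : ℝ) : Fin 6 → ℝ :=
  ![((q * u * v * w + 1 - q * u * v - q * w) / (q - 1)) ^ 2, q * u * v * w ^ 2,
    q * u ^ 2 * v ^ 2 * w, q * u * v * w, u * v * w, u * v * w]

/-- The scalars `muClosed` in terms of the parameters. -/
def muParam (q u v w : ℝ) : Fin 6 → ℝ :=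
  ![(q * u * v * w + 1 - q * u * v - q * w) / (q - 1), -(w * (q * u * (v - 1) / (q - 1))),
    -(u * v * (q * (w - u) / (q - 1))), -((q - 2) * u), -(u * tauParam q u v w), 0]

variable {q u v w : ℝ}

set_option maxHeartbeats 4000000 in
-- The three coefficients are θ₂, θ₁ − θ₂ and θ₀ − θ₁, so each column of H is an eigenvector of the
-- Gram operator on class functions.
theorem matHParam_eigen (hq : q - 1 ≠ 0) (i j : Fin 6) :
    (u * v * w + 1 - q * u * v - q * w) / (q - 1)
        * ∑ l, clsCard q u (q * u * v) (q * w) l * matHParam q u v w l j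
      + u * v * w * (rowSum q u (q * w) (fun l => matHParam q u v w l j) i
          + colSum q u (q * u * v) (fun l => matHParam q u v w l j) i
          - lineSum q (fun l => matHParam q u v w l j) i)
      + q * u * v * w * matHParam q u v w i j
      = epsParam q u v w j * matHParam q u v w i j := by
  rw [Fin.sum_univ_six]
  fin_cases j <;> fin_cases i <;>
    simp only [matHParam, rowSum, colSum, lineSum, clsCard, epsParam, Matrix.of_apply,
      Matrix.cons_val, Fin.zero_eta, Fin.isValue, Fin.mk_one, Fin.reduceFinMk] <;>
    field_simp <;> ring

set_option maxHeartbeats 4000000 in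
theorem matHParam_orthogonal_of_le (hq : q - 1 ≠ 0) (i j : Fin 6) (hij : i ≤ j) :
    ∑ l, clsCard q u (q * u * v) (q * w) l * matHParam q u v w l i * matHParam q u v w l j
      = if i = j then etaParam q u v w i else 0 := by
  rw [Fin.sum_univ_six]
  fin_cases j <;> fin_cases i <;> first | (exact absurd hij (by decide)) |
    (simp only [matHParam, clsCard, etaParam, tauParam, Matrix.of_apply,
      Matrix.cons_val, Fin.zero_eta, Fin.isValue, Fin.mk_one, Fin.reduceFinMk, Fin.reduceEq,
      if_true, if_false] <;> field_simp <;> ring)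

theorem matHParam_orthogonal (hq : q - 1 ≠ 0) (i j : Fin 6) :
    ∑ l, clsCard q u (q * u * v) (q * w) l * matHParam q u v w l i * matHParam q u v w l j
      = if i = j then etaParam q u v w i else 0 := by
  rcases le_total i j with hij | hij
  · exact matHParam_orthogonal_of_le hq i j hij
  · have h := matHParam_orthogonal_of_le (u := u) (v := v) (w := w) hq j i hij
    simp only [mul_right_comm _ (matHParam q u v w _ j)] at h
    rw [h]
    by_cases e : i = j
    · subst e; rfl
    · rw [if_neg e, if_neg (Ne.symm e)]

set_option maxHeartbeats 4000000 in
-- The factors before the entry of H form λ_i: after the common q − 1 cancels, the quotient of dual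
-- eigenvalue differences has numerator q ^ (N − 1) minus a power of q, and denominator q ^ N − q ^
-- (N − k) = qvw (qu − 1).
theorem matHParam_mu (hq : q - 1 ≠ 0) (hq0 : q ≠ 0) (hu : q * u - 1 ≠ 0) (hv : v ≠ 0) (hw : w ≠ 0)
    (j : Fin 6) :
    ∑ i, clsCard q u (q * u * v) (q * w) i
        * ((q * u * v * w - (![q ^ 2 * v * w, q * v * w, q * v * w, q * v * w, q * v * w,
          v * w] : Fin 6 → ℝ) i) / (q * v * w * (q * u - 1)))
        * matHParam q u v w i j = muParam q u v w j := by
  rw [Fin.sum_univ_six]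
  fin_cases j <;>
    simp only [matHParam, clsCard, muParam, tauParam, Matrix.of_apply,
      Matrix.cons_val, Fin.zero_eta, Fin.isValue, Fin.mk_one, Fin.reduceFinMk] <;>
    field_simp <;> ring

/-- The Parseval identity that places the difference of the two base vectors in the span. -/
theorem sum_muParam_sq (hq : q - 1 ≠ 0) (hq0 : q ≠ 0) (hu0 : u ≠ 0) (hv : v ≠ 0) (hw : w ≠ 0)
    (he : ∀ j, epsParam q u v w j ≠ 0) (hη : ∀ j, etaParam q u v w j ≠ 0) :
    ∑ j, muParam q u v w j ^ 2 / (epsParam q u v w j * etaParam q u v w j)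
      = 2 * (q - 1) / (q * v * w * (q * u - 1)) := by
  -- Each factor to be cancelled divides some η_j, so its nonvanishing follows from that of η_j.
  have hu : q * u - 1 ≠ 0 := by
    intro h
    exact hη 3 (by simp [etaParam, h])
  have hm : q * u * v - 1 ≠ 0 := by
    intro h
    exact hη 0 (by simp [etaParam, h])
  have hn : q * w - 1 ≠ 0 := by
    intro h
    exact hη 0 (by simp [etaParam, h])
  have h1 : muParam q u v w 0 ^ 2 / (epsParam q u v w 0 * etaParam q u v w 0)
      = (q - 1) / ((q * u * v - 1) * (q * w - 1)) := by
    have h : muParam q u v w 0 ^ 2 = epsParam q u v w 0 := rfl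
    rw [h, div_mul_cancel_left₀ (he 0)]
    simp [etaParam]
  have hv1 : v - 1 ≠ 0 := by
    intro h
    exact hη 1 (by simp [etaParam, h])
  have hwu : w - u ≠ 0 := by
    intro h
    exact hη 2 (by simp [etaParam, h])
  have hq2 : q - 2 ≠ 0 := by
    intro h
    exact hη 3 (by simp [etaParam, h])
  have hτ : tauParam q u v w ≠ 0 := by
    intro h
    exact hη 4 (by simp [etaParam, h])
  have h2 : muParam q u v w 1 ^ 2 / (epsParam q u v w 1 * etaParam q u v w 1)
      = (v - 1) * (q - 1) / (v * (q * u - 1) * (q * u * v - 1) * (q * w - 1)) := by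
    simp only [muParam, epsParam, etaParam, Matrix.cons_val]
    field_simp
  have h3 : muParam q u v w 2 ^ 2 / (epsParam q u v w 2 * etaParam q u v w 2)
      = (w - u) * (q - 1) / (w * (q * u - 1) * (q * u * v - 1) * (q * w - 1)) := by
    simp only [muParam, epsParam, etaParam, Matrix.cons_val]
    field_simp
  have h4 : muParam q u v w 3 ^ 2 / (epsParam q u v w 3 * etaParam q u v w 3)
      = (q - 2) / (q * v * w * (q * u - 1)) := by
    simp only [muParam, epsParam, etaParam, Matrix.cons_val]
    field_simp
  have h5 : muParam q u v w 4 ^ 2 / (epsParam q u v w 4 * etaParam q u v w 4)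
      = tauParam q u v w * (q - 1) ^ 2
        / (q * v * w * (q * u - 1) * (q * u * v - 1) * (q * w - 1)) := by
    simp only [muParam, epsParam, etaParam, Matrix.cons_val]
    field_simp
  have h6 : muParam q u v w 5 ^ 2 / (epsParam q u v w 5 * etaParam q u v w 5) = 0 := by
    simp [muParam]
  rw [Fin.sum_univ_six, h1, h2, h3, h4, h5, h6, tauParam]
  field_simp
  ring

end Algebra

/-! ### Powers of q in the parameters u, v, w, and positivity -/

section Parameters

variable {q : ℝ} {D N k : ℕ}

theorem theta_eq_param {u v w : ℝ} (hD : q ^ D = q * u * v) (hND : q ^ (N - D) = q * w) (i : ℕ) :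
    theta q D N i = (q ^ (N - i) + 1 - q * u * v - q * w) / (q - 1) := by
  rw [theta, hD, hND]

/-- The powers of `q` occurring in the statement in terms of the parameters. -/
structure Params (q u v w : ℝ) (D N k : ℕ) : Prop where
  pow_k_sub_one : q ^ (k - 1) = u
  pow_D : q ^ D = q * u * v
  pow_N_sub_D : q ^ (N - D) = q * w
  pow_k : q ^ k = q * u
  pow_N : q ^ N = q ^ 2 * u * v * w
  pow_N_sub_zero : q ^ (N - 0) = q ^ 2 * u * v * w
  pow_N_sub_one : q ^ (N - 1) = q * u * v * w
  pow_N_sub_two : q ^ (N - 2) = u * v * w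
  pow_N_sub_D_add_one : q ^ (N - D + 1) = q ^ 2 * w
  pow_D_add_one : q ^ (D + 1) = q ^ 2 * u * v
  pow_k_add_one : q ^ (k + 1) = q ^ 2 * u
  pow_N_sub_D_sub_one : q ^ (N - D - 1) = w
  pow_D_sub_one : q ^ (D - 1) = u * v
  pow_N_sub_k : q ^ (N - k) = q * v * w
  pow_N_sub_k_sub_one : q ^ (N - (k - 1)) = q ^ 2 * v * w
  pow_N_sub_k_add_one : q ^ (N - (k + 1)) = v * w
  pow_two_N : q ^ (2 * N - D - 2) = q * u * v * w ^ 2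
  pow_N_add_D : q ^ (N + D - 2) = q * u ^ 2 * v ^ 2 * w

/-- The exponents split as D = 1 + (k − 1) + (D − k) and N − D = 1 + (N − D − 1). -/
theorem params_of_lt (hk : 1 ≤ k) (hkD : k < D) (hDN : 2 * D < N) :
    Params q (q ^ (k - 1)) (q ^ (D - k)) (q ^ (N - D - 1)) D N k := by
  obtain ⟨r, rfl⟩ : ∃ r, k = r + 1 := ⟨k - 1, by omega⟩
  obtain ⟨s, rfl⟩ : ∃ s, D = r + 1 + s := ⟨D - (r + 1), by omega⟩
  obtain ⟨t, rfl⟩ : ∃ t, N = r + 1 + s + (t + 1) := ⟨N - (r + 1 + s) - 1, by omega⟩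
  rw [Nat.add_sub_cancel, Nat.add_sub_cancel_left, Nat.add_sub_cancel_left, Nat.add_sub_cancel]
  constructor
  · rfl
  · ring
  · rw [Nat.add_sub_cancel_left]; ring
  · ring
  · ring
  · rw [Nat.sub_zero]; ring
  · rw [show r + 1 + s + (t + 1) - 1 = r + s + t + 1 by omega]; ring
  · rw [show r + 1 + s + (t + 1) - 2 = r + s + t by omega]; ring
  · rw [Nat.add_sub_cancel_left]; ring
  · ring
  · ring
  · rw [Nat.add_sub_cancel_left, Nat.add_sub_cancel]
  · rw [show r + 1 + s - 1 = r + s by omega]; ring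
  · rw [show r + 1 + s + (t + 1) - (r + 1) = s + t + 1 by omega]; ring
  · rw [show r + 1 + s + (t + 1) - (r + 1 - 1) = s + t + 2 by omega]; ring
  · rw [show r + 1 + s + (t + 1) - (r + 1 + 1) = s + t by omega]; ring
  · rw [show 2 * (r + 1 + s + (t + 1)) - (r + 1 + s) - 2 = r + s + 2 * t + 1 by omega]; ring
  · rw [show r + 1 + s + (t + 1) + (r + 1 + s) - 2 = 2 * r + 2 * s + t + 1 by omega]; ring

variable {u v w : ℝ}

namespace Params

theorem matH_eq (P : Params q u v w D N k) (hq : q - 1 ≠ 0) (hq0 : q ≠ 0) (hu : u ≠ 0) :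
    matH q D N k = matHParam q u v w := by
  ext i j
  fin_cases i <;> fin_cases j <;>
    simp only [matH, matHParam, Matrix.of_apply, Matrix.cons_val, Fin.zero_eta, Fin.isValue,
      Fin.mk_one, Fin.reduceFinMk, P.pow_k_sub_one, P.pow_D, P.pow_N_sub_D, P.pow_k, P.pow_N,
      P.pow_N_sub_D_add_one, P.pow_D_add_one, P.pow_k_add_one] <;>
    field_simp <;> ring

theorem tau_eq (P : Params q u v w D N k) : tau q D N k = tauParam q u v w := by
  rw [tau, tauParam, P.pow_N_sub_D, P.pow_D_sub_one, P.pow_N_sub_k, P.pow_k_sub_one]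

theorem eta_eq (P : Params q u v w D N k) (hq : q - 1 ≠ 0) (hq0 : q ≠ 0) :
    eta q D N k = etaParam q u v w := by
  ext i
  fin_cases i <;>
    simp only [eta, etaParam, Matrix.cons_val, Fin.zero_eta, Fin.isValue,
      Fin.mk_one, Fin.reduceFinMk, P.pow_k_sub_one, P.pow_D, P.pow_N_sub_D, P.pow_k, P.tau_eq] <;>
    field_simp

theorem eps_eq (P : Params q u v w D N k) : eps q D N = epsParam q u v w := by
  ext i
  fin_cases i <;>
    simp only [eps, epsParam, Matrix.cons_val, Fin.zero_eta, Fin.isValue, Fin.mk_one,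
      Fin.reduceFinMk, P.pow_N_sub_one, P.pow_two_N, P.pow_N_add_D, P.pow_N_sub_two,
      theta_eq_param P.pow_D P.pow_N_sub_D]

theorem muClosed_eq (P : Params q u v w D N k) : muClosed q D N k = muParam q u v w := by
  ext i
  fin_cases i <;>
    simp only [muClosed, muParam, Matrix.cons_val, Fin.zero_eta, Fin.isValue, Fin.mk_one,
      Fin.reduceFinMk, P.pow_N_sub_one, P.pow_k_sub_one, P.pow_N_sub_D_sub_one, P.pow_D_sub_one,
      P.pow_k, P.pow_D, P.pow_N_sub_D, P.tau_eq, theta_eq_param P.pow_D P.pow_N_sub_D] <;>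
    ring

end Params

theorem epsParam_pos (hq : 2 < q) (hu : 2 ≤ u) (hv : 2 ≤ v) (hw : 2 ≤ w) (j : Fin 6) :
    0 < epsParam q u v w j := by
  have hθ : 0 < q * u * v * w + 1 - q * u * v - q * w := by
    -- This form shows that the numerator of θ*₁ is at least 1.
    have h1 : q * u * v * w + 1 - q * u * v - q * w = q * ((u * v - 1) * (w - 1)) - (q - 1) := by
      ring
    have h2 : 1 ≤ (u * v - 1) * (w - 1) := by
      have : 1 ≤ u * v - 1 := by nlinarith
      nlinarith
    rw [h1]
    nlinarith
  have hq0 : 0 < q := by linarith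
  have hu0 : 0 < u := by linarith
  have hv0 : 0 < v := by linarith
  have hw0 : 0 < w := by linarith
  have hq1 : 0 < q - 1 := by linarith
  fin_cases j <;>
    simp only [epsParam, Matrix.cons_val, Fin.zero_eta, Fin.isValue, Fin.mk_one,
      Fin.reduceFinMk] <;>
    positivity

/-- The restrictions on the parameters are spent here: q > 2 for η₄, k ≥ 2 (the factor u − 1) for
η₆, k < D (the factor v − 1) for η₂ and η₆, and u < w for η₃ and η₆. -/
theorem etaParam_pos (hq : 2 < q) (hu : 2 ≤ u) (hv : 2 ≤ v) (hw : u < w) (j : Fin 6) :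
    0 < etaParam q u v w j := by
  have hq0 : 0 < q := by linarith
  have hu0 : 0 < u := by linarith
  have hv0 : 0 < v := by linarith
  have hw0 : 0 < w := by linarith
  have hq1 : 0 < q - 1 := by linarith
  have hq2 : 0 < q - 2 := by linarith
  have hu1 : 0 < u - 1 := by linarith
  have hv1 : 0 < v - 1 := by linarith
  have hwu : 0 < w - u := by linarith
  have hw1 : 0 < w - 1 := by linarith
  have hqu : 0 < q * u - 1 := by nlinarith
  have hquv : 0 < q * u * v - 1 := by nlinarith
  have hqw : 0 < q * w - 1 := by nlinarith
  have huv : 0 < u * v - 1 := by nlinarith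
  have hτ : 0 < tauParam q u v w := by
    rw [tauParam, show q * w - q = q * (w - 1) by ring]
    positivity
  fin_cases j <;>
    simp only [etaParam, Matrix.cons_val, Fin.zero_eta, Fin.isValue, Fin.mk_one,
      Fin.reduceFinMk] <;>
    positivity

end Parameters

/-! ### Inner products -/

section Gram

open Matrix Finset

variable {K : Type*} [Field K] [Fintype K] [DecidableEq K] {D N : ℕ} {x y : Vert K D N}
  {G : Matrix (Fin (N - D)) (Fin D) K}

theorem part_eq_image (hG : (y - x) * G * (y - x) = y - x) (h1 : 1 ≤ (graph K D N).dist x y)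
    (h2 : (graph K D N).dist x y < D) (hN : 2 * D < N) (i : Fin 6) :
    part x y i
      = ({W ∈ rankOne (Fin D) (Fin (N - D)) K | cls (y - x) G W = i}).image (fun W => x + W) := by
  ext z
  rw [mem_part hG h1 h2 hN, Finset.mem_image]
  constructor
  · exact fun h => ⟨z - x, Finset.mem_filter.2 h, add_sub_cancel _ _⟩
  · rintro ⟨W, hW, rfl⟩
    rw [add_sub_cancel_left]
    exact Finset.mem_filter.1 hW

/-- Reversing the pair negates M, G and W together, which leaves the class unchanged. Both
partitions are thus described by the same W, added to x or subtracted from y. -/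
theorem part_swap_eq_image (hG : (y - x) * G * (y - x) = y - x)
    (h1 : 1 ≤ (graph K D N).dist x y) (h2 : (graph K D N).dist x y < D) (hN : 2 * D < N)
    (i : Fin 6) :
    part y x i
      = ({W ∈ rankOne (Fin D) (Fin (N - D)) K | cls (y - x) G W = i}).image (fun W => y - W) := by
  have hG' : (x - y) * (-G) * (x - y) = x - y := by
    rw [← neg_sub y x]
    simp only [Matrix.neg_mul, Matrix.mul_neg, neg_neg, hG]
  have key : ∀ W, cls (x - y) (-G) (-W) = cls (y - x) G W := fun W => by
    rw [← neg_sub y x, cls_neg]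
  have hcomm : (graph K D N).dist y x = (graph K D N).dist x y := SimpleGraph.dist_comm
  ext z
  rw [mem_part hG' (by rwa [hcomm]) (by rwa [hcomm]) hN, Finset.mem_image]
  constructor
  · rintro ⟨h3, h4⟩
    refine ⟨y - z, Finset.mem_filter.2 ⟨?_, ?_⟩, sub_sub_cancel _ _⟩
    · rw [mem_rankOne, rank_sub_comm]
      exact mem_rankOne.1 h3
    · rw [← key, neg_sub, h4]
  · rintro ⟨W, hW, rfl⟩
    rw [Finset.mem_filter] at hW
    rw [sub_sub_cancel_left, key, mem_rankOne, rank_neg]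
    exact ⟨mem_rankOne.1 hW.1, hW.2⟩

theorem sum_part (hG : (y - x) * G * (y - x) = y - x) (h1 : 1 ≤ (graph K D N).dist x y)
    (h2 : (graph K D N).dist x y < D) (hN : 2 * D < N) {E : Type*} [AddCommMonoid E]
    (f : Vert K D N → E) (i : Fin 6) :
    ∑ z ∈ part x y i, f z
      = ∑ W ∈ rankOne (Fin D) (Fin (N - D)) K with cls (y - x) G W = i, f (x + W) := by
  rw [part_eq_image hG h1 h2 hN, Finset.sum_image (fun _ _ _ _ h => add_right_injective x h)]

theorem sum_part_swap (hG : (y - x) * G * (y - x) = y - x) (h1 : 1 ≤ (graph K D N).dist x y)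
    (h2 : (graph K D N).dist x y < D) (hN : 2 * D < N) {E : Type*} [AddCommMonoid E]
    (f : Vert K D N → E) (i : Fin 6) :
    ∑ z ∈ part y x i, f z
      = ∑ W ∈ rankOne (Fin D) (Fin (N - D)) K with cls (y - x) G W = i, f (y - W) := by
  rw [part_swap_eq_image hG h1 h2 hN, Finset.sum_image (fun _ _ _ _ h => sub_right_injective h)]

theorem EO_eq_sum (x y : Vert K D N) (i : Fin 6) :
    EO x y i = ∑ z ∈ part x y i, idem K D N (hat z) := by
  rw [EO, hatSet, map_sum]

theorem sum_smul_EO (hG : (y - x) * G * (y - x) = y - x) (h1 : 1 ≤ (graph K D N).dist x y)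
    (h2 : (graph K D N).dist x y < D) (hN : 2 * D < N) (g : Fin 6 → ℝ) :
    ∑ i, g i • EO x y i
      = ∑ W ∈ rankOne (Fin D) (Fin (N - D)) K,
        g (cls (y - x) G W) • idem K D N (hat (x + W)) := by
  simp only [EO_eq_sum, sum_part hG h1 h2 hN, Finset.smul_sum]
  rw [← Finset.sum_fiberwise (s := rankOne (Fin D) (Fin (N - D)) K) (g := cls (y - x) G)]
  refine Finset.sum_congr rfl fun i _ => Finset.sum_congr rfl fun W hW => ?_
  rw [(Finset.mem_filter.1 hW).2]

theorem card_part (hG : (y - x) * G * (y - x) = y - x) (h1 : 1 ≤ (graph K D N).dist x y)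
    (h2 : (graph K D N).dist x y < D) (hN : 2 * D < N) (i : Fin 6) :
    (#(part x y i) : ℝ) = clsCard (Fintype.card K)
      ((Fintype.card K : ℝ) ^ ((graph K D N).dist x y - 1)) (Fintype.card K ^ D)
      (Fintype.card K ^ (N - D)) i := by
  have hk : (graph K D N).dist x y = (y - x).rank := by rw [dist_eq_rank, rank_sub_comm]
  rw [part_eq_image hG h1 h2 hN,
    Finset.card_image_of_injective _ (fun _ _ h => add_right_injective x h),
    card_filter_cls hG (r := (graph K D N).dist x y - 1) (by omega)]
  simp

/-- The hypothesis `he` says that the Gram operator takes the class function g to e; the inner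
product is then a weighted sum over six classes. -/
theorem inner_sum_smul_EO (hG : (y - x) * G * (y - x) = y - x)
    (h1 : 1 ≤ (graph K D N).dist x y) (h2 : (graph K D N).dist x y < D) (hN : 2 * D < N)
    (f g e : Fin 6 → ℝ)
    (he : ∀ i,
      theta (Fintype.card K) D N 2 * ∑ l, clsCard (Fintype.card K)
          ((Fintype.card K : ℝ) ^ ((graph K D N).dist x y - 1)) (Fintype.card K ^ D)
          (Fintype.card K ^ (N - D)) l * g l
        + (theta (Fintype.card K) D N 1 - theta (Fintype.card K) D N 2) *
          (rowSum (Fintype.card K) ((Fintype.card K : ℝ) ^ ((graph K D N).dist x y - 1))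
              (Fintype.card K ^ (N - D)) g i
            + colSum (Fintype.card K) ((Fintype.card K : ℝ) ^ ((graph K D N).dist x y - 1))
              (Fintype.card K ^ D) g i
            - lineSum (Fintype.card K) g i)
        + (theta (Fintype.card K) D N 0 - theta (Fintype.card K) D N 1) * g i = e i) :
    inner ℝ (∑ i, f i • EO x y i) (∑ i, g i • EO x y i)
      = (Fintype.card (Vert K D N) : ℝ)⁻¹ * ∑ l, clsCard (Fintype.card K)
          ((Fintype.card K : ℝ) ^ ((graph K D N).dist x y - 1)) (Fintype.card K ^ D)
          (Fintype.card K ^ (N - D)) l * (f l * e l) := by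
  have hk : (graph K D N).dist x y = (y - x).rank := by rw [dist_eq_rank, rank_sub_comm]
  have hr : (y - x).rank = (graph K D N).dist x y - 1 + 1 := by omega
  rw [sum_smul_EO hG h1 h2 hN, sum_smul_EO hG h1 h2 hN, sum_inner]
  have hinner : ∀ W ∈ rankOne (Fin D) (Fin (N - D)) K,
      inner ℝ (f (cls (y - x) G W) • idem K D N (hat (x + W)))
        (∑ W' ∈ rankOne (Fin D) (Fin (N - D)) K,
          g (cls (y - x) G W') • idem K D N (hat (x + W')))
      = (Fintype.card (Vert K D N) : ℝ)⁻¹ * ((fun l => f l * e l) (cls (y - x) G W)) := by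
    intro W hW
    have h := sum_rankOne_theta_cls hG hr (theta (Fintype.card K) D N) g hW
    simp only [Fintype.card_fin] at h
    rw [he] at h
    rw [inner_sum]
    dsimp only
    rw [← h, Finset.mul_sum, Finset.mul_sum]
    refine Finset.sum_congr rfl fun W' _ => ?_
    rw [real_inner_smul_left, real_inner_smul_right, inner_idem_hat (by omega) (by omega),
      add_sub_add_left_eq_sub]
    ring
  rw [Finset.sum_congr rfl hinner, ← Finset.mul_sum]
  refine congrArg _ ((sum_rankOne_cls hG hr (fun l => f l * e l)).trans ?_)
  simp only [Fintype.card_fin]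

theorem inner_EO_idem_hat_sub (hG : (y - x) * G * (y - x) = y - x)
    (h1 : 1 ≤ (graph K D N).dist x y) (h2 : (graph K D N).dist x y < D) (hN : 2 * D < N)
    (i : Fin 6) :
    inner ℝ (EO x y i) (idem K D N (hat x) - idem K D N (hat y))
      = (Fintype.card (Vert K D N) : ℝ)⁻¹ * (#(part x y i) * (theta (Fintype.card K) D N 1
        - theta (Fintype.card K) D N ((![(graph K D N).dist x y - 1, (graph K D N).dist x y,
          (graph K D N).dist x y, (graph K D N).dist x y, (graph K D N).dist x y,
          (graph K D N).dist x y + 1] : Fin 6 → ℕ) i))) := by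
  have hk : (graph K D N).dist x y = (y - x).rank := by rw [dist_eq_rank, rank_sub_comm]
  rw [EO_eq_sum, sum_inner, Finset.sum_congr rfl (g := fun _ => (Fintype.card (Vert K D N) : ℝ)⁻¹ *
    (theta (Fintype.card K) D N 1 - theta (Fintype.card K) D N ((![(graph K D N).dist x y - 1,
      (graph K D N).dist x y, (graph K D N).dist x y, (graph K D N).dist x y,
      (graph K D N).dist x y, (graph K D N).dist x y + 1] : Fin 6 → ℕ) i)))]
  · rw [Finset.sum_const, nsmul_eq_mul]
    ring
  · intro z hz
    rw [mem_part hG h1 h2 hN] at hz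
    have h3 := rank_sub_of_cls hG hz.1
    rw [hz.2, sub_sub_sub_cancel_right, ← hk, rank_sub_comm] at h3
    rw [inner_sub_right, inner_idem_hat (by omega) (by omega), inner_idem_hat (by omega) (by omega),
      mem_rankOne.1 hz.1, h3]
    ring

theorem norm_idem_hat_sub_sq (hD : 0 < D) (hN : D < N) (x y : Vert K D N) :
    inner ℝ (idem K D N (hat x) - idem K D N (hat y)) (idem K D N (hat x) - idem K D N (hat y))
      = (Fintype.card (Vert K D N) : ℝ)⁻¹ * (2 * (theta (Fintype.card K) D N 0
        - theta (Fintype.card K) D N ((graph K D N).dist x y))) := by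
  rw [inner_sub_left, inner_sub_right, inner_sub_right, inner_idem_hat hD hN, inner_idem_hat hD hN,
    inner_idem_hat hD hN, inner_idem_hat hD hN, dist_eq_rank, rank_sub_comm y x, sub_self, sub_self,
    Matrix.rank_zero]
  ring

theorem inner_h_idem_hat_sub (hG : (y - x) * G * (y - x) = y - x)
    (h1 : 1 ≤ (graph K D N).dist x y) (h2 : (graph K D N).dist x y < D) (hN : 2 * D < N)
    (j : Fin 6) :
    inner ℝ (h x y j) (idem K D N (hat x) - idem K D N (hat y))
      = (Fintype.card (Vert K D N) : ℝ)⁻¹ * ((theta (Fintype.card K) D N 0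
        - theta (Fintype.card K) D N ((graph K D N).dist x y)) * mu x y j) := by
  have hθ : theta (Fintype.card K) D N 0
      - theta (Fintype.card K) D N ((graph K D N).dist x y) ≠ 0 :=
    sub_ne_zero.2 (theta_lt_theta (one_lt_card_real K) (by omega) (by omega)).ne'
  rw [h, sum_inner, mu, Finset.mul_sum, Finset.mul_sum]
  refine Finset.sum_congr rfl fun i _ => ?_
  rw [real_inner_smul_left, inner_EO_idem_hat_sub hG h1 h2 hN, lam]
  field_simp

end Gram

/-! ### Gram matrix of the vectors h_j and closed forms of the μ_j -/

section Basis

open Matrix Finset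

variable {K : Type*} [Field K] [Fintype K] [DecidableEq K] {D N : ℕ} {x y : Vert K D N}

theorem inner_h (h1 : 1 ≤ (graph K D N).dist x y) (h2 : (graph K D N).dist x y < D)
    (hN : 2 * D < N) (i j : Fin 6) :
    inner ℝ (h x y i) (h x y j)
      = (Fintype.card (Vert K D N) : ℝ)⁻¹ * (eps (Fintype.card K) D N j *
        if i = j then eta (Fintype.card K) D N ((graph K D N).dist x y) i else 0) := by
  obtain ⟨G, hG⟩ := exists_generalized_inverse (y - x)
  have hq := one_lt_card_real K
  have hq0 : (Fintype.card K : ℝ) ≠ 0 := by linarith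
  have hq1 : (Fintype.card K : ℝ) - 1 ≠ 0 := by linarith
  have P := params_of_lt (q := Fintype.card K) h1 h2 hN
  have hu : (Fintype.card K : ℝ) ^ ((graph K D N).dist x y - 1) ≠ 0 := pow_ne_zero _ hq0
  rw [h, h, inner_sum_smul_EO hG h1 h2 hN _ _ (fun i => eps (Fintype.card K) D N j *
    matH (Fintype.card K) D N ((graph K D N).dist x y) i j)]
  · rw [P.matH_eq hq1 hq0 hu, P.eps_eq, P.eta_eq hq1 hq0, ← matHParam_orthogonal hq1, P.pow_D,
      P.pow_N_sub_D]
    congr 1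
    rw [Finset.mul_sum]
    exact Finset.sum_congr rfl fun l _ => by ring
  · intro l
    rw [P.matH_eq hq1 hq0 hu, P.eps_eq, ← matHParam_eigen hq1, theta_eq_param P.pow_D P.pow_N_sub_D,
      theta_eq_param P.pow_D P.pow_N_sub_D, theta_eq_param P.pow_D P.pow_N_sub_D,
      P.pow_N_sub_zero, P.pow_N_sub_one, P.pow_N_sub_two, P.pow_D, P.pow_N_sub_D]
    generalize (Fintype.card K : ℝ) ^ ((graph K D N).dist x y - 1) = u
    generalize (Fintype.card K : ℝ) ^ (D - (graph K D N).dist x y) = v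
    generalize (Fintype.card K : ℝ) ^ (N - D - 1) = w
    generalize (Fintype.card K : ℝ) = q at *
    congr 1
    · congr 1
      congr 1
      field_simp
      ring
    · congr 1
      field_simp
      ring

theorem theta_sub_theta (q : ℝ) (D N i j : ℕ) :
    theta q D N i - theta q D N j = (q ^ (N - i) - q ^ (N - j)) / (q - 1) := by
  rw [theta, theta, div_sub_div_same]
  ring

theorem mu_eq_muClosed (h1 : 1 ≤ (graph K D N).dist x y) (h2 : (graph K D N).dist x y < D)
    (hN : 2 * D < N) (j : Fin 6) :
    mu x y j = muClosed (Fintype.card K) D N ((graph K D N).dist x y) j := by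
  obtain ⟨G, hG⟩ := exists_generalized_inverse (y - x)
  have hq := one_lt_card_real K
  have hq0 : (Fintype.card K : ℝ) ≠ 0 := by linarith
  have hq1 : (Fintype.card K : ℝ) - 1 ≠ 0 := by linarith
  have P := params_of_lt (q := Fintype.card K) h1 h2 hN
  have hu : 1 ≤ (Fintype.card K : ℝ) ^ ((graph K D N).dist x y - 1) := one_le_pow₀ hq.le
  have hqu : (Fintype.card K : ℝ) * (Fintype.card K : ℝ) ^ ((graph K D N).dist x y - 1) - 1 ≠ 0 := by
    nlinarith
  have hv : (Fintype.card K : ℝ) ^ (D - (graph K D N).dist x y) ≠ 0 := pow_ne_zero _ hq0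
  have hw : (Fintype.card K : ℝ) ^ (N - D - 1) ≠ 0 := pow_ne_zero _ hq0
  rw [P.muClosed_eq, ← matHParam_mu hq1 hq0 hqu hv hw, mu, P.matH_eq hq1 hq0 (by linarith)]
  refine Finset.sum_congr rfl fun i _ => ?_
  congr 1
  rw [lam]
  rw [card_part hG h1 h2 hN, P.pow_D, P.pow_N_sub_D]
  congr 1
  rw [theta_sub_theta, theta_sub_theta, div_div_div_cancel_right₀ hq1, P.pow_N_sub_zero,
    P.pow_N_sub_one, P.pow_N_sub_k]
  congr 1
  · fin_cases i <;>
      simp only [Matrix.cons_val, Fin.zero_eta, Fin.isValue, Fin.mk_one, Fin.reduceFinMk,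
        P.pow_N_sub_k, P.pow_N_sub_k_sub_one, P.pow_N_sub_k_add_one]
  · ring

end Basis

/-! ### Fourier transforms of the classes -/

section ClassFourier

open Matrix Finset

variable {K ι κ : Type*} [Field K] [Fintype K] [DecidableEq K] [Fintype ι] [Fintype κ]
  [DecidableEq ι] [DecidableEq κ]

theorem exists_psi_ne_one : ∃ t : K, psi K t ≠ 1 := by
  by_contra! h
  have h1 := sum_psi (K := K)
  simp [h] at h1

theorem pair_vecMulVec_vecMulVec (p a : ι → K) (r b : κ → K) :
    pair (vecMulVec p r) (vecMulVec a b) = (p ⬝ᵥ a) * (r ⬝ᵥ b) := by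
  rw [pair_vecMulVec, vecMul_vecMulVec, smul_dotProduct, smul_eq_mul, dotProduct_comm a p]

theorem pair_vecMulVec_left (p : ι → K) (r : κ → K) (M : Matrix ι κ K) :
    pair (vecMulVec p r) M = p ⬝ᵥ (M *ᵥ r) := by
  rw [pair_comm, pair_vecMulVec, Matrix.dotProduct_mulVec]

open Classical in
theorem card_mul_card_filter_dotProduct_eq_zero (U : Submodule K (ι → K)) {p : ι → K}
    (hp : ∃ u ∈ U, p ⬝ᵥ u ≠ 0) :
    Fintype.card K * #{a : ι → K | a ∈ U ∧ p ⬝ᵥ a = 0} = #{a : ι → K | a ∈ U} := by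
  have hne : Module.finrank K U ≠ 0 := by
    obtain ⟨u, hu, hfu⟩ := hp
    intro h0
    rw [Submodule.finrank_eq_zero.1 h0, Submodule.mem_bot] at hu
    exact hfu (by rw [hu, dotProduct_zero])
  have hc : #{a : ι → K | a ∈ U} = Fintype.card K * Fintype.card K ^ (Module.finrank K U - 1) := by
    rw [card_filter_mem_submodule, ← pow_succ', Nat.sub_add_cancel (by omega)]
  have h := sum_submodule_comp_linear U (dotProductEquiv K ι p) hp hc
    (fun t => if t = 0 then 1 else 0)
  rw [← Finset.card_filter, Finset.sum_ite_eq', if_pos (Finset.mem_univ _), smul_eq_mul, mul_one,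
    Finset.filter_filter] at h
  rw [hc, ← h]
  rfl

open Classical in
-- For fixed a in U, the sum over b in V is |V| or 0 according to whether the phase is trivial on V;
-- the last three terms remove a = 0 and b = 0.
theorem sum_submodule_prod_psi (U : Submodule K (ι → K)) (V : Submodule K (κ → K))
    (p : ι → K) (r : κ → K) :
    ∑ a ∈ univ.erase (0 : ι → K), ∑ b ∈ univ.erase (0 : κ → K),
        (if a ∈ U ∧ b ∈ V then psi K ((p ⬝ᵥ a) * (r ⬝ᵥ b)) else 0)
      = (#{b | b ∈ V} : ℂ) * #{a | a ∈ U ∧ ∀ b ∈ V, (p ⬝ᵥ a) * (r ⬝ᵥ b) = 0} - #{b | b ∈ V}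
        - #{a | a ∈ U} + 1 := by
  have h1 : ∀ a, ∑ b ∈ univ.erase (0 : κ → K),
      (if a ∈ U ∧ b ∈ V then psi K ((p ⬝ᵥ a) * (r ⬝ᵥ b)) else 0)
      = if a ∈ U then (if ∀ b ∈ V, (p ⬝ᵥ a) * (r ⬝ᵥ b) = 0 then (#{b | b ∈ V} : ℂ) else 0) - 1
        else 0 := by
    intro a
    by_cases ha : a ∈ U
    · simp only [ha, true_and, if_true]
      rw [Finset.sum_erase_eq_sub (Finset.mem_univ _), if_pos V.zero_mem, dotProduct_zero, mul_zero,
        AddChar.map_zero_eq_one, ← Finset.sum_filter]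
      congr 1
      exact sum_submodule_psi V ((p ⬝ᵥ a) • dotProductEquiv K κ r)
    · simp [ha]
  rw [Finset.sum_congr rfl (fun a _ => h1 a), Finset.sum_erase_eq_sub (Finset.mem_univ _),
    if_pos U.zero_mem, if_pos (by simp), ← Finset.sum_filter, Finset.sum_sub_distrib,
    ← Finset.sum_filter, Finset.filter_filter, Finset.sum_const, Finset.sum_const]
  simp only [nsmul_eq_mul]
  ring

open Classical in
-- If p · Mr ≠ 0, then p is nonzero on U (at Mr) and r is nonzero on V (at pM). The phase is then
-- trivial on V only for the a in U orthogonal to p, a fraction 1/q of U.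
theorem exists_sum_submodule_prod_psi (M : Matrix ι κ K) (U : Submodule K (ι → K))
    (V : Submodule K (κ → K)) (hU : LinearMap.range M.mulVecLin ≤ U)
    (hV : LinearMap.range M.vecMulLinear ≤ V) :
    ∃ c : ℝ, ∀ (p : ι → K) (r : κ → K), ∃ ρ : ℝ,
      ∑ a ∈ univ.erase (0 : ι → K), ∑ b ∈ univ.erase (0 : κ → K),
        (if a ∈ U ∧ b ∈ V then psi K ((p ⬝ᵥ a) * (r ⬝ᵥ b)) else 0) = ρ
      ∧ (p ⬝ᵥ (M *ᵥ r) ≠ 0 → ρ = c) := by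
  refine ⟨(#{b | b ∈ V} : ℝ) * ((#{a | a ∈ U} : ℝ) / Fintype.card K) - #{b | b ∈ V}
    - #{a | a ∈ U} + 1, fun p r => ⟨(#{b | b ∈ V} : ℝ) *
      #{a | a ∈ U ∧ ∀ b ∈ V, (p ⬝ᵥ a) * (r ⬝ᵥ b) = 0} - #{b | b ∈ V} - #{a | a ∈ U} + 1, ?_, ?_⟩⟩
  · push_cast
    rw [← sum_submodule_prod_psi]
  · intro hs
    have hM : M *ᵥ r ∈ U := hU ⟨r, rfl⟩
    have h := card_mul_card_filter_dotProduct_eq_zero U ⟨_, hM, hs⟩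
    have hr : ∃ b ∈ V, r ⬝ᵥ b ≠ 0 := by
      refine ⟨p ᵥ* M, hV ⟨p, rfl⟩, ?_⟩
      rwa [dotProduct_comm, ← Matrix.dotProduct_mulVec]
    have hset : #{a : ι → K | a ∈ U ∧ ∀ b ∈ V, (p ⬝ᵥ a) * (r ⬝ᵥ b) = 0}
        = #{a : ι → K | a ∈ U ∧ p ⬝ᵥ a = 0} := by
      congr 1
      ext a
      simp only [Finset.mem_filter, Finset.mem_univ, true_and]
      refine and_congr_right fun _ => ⟨fun ha => ?_, fun ha b _ => by rw [ha, zero_mul]⟩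
      obtain ⟨b, hb, hrb⟩ := hr
      exact (mul_eq_zero.1 (ha b hb)).resolve_right hrb
    have h' : (Fintype.card K : ℝ) * #{a : ι → K | a ∈ U ∧ p ⬝ᵥ a = 0} = #{a : ι → K | a ∈ U} := by
      exact_mod_cast h
    have hq := one_lt_card_real K
    rw [hset, ← h', mul_div_cancel_left₀ _ (by linarith)]

variable {M : Matrix ι κ K} {G : Matrix κ ι K}

open Classical in
-- Writing b = uM, the constraint is u · a = τ and the phase is (p · a)(u · Mr). It is constant on
-- this affine space exactly when (p · a) Mr is a multiple of a; otherwise the character sum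
-- cancels. If p · a ≠ 0, pairing with p shows that the multiple can only be p · Mr.
theorem sum_affine_psi (hG : M * G * M = M) {n : ℕ} (hn : M.rank = n + 1) {a : ι → K} (ha : a ≠ 0)
    (hC : a ∈ LinearMap.range M.mulVecLin) (τ : K) (p : ι → K) (r : κ → K) :
    ∑ b with b ∈ LinearMap.range M.vecMulLinear ∧ b ⬝ᵥ (G *ᵥ a) = τ, psi K ((p ⬝ᵥ a) * (r ⬝ᵥ b))
      = (Fintype.card K : ℂ) ^ n * ((if p ⬝ᵥ a = 0 then 1 else 0)
        + (if p ⬝ᵥ a ≠ 0 ∧ (p ⬝ᵥ a) • (M *ᵥ r) = (p ⬝ᵥ (M *ᵥ r)) • a then 1 else 0)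
          * psi K ((p ⬝ᵥ (M *ᵥ r)) * τ)) := by
  set R := LinearMap.range M.vecMulLinear with hR
  have hGa := (mulVec_mulVec_eq_iff hG).2 hC
  have hRG : ∀ u, (u ᵥ* M) ⬝ᵥ (G *ᵥ a) = u ⬝ᵥ a := fun u => by
    rw [← Matrix.dotProduct_mulVec, hGa]
  have hRr : ∀ u, r ⬝ᵥ (u ᵥ* M) = u ⬝ᵥ (M *ᵥ r) := fun u => by
    rw [dotProduct_comm, ← Matrix.dotProduct_mulVec]
  have hcard : #{b | b ∈ R ∧ b ⬝ᵥ (G *ᵥ a) = τ} = Fintype.card K ^ n := by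
    have hc : #{b | b ∈ R} = Fintype.card K * Fintype.card K ^ n := by
      rw [card_filter_mem_submodule, hR, finrank_range_vecMulLinear, hn, pow_succ']
    have hne : ∃ b ∈ R, dotProductEquiv K κ (G *ᵥ a) b ≠ 0 := by
      obtain ⟨i, hi⟩ := Function.ne_iff.1 ha
      refine ⟨Pi.single i 1 ᵥ* M, ⟨_, rfl⟩, ?_⟩
      rw [dotProductEquiv_apply_apply, dotProduct_comm, hRG]
      simpa using hi
    have h := sum_submodule_comp_linear R (dotProductEquiv K κ (G *ᵥ a)) hne hc
      (fun t => if t = τ then 1 else 0)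
    rw [← Finset.card_filter, Finset.sum_ite_eq', if_pos (Finset.mem_univ _), smul_eq_mul, mul_one,
      Finset.filter_filter] at h
    rw [← h]
    simp only [dotProductEquiv_apply_apply, dotProduct_comm]
  have hmul : ∀ l : K, (p ⬝ᵥ a) • (M *ᵥ r) = l • a →
      ∑ b with b ∈ R ∧ b ⬝ᵥ (G *ᵥ a) = τ, psi K ((p ⬝ᵥ a) * (r ⬝ᵥ b))
        = (Fintype.card K : ℂ) ^ n * psi K (l * τ) := by
    intro l hl
    rw [Finset.sum_congr rfl (g := fun _ => psi K (l * τ)), Finset.sum_const, hcard, nsmul_eq_mul,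
      Nat.cast_pow]
    intro b hb
    simp only [Finset.mem_filter, Finset.mem_univ, true_and] at hb
    obtain ⟨⟨u, rfl⟩, h2⟩ := hb
    rw [Matrix.vecMulLinear_apply] at h2 ⊢
    rw [hRG] at h2
    rw [hRr, ← smul_eq_mul, ← dotProduct_smul, hl, dotProduct_smul, h2, smul_eq_mul]
  by_cases hx : p ⬝ᵥ a = 0
  · rw [hmul 0 (by rw [hx, zero_smul, zero_smul])]
    simp [hx]
  · by_cases hs : (p ⬝ᵥ a) • (M *ᵥ r) = (p ⬝ᵥ (M *ᵥ r)) • a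
    · rw [hmul _ hs]
      simp [hx, hs]
    · rw [if_neg hx, if_neg (fun h => hs h.2), zero_mul, add_zero, mul_zero]
      have hspan : (p ⬝ᵥ a) • (M *ᵥ r) ∉ Submodule.span K {a} := by
        rw [Submodule.mem_span_singleton]
        rintro ⟨l, hl⟩
        have h1 := congrArg (fun z => p ⬝ᵥ z) hl
        simp only [dotProduct_smul, smul_eq_mul] at h1
        rw [mul_comm] at h1
        have h2 := mul_left_cancel₀ hx h1
        exact hs (by rw [← hl, h2])
      -- A functional u killing a but not (p · a) Mr gives a translation z that preserves the
      -- constraint and multiplies the sum by some ψ(t) ≠ 1.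
      obtain ⟨f, hf, hle⟩ := Submodule.exists_le_ker_of_notMem hspan
      obtain ⟨u, rfl⟩ := (dotProductEquiv K ι).surjective f
      have hua : u ⬝ᵥ a = 0 := hle (Submodule.mem_span_singleton_self a)
      rw [dotProductEquiv_apply_apply, dotProduct_smul, smul_eq_mul] at hf
      obtain ⟨t, ht⟩ := exists_psi_ne_one (K := K)
      set z := (t / ((p ⬝ᵥ a) * (u ⬝ᵥ (M *ᵥ r)))) • (u ᵥ* M) with hz
      have hzR : z ∈ R := R.smul_mem _ ⟨u, rfl⟩
      have hzG : z ⬝ᵥ (G *ᵥ a) = 0 := by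
        rw [hz, smul_dotProduct, hRG, hua, smul_zero]
      have hzr : (p ⬝ᵥ a) * (r ⬝ᵥ z) = t := by
        rw [hz, dotProduct_smul, hRr, smul_eq_mul, mul_left_comm, div_mul_cancel₀ _ hf]
      have hshift : ∑ b with b ∈ R ∧ b ⬝ᵥ (G *ᵥ a) = τ, psi K ((p ⬝ᵥ a) * (r ⬝ᵥ b))
          = psi K t * ∑ b with b ∈ R ∧ b ⬝ᵥ (G *ᵥ a) = τ, psi K ((p ⬝ᵥ a) * (r ⬝ᵥ b)) := by
        rw [Finset.mul_sum]
        refine Finset.sum_bij' (fun b _ => b - z) (fun b _ => b + z) ?_ ?_ ?_ ?_ ?_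
        · intro b hb
          simp only [Finset.mem_filter, Finset.mem_univ, true_and] at hb ⊢
          exact ⟨R.sub_mem hb.1 hzR, by rw [sub_dotProduct, hzG, hb.2, sub_zero]⟩
        · intro b hb
          simp only [Finset.mem_filter, Finset.mem_univ, true_and] at hb ⊢
          exact ⟨R.add_mem hb.1 hzR, by rw [add_dotProduct, hzG, hb.2, add_zero]⟩
        · intro b _
          exact sub_add_cancel _ _
        · intro b _
          exact add_sub_cancel_right _ _
        · intro b _
          rw [← AddChar.map_add_eq_mul, dotProduct_sub, mul_sub, hzr, add_sub_cancel]
      have h3 : (1 - psi K t)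
          * ∑ b with b ∈ R ∧ b ⬝ᵥ (G *ᵥ a) = τ, psi K ((p ⬝ᵥ a) * (r ⬝ᵥ b)) = 0 := by
        linear_combination hshift
      exact (mul_eq_zero.1 h3).resolve_left (sub_ne_zero.2 (Ne.symm ht))

open Classical in
-- In ρ one counts the a orthogonal to p, in σ the a not orthogonal to p that satisfy the
-- proportionality. When p · Mr ≠ 0, the latter are the q − 1 nonzero multiples of Mr.
theorem exists_sum_affine_psi (hG : M * G * M = M) {n : ℕ} (hn : M.rank = n + 1) (τ : K) :
    ∃ c c' : ℝ, ∀ (p : ι → K) (r : κ → K), ∃ ρ σ : ℝ,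
      ∑ a ∈ univ.erase (0 : ι → K), ∑ b ∈ univ.erase (0 : κ → K),
        (if a ∈ LinearMap.range M.mulVecLin ∧ b ∈ LinearMap.range M.vecMulLinear
          ∧ b ⬝ᵥ (G *ᵥ a) = τ then psi K ((p ⬝ᵥ a) * (r ⬝ᵥ b)) else 0)
        = ρ + σ * psi K ((p ⬝ᵥ (M *ᵥ r)) * τ)
      ∧ (p ⬝ᵥ (M *ᵥ r) ≠ 0 → ρ = c ∧ σ = c') := by
  set C := LinearMap.range M.mulVecLin with hC
  set R := LinearMap.range M.vecMulLinear with hR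
  set q : ℝ := ((Fintype.card K : ℕ) : ℝ) with hq
  -- The excluded vector b = 0 meets the constraint only for τ = 0, and this is its contribution.
  set e : ℝ := if τ = 0 then 1 else 0 with he
  refine ⟨q ^ n * ((#{a | a ∈ C} : ℝ) / q - 1) - (#{a | a ∈ C} - 1) * e, q ^ n * (q - 1),
    fun p r => ⟨q ^ n * ((#{a | a ∈ C ∧ p ⬝ᵥ a = 0} : ℝ) - 1) - (#{a | a ∈ C} - 1) * e,
      q ^ n * #{a | a ∈ C ∧ p ⬝ᵥ a ≠ 0 ∧ (p ⬝ᵥ a) • (M *ᵥ r) = (p ⬝ᵥ (M *ᵥ r)) • a}, ?_, ?_⟩⟩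
  · have h1 : ∀ a ∈ univ.erase (0 : ι → K), ∑ b ∈ univ.erase (0 : κ → K),
        (if a ∈ C ∧ b ∈ R ∧ b ⬝ᵥ (G *ᵥ a) = τ then psi K ((p ⬝ᵥ a) * (r ⬝ᵥ b)) else 0)
        = (if a ∈ C then ((Fintype.card K : ℂ) ^ n * ((if p ⬝ᵥ a = 0 then 1 else 0)
        + (if p ⬝ᵥ a ≠ 0 ∧ (p ⬝ᵥ a) • (M *ᵥ r) = (p ⬝ᵥ (M *ᵥ r)) • a then 1 else 0)
          * psi K ((p ⬝ᵥ (M *ᵥ r)) * τ)) - (e : ℂ)) else 0) := by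
      intro a ha
      by_cases hc : a ∈ C
      · simp only [hc, true_and, if_true]
        rw [Finset.sum_erase_eq_sub (Finset.mem_univ _), ← Finset.sum_filter]
        congr 1
        · exact sum_affine_psi hG hn (Finset.ne_of_mem_erase ha) hc τ p r
        · simp [he, R.zero_mem, eq_comm, apply_ite Complex.ofReal]
      · simp [hc]
    rw [Finset.sum_congr rfl h1, Finset.sum_erase_eq_sub (Finset.mem_univ _), if_pos C.zero_mem,
      ← Finset.sum_filter, Finset.sum_sub_distrib, ← Finset.mul_sum, Finset.sum_add_distrib,
      ← Finset.sum_mul, Finset.sum_boole, Finset.sum_boole, Finset.filter_filter,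
      Finset.filter_filter, Finset.sum_const]
    simp only [nsmul_eq_mul, dotProduct_zero, if_true, ne_eq, not_true_eq_false, false_and,
      if_false]
    have hqc : (q : ℂ) = Fintype.card K := by rw [hq, Complex.ofReal_natCast]
    push_cast
    rw [hqc]
    ring
  · intro hs
    have hMr : M *ᵥ r ∈ C := ⟨r, rfl⟩
    have h := card_mul_card_filter_dotProduct_eq_zero C ⟨_, hMr, hs⟩
    have h' : q * #{a : ι → K | a ∈ C ∧ p ⬝ᵥ a = 0} = #{a : ι → K | a ∈ C} := by
      rw [hq]
      exact_mod_cast h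
    have hq1 := one_lt_card_real K
    have hq0 : q ≠ 0 := by linarith
    constructor
    · rw [← h', mul_div_cancel_left₀ _ hq0]
    · congr 1
      have hcount : #{a | a ∈ C ∧ p ⬝ᵥ a ≠ 0 ∧ (p ⬝ᵥ a) • (M *ᵥ r) = (p ⬝ᵥ (M *ᵥ r)) • a}
          = #(univ.erase (0 : K)) := by
        symm
        refine Finset.card_bij' (fun t _ => t • (M *ᵥ r)) (fun a _ => (p ⬝ᵥ a) / (p ⬝ᵥ (M *ᵥ r)))
          ?_ ?_ ?_ ?_
        · intro t ht
          have ht0 := Finset.ne_of_mem_erase ht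
          simp only [Finset.mem_filter, Finset.mem_univ, true_and, dotProduct_smul, smul_eq_mul]
          exact ⟨C.smul_mem _ hMr, mul_ne_zero ht0 hs, by rw [smul_smul, mul_comm]⟩
        · intro a ha
          simp only [Finset.mem_filter, Finset.mem_univ, true_and] at ha
          exact Finset.mem_erase.2 ⟨div_ne_zero ha.2.1 hs, Finset.mem_univ _⟩
        · intro t _
          rw [dotProduct_smul, smul_eq_mul, mul_div_cancel_right₀ _ hs]
        · intro a ha
          simp only [Finset.mem_filter, Finset.mem_univ, true_and] at ha
          rw [div_eq_inv_mul, mul_smul, ha.2.2, smul_smul, inv_mul_cancel₀ hs, one_smul]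
      rw [hcount, Finset.card_erase_of_mem (Finset.mem_univ _), Finset.card_univ,
        Nat.cast_sub Fintype.card_pos, Nat.cast_one]

end ClassFourier

/-! ### The balanced set condition -/

section Balanced

open Matrix Finset

variable {K ι κ : Type*} [Field K] [Fintype K] [DecidableEq K] [Fintype ι] [Fintype κ]
  [DecidableEq ι] [DecidableEq κ]

/-- The Fourier transform at `A` of the function `g ∘ cls` on the rank-one matrices. -/
def clsFourier (M : Matrix ι κ K) (G : Matrix κ ι K) (A : Matrix ι κ K) (g : Fin 6 → ℝ) : ℂ :=
  ∑ W ∈ rankOne ι κ K, (g (cls M G W) : ℂ) * psi K (pair A W)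

theorem psi_mul_star_psi (t : K) : psi K t * starRingEnd ℂ (psi K t) = 1 := by
  rw [star_psi, ← AddChar.map_add_eq_mul, add_neg_cancel, AddChar.map_zero_eq_one]

/-- The functions `g` on the six classes such that the difference of the `g`-weighted sums over the
neighbourhoods of `0` and `M` projects to a multiple of the difference of the projections of `0` and
`M`. -/
def balanced (M : Matrix ι κ K) (G : Matrix κ ι K) : Submodule ℝ (Fin 6 → ℝ) where
  carrier := {g | ∃ c : ℝ, ∀ A ∈ rankOne ι κ K, clsFourier M G A g
    - psi K (pair A M) * starRingEnd ℂ (clsFourier M G A g) = c * (1 - psi K (pair A M))}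
  zero_mem' := ⟨0, fun A _ => by simp [clsFourier]⟩
  add_mem' := by
    rintro g g' ⟨c, hc⟩ ⟨c', hc'⟩
    refine ⟨c + c', fun A hA => ?_⟩
    have h : clsFourier M G A (g + g') = clsFourier M G A g + clsFourier M G A g' := by
      simp [clsFourier, add_mul, Finset.sum_add_distrib]
    rw [h, map_add]
    push_cast
    linear_combination hc A hA + hc' A hA
  smul_mem' := by
    rintro t g ⟨c, hc⟩
    refine ⟨t * c, fun A hA => ?_⟩
    have h : clsFourier M G A (t • g) = t * clsFourier M G A g := by
      simp [clsFourier, mul_assoc, Finset.mul_sum]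
    rw [h, map_mul, Complex.conj_ofReal]
    push_cast
    linear_combination (t : ℂ) * hc A hA

variable {M : Matrix ι κ K} {G : Matrix κ ι K}

theorem mem_balanced_of_exists {g : Fin 6 → ℝ} (h : ∃ c c' : ℝ, ∀ (p : ι → K) (r : κ → K),
    ∃ ρ σ : ℝ, ∑ a ∈ univ.erase (0 : ι → K), ∑ b ∈ univ.erase (0 : κ → K),
      (g (cls M G (vecMulVec a b)) : ℂ) * psi K ((p ⬝ᵥ a) * (r ⬝ᵥ b))
        = ρ + σ * psi K (p ⬝ᵥ (M *ᵥ r))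
      ∧ (p ⬝ᵥ (M *ᵥ r) ≠ 0 → ρ = c ∧ σ = c')) : g ∈ balanced M G := by
  obtain ⟨c, c', h⟩ := h
  -- From F = ρ + σψ(s) with real ρ and σ one gets F − ψ(s) F̄ = (ρ − σ)(1 − ψ(s)); the factor q − 1
  -- counts factorisations. For s = 0 both sides vanish, so ρ and σ need not be constant there.
  refine ⟨(c - c') / (Fintype.card K - 1), fun A hA => ?_⟩
  obtain ⟨p, r, -, -, rfl⟩ := rank_eq_one_iff.1 (mem_rankOne.1 hA)
  obtain ⟨ρ, σ, h1, h2⟩ := h p r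
  have hq := one_lt_card_real K
  have hq' : (Fintype.card K : ℂ) - 1 ≠ 0 := by
    rw [sub_ne_zero]
    exact_mod_cast hq.ne'
  have h3 := card_sub_one_nsmul_sum_rankOne
    (fun W : Matrix ι κ K => (g (cls M G W) : ℂ) * psi K (pair (vecMulVec p r) W))
  simp only [pair_vecMulVec_vecMulVec] at h3
  rw [h1, nsmul_eq_mul, Nat.cast_sub Fintype.card_pos, Nat.cast_one] at h3
  have h4 : clsFourier M G (vecMulVec p r) g
      = (ρ + σ * psi K (p ⬝ᵥ (M *ᵥ r))) / (Fintype.card K - 1) := by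
    rw [eq_div_iff hq', mul_comm]
    exact h3
  rw [h4, pair_vecMulVec_left]
  simp only [map_div₀, map_add, map_mul, Complex.conj_ofReal, map_sub, map_one,
    Complex.conj_natCast]
  have h5 := psi_mul_star_psi (p ⬝ᵥ (M *ᵥ r))
  push_cast
  by_cases hs : p ⬝ᵥ (M *ᵥ r) = 0
  · rw [hs, AddChar.map_zero_eq_one]
    simp
  · obtain ⟨rfl, rfl⟩ := h2 hs
    field_simp
    linear_combination -(σ : ℂ) * h5

open Classical in
theorem mem_balanced_of_submodule {g : Fin 6 → ℝ} (U : Submodule K (ι → K))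
    (V : Submodule K (κ → K)) (hU : LinearMap.range M.mulVecLin ≤ U)
    (hV : LinearMap.range M.vecMulLinear ≤ V)
    (hg : ∀ a ≠ 0, ∀ b ≠ 0, g (cls M G (vecMulVec a b)) = if a ∈ U ∧ b ∈ V then 1 else 0) :
    g ∈ balanced M G := by
  obtain ⟨c, h⟩ := exists_sum_submodule_prod_psi M U V hU hV
  refine mem_balanced_of_exists ⟨c, 0, fun p r => ?_⟩
  obtain ⟨ρ, h1, h2⟩ := h p r
  refine ⟨ρ, 0, ?_, fun hs => ⟨h2 hs, rfl⟩⟩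
  rw [Complex.ofReal_zero, zero_mul, add_zero, ← h1]
  refine Finset.sum_congr rfl fun a ha => Finset.sum_congr rfl fun b hb => ?_
  rw [hg a (Finset.ne_of_mem_erase ha) b (Finset.ne_of_mem_erase hb)]
  split_ifs <;> simp

set_option linter.unusedSimpArgs false in
-- Functions of the class are spanned by the indicators of four products U × V, each factor the full
-- space or the corresponding space of M, and by those of the classes with scalar 1 and scalar 0.
theorem balanced_eq_top (hG : M * G * M = M) {n : ℕ} (hn : M.rank = n + 1) :
    balanced M G = ⊤ := by
  classical
  have hg0 : ∀ a ≠ 0, ∀ b ≠ 0, (![1, 0, 0, 0, 0, 0] : Fin 6 → ℝ) (cls M G (vecMulVec a b))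
      = if a ∈ LinearMap.range M.mulVecLin ∧ b ∈ LinearMap.range M.vecMulLinear
          ∧ b ⬝ᵥ (G *ᵥ a) = 1 then 1 else 0 := fun a ha b hb => by
    rw [cls_vecMulVec hG ha hb]
    by_cases hA : a ∈ LinearMap.range M.mulVecLin <;>
      by_cases hB : b ∈ LinearMap.range M.vecMulLinear <;>
      simp only [hA, hB, if_true, if_false, and_true, true_and, and_self, and_false, false_and] <;>
      (try split_ifs) <;> rfl
  have hg1 : ∀ a ≠ 0, ∀ b ≠ 0, (![0, 1, 0, 0, 0, 0] : Fin 6 → ℝ) (cls M G (vecMulVec a b))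
      = if a ∈ LinearMap.range M.mulVecLin ∧ b ∈ LinearMap.range M.vecMulLinear
          ∧ b ⬝ᵥ (G *ᵥ a) = 0 then 1 else 0 := fun a ha b hb => by
    rw [cls_vecMulVec hG ha hb]
    by_cases hA : a ∈ LinearMap.range M.mulVecLin <;>
      by_cases hB : b ∈ LinearMap.range M.vecMulLinear <;>
      simp only [hA, hB, if_true, if_false, and_true, true_and, and_self, and_false, false_and] <;>
      (try split_ifs) <;> first | rfl | simp_all
  have hCR : (![1, 1, 1, 0, 0, 0] : Fin 6 → ℝ) ∈ balanced M G :=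
    mem_balanced_of_submodule _ _ le_rfl le_rfl fun a ha b hb => by
      rw [cls_vecMulVec hG ha hb]
      by_cases hA : a ∈ LinearMap.range M.mulVecLin <;>
        by_cases hB : b ∈ LinearMap.range M.vecMulLinear <;>
        simp only [hA, hB, if_true, if_false, and_true, true_and, and_self, and_false, false_and,
          Submodule.mem_top] <;> (try split_ifs) <;> rfl
  have hC : (![1, 1, 1, 1, 0, 0] : Fin 6 → ℝ) ∈ balanced M G :=
    mem_balanced_of_submodule _ ⊤ le_rfl le_top fun a ha b hb => by
      rw [cls_vecMulVec hG ha hb]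
      by_cases hA : a ∈ LinearMap.range M.mulVecLin <;>
        by_cases hB : b ∈ LinearMap.range M.vecMulLinear <;>
        simp only [hA, hB, if_true, if_false, and_true, true_and, and_self, and_false, false_and,
          Submodule.mem_top] <;> (try split_ifs) <;> rfl
  have hR : (![1, 1, 1, 0, 1, 0] : Fin 6 → ℝ) ∈ balanced M G :=
    mem_balanced_of_submodule ⊤ _ le_top le_rfl fun a ha b hb => by
      rw [cls_vecMulVec hG ha hb]
      by_cases hA : a ∈ LinearMap.range M.mulVecLin <;>
        by_cases hB : b ∈ LinearMap.range M.vecMulLinear <;>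
        simp only [hA, hB, if_true, if_false, and_true, true_and, and_self, and_false, false_and,
          Submodule.mem_top] <;> (try split_ifs) <;> rfl
  have hT : (![1, 1, 1, 1, 1, 1] : Fin 6 → ℝ) ∈ balanced M G :=
    mem_balanced_of_submodule ⊤ ⊤ le_top le_top fun a ha b hb => by
      rw [cls_vecMulVec hG ha hb]
      by_cases hA : a ∈ LinearMap.range M.mulVecLin <;>
        by_cases hB : b ∈ LinearMap.range M.vecMulLinear <;>
        simp only [hA, hB, if_true, if_false, and_true, true_and, and_self, and_false, false_and,
          Submodule.mem_top] <;> (try split_ifs) <;> rfl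
  have h0 : (![1, 0, 0, 0, 0, 0] : Fin 6 → ℝ) ∈ balanced M G := by
    obtain ⟨c, c', h⟩ := exists_sum_affine_psi hG hn 1
    refine mem_balanced_of_exists ⟨c, c', fun p r => ?_⟩
    obtain ⟨ρ, σ, h1, h2⟩ := h p r
    refine ⟨ρ, σ, ?_, h2⟩
    rw [mul_one] at h1
    rw [← h1]
    refine Finset.sum_congr rfl fun a ha => Finset.sum_congr rfl fun b hb => ?_
    rw [hg0 a (Finset.ne_of_mem_erase ha) b (Finset.ne_of_mem_erase hb)]
    rw [apply_ite Complex.ofReal, ite_mul, Complex.ofReal_one, one_mul, Complex.ofReal_zero,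
      zero_mul]
  have h1 : (![0, 1, 0, 0, 0, 0] : Fin 6 → ℝ) ∈ balanced M G := by
    obtain ⟨c, c', h⟩ := exists_sum_affine_psi hG hn 0
    -- For τ = 0 the phase ψ(0) is 1, so σ is absorbed into ρ.
    refine mem_balanced_of_exists ⟨c + c', 0, fun p r => ?_⟩
    obtain ⟨ρ, σ, h1, h2⟩ := h p r
    refine ⟨ρ + σ, 0, ?_, fun hs => ⟨by rw [(h2 hs).1, (h2 hs).2], rfl⟩⟩
    rw [mul_zero, AddChar.map_zero_eq_one, mul_one] at h1
    rw [Complex.ofReal_zero, zero_mul, add_zero, Complex.ofReal_add, ← h1]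
    refine Finset.sum_congr rfl fun a ha => Finset.sum_congr rfl fun b hb => ?_
    rw [hg1 a (Finset.ne_of_mem_erase ha) b (Finset.ne_of_mem_erase hb)]
    rw [apply_ite Complex.ofReal, ite_mul, Complex.ofReal_one, one_mul, Complex.ofReal_zero,
      zero_mul]
  refine eq_top_iff.2 fun g _ => ?_
  have hdecomp : g = g 5 • ![1, 1, 1, 1, 1, 1] + (g 3 - g 5) • ![1, 1, 1, 1, 0, 0]
      + (g 4 - g 5) • ![1, 1, 1, 0, 1, 0] + (g 2 - g 3 - g 4 + g 5) • ![1, 1, 1, 0, 0, 0]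
      + (g 0 - g 2) • ![1, 0, 0, 0, 0, 0] + (g 1 - g 2) • ![0, 1, 0, 0, 0, 0] := by
    ext i
    fin_cases i <;> simp <;> ring
  rw [hdecomp]
  exact add_mem (add_mem (add_mem (add_mem (add_mem (Submodule.smul_mem _ _ hT)
    (Submodule.smul_mem _ _ hC)) (Submodule.smul_mem _ _ hR)) (Submodule.smul_mem _ _ hCR))
    (Submodule.smul_mem _ _ h0)) (Submodule.smul_mem _ _ h1)

end Balanced

/-! ### Comparison of the two partitions: h_j − h'_j as a multiple of Ex − Ey -/

section Relation

open Matrix Finset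

variable {K : Type*} [Field K] [Fintype K] [DecidableEq K] {D N : ℕ} {x y : Vert K D N}

theorem fourier_hatSet (A : Vert K D N) (Ω : Finset (Vert K D N)) :
    fourier A (hatSet Ω) = ∑ z ∈ Ω, psi K (pair A z) := by
  rw [hatSet, map_sum]
  exact Finset.sum_congr rfl fun z _ => fourier_hat A z

theorem exists_EO_sub_EO (h1 : 1 ≤ (graph K D N).dist x y) (h2 : (graph K D N).dist x y < D)
    (hN : 2 * D < N) (i : Fin 6) :
    ∃ c : ℝ, EO x y i - EO y x i = c • (idem K D N (hat x) - idem K D N (hat y)) := by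
  obtain ⟨G, hG⟩ := exists_generalized_inverse (y - x)
  have hk : (graph K D N).dist x y = (y - x).rank := by rw [dist_eq_rank, rank_sub_comm]
  have hmem : (fun j => if j = i then 1 else 0 : Fin 6 → ℝ) ∈ balanced (y - x) G := by
    rw [balanced_eq_top hG (n := (graph K D N).dist x y - 1) (by omega)]
    exact Submodule.mem_top
  obtain ⟨c, hc⟩ := hmem
  refine ⟨c, ?_⟩
  rw [← sub_eq_zero, EO, EO, ← map_sub, ← map_sub, ← map_smul, ← map_sub]
  refine idem_eq_zero_of_fourier (by omega) (by omega) fun A hA => ?_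
  have hF : clsFourier (y - x) G A (fun j => if j = i then 1 else 0)
      = ∑ W ∈ rankOne (Fin D) (Fin (N - D)) K with cls (y - x) G W = i, psi K (pair A W) := by
    rw [clsFourier, Finset.sum_filter]
    exact Finset.sum_congr rfl fun W _ => by split_ifs <;> simp
  have hx : fourier A (hatSet (part x y i)) = psi K (pair A x)
      * clsFourier (y - x) G A (fun j => if j = i then 1 else 0) := by
    rw [fourier_hatSet, sum_part hG h1 h2 hN, hF, Finset.mul_sum]
    exact Finset.sum_congr rfl fun W _ => by rw [pair_add, AddChar.map_add_eq_mul]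
  have hy : fourier A (hatSet (part y x i)) = psi K (pair A y) * starRingEnd ℂ
      -- The conjugate appears because O'_i consists of the vertices y − W.
      (clsFourier (y - x) G A (fun j => if j = i then 1 else 0)) := by
    rw [fourier_hatSet, sum_part_swap hG h1 h2 hN, hF, map_sum, Finset.mul_sum]
    exact Finset.sum_congr rfl fun W _ => by
      rw [pair_sub, sub_eq_add_neg, AddChar.map_add_eq_mul, star_psi]
  have hyx : psi K (pair A y) = psi K (pair A x) * psi K (pair A (y - x)) := by
    rw [← AddChar.map_add_eq_mul, ← pair_add, add_sub_cancel]
  rw [map_sub, map_sub, map_smul, map_sub, hx, hy, fourier_hat, fourier_hat, Complex.real_smul, hyx]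
  linear_combination psi K (pair A x) * hc A hA

/-- The coefficient is found by pairing with Ex − Ey. By symmetry of the class sizes, EO_i and EO'_i
have opposite inner products with it, so the factor 2 in its square norm cancels. -/
theorem EO_sub_EO (h1 : 1 ≤ (graph K D N).dist x y) (h2 : (graph K D N).dist x y < D)
    (hN : 2 * D < N) (i : Fin 6) :
    EO x y i - EO y x i = lam x y i • (idem K D N (hat x) - idem K D N (hat y)) := by
  obtain ⟨G, hG⟩ := exists_generalized_inverse (y - x)
  obtain ⟨G', hG'⟩ := exists_generalized_inverse (x - y)
  have hcomm : (graph K D N).dist y x = (graph K D N).dist x y := SimpleGraph.dist_comm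
  obtain ⟨c, hc⟩ := exists_EO_sub_EO h1 h2 hN i
  rw [hc]
  congr 1
  have h3 := inner_EO_idem_hat_sub hG h1 h2 hN i
  have h4 := inner_EO_idem_hat_sub hG' (by rwa [hcomm]) (by rwa [hcomm]) hN i
  have hcard : (#(part y x i) : ℝ) = #(part x y i) := by
    rw [card_part hG h1 h2 hN, card_part hG' (by rwa [hcomm]) (by rwa [hcomm]) hN, hcomm]
  rw [hcard, hcomm, ← neg_sub, inner_neg_right] at h4
  have h5 := congrArg
    (fun f => inner ℝ f (idem K D N (hat x) - idem K D N (hat y))) hc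
  simp only [inner_sub_left (EO x y i), real_inner_smul_left] at h5
  rw [norm_idem_hat_sub_sq (by omega) (by omega), h3] at h5
  have hθ : theta (Fintype.card K) D N 0
      - theta (Fintype.card K) D N ((graph K D N).dist x y) ≠ 0 :=
    sub_ne_zero.2 (theta_lt_theta (one_lt_card_real K) (by omega) (by omega)).ne'
  rw [lam, ← mul_div_assoc, eq_div_iff hθ]
  refine mul_left_cancel₀ (inv_ne_zero (card_vert_ne_zero (K := K) (D := D) (N := N))) ?_
  linear_combination (-1 / 2) * h5 + (1 / 2) * h4

theorem h_sub_h (h1 : 1 ≤ (graph K D N).dist x y) (h2 : (graph K D N).dist x y < D)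
    (hN : 2 * D < N) (j : Fin 6) :
    h x y j - h y x j = mu x y j • (idem K D N (hat x) - idem K D N (hat y)) := by
  have hcomm : (graph K D N).dist y x = (graph K D N).dist x y := SimpleGraph.dist_comm
  rw [h, h, hcomm, ← Finset.sum_sub_distrib, mu, Finset.sum_smul]
  refine Finset.sum_congr rfl fun i _ => ?_
  rw [← smul_sub, EO_sub_EO h1 h2 hN, smul_smul, mul_comm]

end Relation

/-! ### Bases of S and membership of Ex − Ey -/

section Final

open Matrix Finset

variable {K : Type*} [Field K] [Fintype K] [DecidableEq K] {D N : ℕ} {x y : Vert K D N}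

theorem two_lt_card (hq : Fintype.card K ≠ 2) : (2 : ℝ) < Fintype.card K := by
  have h : 1 < Fintype.card K := Fintype.one_lt_card
  have h' : 2 < Fintype.card K := by omega
  exact_mod_cast h'

theorem exists_params (hq : Fintype.card K ≠ 2) (h1 : 2 ≤ (graph K D N).dist x y)
    (h2 : (graph K D N).dist x y < D) (hN : 2 * D < N) :
    ∃ u v w : ℝ, Params (Fintype.card K) u v w D N ((graph K D N).dist x y) ∧ 2 ≤ u ∧ 2 ≤ v
      ∧ u < w := by
  have hq2 := two_lt_card hq
  have hq1 : (1 : ℝ) < Fintype.card K := by linarith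
  refine ⟨_, _, _, params_of_lt (by omega) h2 hN, ?_, ?_, pow_lt_pow_right₀ hq1 (by omega)⟩
  · exact hq2.le.trans (le_self_pow₀ hq1.le (by omega))
  · exact hq2.le.trans (le_self_pow₀ hq1.le (by omega))

theorem eps_mul_eta_pos (hq : Fintype.card K ≠ 2) (h1 : 2 ≤ (graph K D N).dist x y)
    (h2 : (graph K D N).dist x y < D) (hN : 2 * D < N) (j : Fin 6) :
    0 < eps (Fintype.card K) D N j * eta (Fintype.card K) D N ((graph K D N).dist x y) j := by
  have hq2 := two_lt_card hq
  obtain ⟨u, v, w, P, hu, hv, hw⟩ := exists_params hq h1 h2 hN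
  rw [P.eps_eq, P.eta_eq (by linarith) (by linarith)]
  exact mul_pos (epsParam_pos hq2 hu hv (by linarith) j) (etaParam_pos hq2 hu hv hw j)

theorem inner_h_self (h1 : 1 ≤ (graph K D N).dist x y) (h2 : (graph K D N).dist x y < D)
    (hN : 2 * D < N) (j : Fin 6) :
    inner ℝ (h x y j) (h x y j) = (Fintype.card (Vert K D N) : ℝ)⁻¹
      * (eps (Fintype.card K) D N j * eta (Fintype.card K) D N ((graph K D N).dist x y) j) := by
  rw [inner_h h1 h2 hN, if_pos rfl]

theorem inner_h_self_pos (hq : Fintype.card K ≠ 2) (h1 : 2 ≤ (graph K D N).dist x y)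
    (h2 : (graph K D N).dist x y < D) (hN : 2 * D < N) (j : Fin 6) :
    0 < (inner ℝ (h x y j) (h x y j) : ℝ) := by
  rw [inner_h_self (by omega) h2 hN]
  exact mul_pos (inv_pos.2 (Nat.cast_pos.2 Fintype.card_pos)) (eps_mul_eta_pos hq h1 h2 hN j)

theorem inner_h_of_ne (h1 : 1 ≤ (graph K D N).dist x y) (h2 : (graph K D N).dist x y < D)
    (hN : 2 * D < N) {i j : Fin 6} (hij : i ≠ j) : inner ℝ (h x y i) (h x y j) = 0 := by
  rw [inner_h h1 h2 hN, if_neg hij, mul_zero, mul_zero]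

theorem linearIndependent_h (hq : Fintype.card K ≠ 2) (h1 : 2 ≤ (graph K D N).dist x y)
    (h2 : (graph K D N).dist x y < D) (hN : 2 * D < N) : LinearIndependent ℝ (h x y) := by
  refine linearIndependent_of_ne_zero_of_inner_eq_zero (𝕜 := ℝ) (fun j h0 => ?_)
    (fun i j hij => inner_h_of_ne (by omega) h2 hN hij)
  have := inner_h_self_pos hq h1 h2 hN j
  rw [h0, inner_zero_left] at this
  exact lt_irrefl _ this

theorem finrank_span_h (hq : Fintype.card K ≠ 2) (h1 : 2 ≤ (graph K D N).dist x y)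
    (h2 : (graph K D N).dist x y < D) (hN : 2 * D < N) :
    Module.finrank ℝ (Submodule.span ℝ (Set.range (h x y))) = 6 := by
  rw [finrank_span_eq_card (linearIndependent_h hq h1 h2 hN), Fintype.card_fin]

theorem h_mem_subspaceS (x y : Vert K D N) (j : Fin 6) : h x y j ∈ subspaceS x y :=
  Submodule.sum_mem _ fun i _ => Submodule.smul_mem _ _ (Submodule.subset_span ⟨i, rfl⟩)

theorem finrank_subspaceS_le (x y : Vert K D N) : Module.finrank ℝ (subspaceS x y) ≤ 6 :=
  (finrank_range_le_card (R := ℝ) (EO x y)).trans (by simp)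

theorem span_h (hq : Fintype.card K ≠ 2) (h1 : 2 ≤ (graph K D N).dist x y)
    (h2 : (graph K D N).dist x y < D) (hN : 2 * D < N) :
    Submodule.span ℝ (Set.range (h x y)) = subspaceS x y :=
  Submodule.eq_of_le_of_finrank_le
    (Submodule.span_le.2 (Set.range_subset_iff.2 (h_mem_subspaceS x y)))
    ((finrank_subspaceS_le x y).trans (finrank_span_h hq h1 h2 hN).ge)

/-- Six vectors whose span contains the six independent vectors h_j must be independent. -/
theorem linearIndependent_EO (hq : Fintype.card K ≠ 2) (h1 : 2 ≤ (graph K D N).dist x y)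
    (h2 : (graph K D N).dist x y < D) (hN : 2 * D < N) : LinearIndependent ℝ (EO x y) := by
  rw [linearIndependent_iff_card_eq_finrank_span, Fintype.card_fin]
  have h3 := finrank_span_h hq h1 h2 hN
  rw [span_h hq h1 h2 hN] at h3
  exact h3.symm

/-- Equality in Bessel's inequality: the residue of Ex − Ey after projection onto the h_j has norm
zero, since Σ μ_j² / (ε_j η_j) = 2 / (θ*₀ − θ*_k). -/
theorem idem_hat_sub_eq_sum (hq : Fintype.card K ≠ 2) (h1 : 2 ≤ (graph K D N).dist x y)
    (h2 : (graph K D N).dist x y < D) (hN : 2 * D < N) :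
    idem K D N (hat x) - idem K D N (hat y)
      = ∑ j, (inner ℝ (h x y j) (idem K D N (hat x) - idem K D N (hat y))
        / inner ℝ (h x y j) (h x y j)) • h x y j := by
  obtain ⟨G, hG⟩ := exists_generalized_inverse (y - x)
  set f := idem K D N (hat x) - idem K D N (hat y) with hf
  set c : Fin 6 → ℝ := fun j => inner ℝ (h x y j) f / inner ℝ (h x y j) (h x y j) with hc
  have hpos := inner_h_self_pos hq h1 h2 hN
  have h3 : ∀ i, inner ℝ (h x y i) (∑ j, c j • h x y j) = (inner ℝ (h x y i) f : ℝ) := by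
    intro i
    rw [inner_sum, Finset.sum_eq_single i]
    · rw [real_inner_smul_right, hc]
      exact div_mul_cancel₀ _ (hpos i).ne'
    · intro j _ hji
      rw [real_inner_smul_right, inner_h_of_ne (by omega) h2 hN hji.symm, mul_zero]
    · simp
  have h4 : inner ℝ (f - ∑ j, c j • h x y j) (f - ∑ j, c j • h x y j)
      = inner ℝ f f - ∑ j, inner ℝ (h x y j) f ^ 2 / inner ℝ (h x y j) (h x y j) := by
    have h5 : inner ℝ (∑ j, c j • h x y j) (∑ j, c j • h x y j)
        = (inner ℝ (∑ j, c j • h x y j) f : ℝ) := by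
      conv_lhs => rw [sum_inner]
      rw [sum_inner]
      refine Finset.sum_congr rfl fun j _ => ?_
      rw [real_inner_smul_left, h3, real_inner_smul_left]
    have h6 : (inner ℝ (∑ j, c j • h x y j) f : ℝ)
        = ∑ j, inner ℝ (h x y j) f ^ 2 / inner ℝ (h x y j) (h x y j) := by
      rw [sum_inner]
      refine Finset.sum_congr rfl fun j _ => ?_
      rw [real_inner_smul_left, hc]
      ring
    rw [inner_sub_left, inner_sub_right f f, inner_sub_right _ f, h5,
      real_inner_comm (∑ j, c j • h x y j) f, h6]
    ring
  have h7 : (inner ℝ f f : ℝ)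
      = ∑ j, inner ℝ (h x y j) f ^ 2 / inner ℝ (h x y j) (h x y j) := by
    have hq2 := two_lt_card hq
    obtain ⟨u, v, w, P, hu, hv, hw⟩ := exists_params hq h1 h2 hN
    have hsum := sum_muParam_sq (q := Fintype.card K) (u := u) (v := v) (w := w) (by linarith)
      (by linarith) (by linarith) (by linarith) (by linarith)
      (fun j => (epsParam_pos hq2 hu hv (by linarith) j).ne')
      (fun j => (etaParam_pos hq2 hu hv hw j).ne')
    have hX := card_vert_ne_zero (K := K) (D := D) (N := N)
    have hterm : ∀ j, (inner ℝ (h x y j) f : ℝ) ^ 2 / inner ℝ (h x y j) (h x y j)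
        = (Fintype.card (Vert K D N) : ℝ)⁻¹ * (theta (Fintype.card K) D N 0
            - theta (Fintype.card K) D N ((graph K D N).dist x y)) ^ 2
          * (muParam (Fintype.card K) u v w j ^ 2
            / (epsParam (Fintype.card K) u v w j * etaParam (Fintype.card K) u v w j)) := by
      intro j
      rw [hf, inner_h_idem_hat_sub hG (by omega) h2 hN, inner_h_self (by omega) h2 hN,
        mu_eq_muClosed (by omega) h2 hN, P.muClosed_eq, P.eps_eq,
        P.eta_eq (by linarith) (by linarith)]
      have he := (epsParam_pos hq2 hu hv (by linarith : 2 ≤ w) j).ne'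
      have hη := (etaParam_pos hq2 hu hv hw j).ne'
      field_simp
    rw [Finset.sum_congr rfl fun j _ => hterm j, ← Finset.mul_sum, hsum, hf,
      norm_idem_hat_sub_sq (by omega) (by omega), theta_sub_theta, P.pow_N_sub_zero, P.pow_N_sub_k]
    have hqu : (Fintype.card K : ℝ) * u - 1 ≠ 0 := by nlinarith
    have hq1 : (Fintype.card K : ℝ) - 1 ≠ 0 := by linarith
    have hq0 : (Fintype.card K : ℝ) ≠ 0 := by linarith
    have hv0 : v ≠ 0 := by linarith
    have hw0 : w ≠ 0 := by linarith
    rw [show (Fintype.card K : ℝ) ^ 2 * u * v * w - Fintype.card K * v * w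
      = Fintype.card K * v * w * (Fintype.card K * u - 1) by ring]
    field_simp
  rw [h7, sub_self] at h4
  exact sub_eq_zero.1 (inner_self_eq_zero.1 h4)

theorem idem_hat_sub_mem_subspaceS (hq : Fintype.card K ≠ 2) (h1 : 2 ≤ (graph K D N).dist x y)
    (h2 : (graph K D N).dist x y < D) (hN : 2 * D < N) :
    idem K D N (hat x) - idem K D N (hat y) ∈ subspaceS x y := by
  rw [idem_hat_sub_eq_sum hq h1 h2 hN]
  exact Submodule.sum_mem _ fun j _ => Submodule.smul_mem _ _ (h_mem_subspaceS x y j)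

/-- Each h'_j is h_j minus a multiple of Ex − Ey, hence in S; a dimension count gives equality. -/
theorem span_h_swap (hq : Fintype.card K ≠ 2) (h1 : 2 ≤ (graph K D N).dist x y)
    (h2 : (graph K D N).dist x y < D) (hN : 2 * D < N) :
    Submodule.span ℝ (Set.range (h y x)) = subspaceS x y := by
  have hcomm : (graph K D N).dist y x = (graph K D N).dist x y := SimpleGraph.dist_comm
  refine Submodule.eq_of_le_of_finrank_le
    (Submodule.span_le.2 (Set.range_subset_iff.2 fun j => ?_))
    ((finrank_subspaceS_le x y).trans
      (finrank_span_h hq (by rwa [hcomm]) (by rwa [hcomm]) hN).ge)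
  rw [← sub_sub_cancel (h x y j) (h y x j), h_sub_h (by omega) h2 hN]
  exact Submodule.sub_mem _ (h_mem_subspaceS x y j)
    (Submodule.smul_mem _ _ (idem_hat_sub_mem_subspaceS hq h1 h2 hN))

end Final

end BilinearForms

end

theorem proposition9p8 {K : Type*} [Field K] [Fintype K] [DecidableEq K]
    (hq : Fintype.card K ≠ 2) (D N : ℕ) (hD : 6 ≤ 2 * D) (hN : 2 * D < N)
    (x y : BilinearForms.Vert K D N)
    (hk : 2 ≤ (BilinearForms.graph K D N).dist x y)
    (hk' : (BilinearForms.graph K D N).dist x y ≤ D - 1) :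
    -- the eigenvalue and the dual eigenvalues attached to `E`
    BilinearForms.graphEigenvalue (BilinearForms.graph K D N) 1
        = BilinearForms.theta (Fintype.card K) D N 1 ∧
    (∀ u v : BilinearForms.Vert K D N,
      (Fintype.card (BilinearForms.Vert K D N) : ℝ)
          * BilinearForms.idem K D N (BilinearForms.hat v) u
        = BilinearForms.theta (Fintype.card K) D N ((BilinearForms.graph K D N).dist u v)) ∧
    -- `E Ô₁, …, E Ô₆` is a basis of `S`
    LinearIndependent ℝ (BilinearForms.EO x y) ∧
    -- `h₁, …, h₆` is an orthogonal basis of `S`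
    (LinearIndependent ℝ (BilinearForms.h x y) ∧
      Submodule.span ℝ (Set.range (BilinearForms.h x y)) = BilinearForms.subspaceS x y ∧
      (∀ i j, i ≠ j → inner ℝ (BilinearForms.h x y i) (BilinearForms.h x y j) = 0) ∧
      ∀ j, ‖BilinearForms.h x y j‖ ^ 2
        = (Fintype.card (BilinearForms.Vert K D N) : ℝ)⁻¹
          * (BilinearForms.eps (Fintype.card K) D N j
            * BilinearForms.eta (Fintype.card K) D N ((BilinearForms.graph K D N).dist x y) j)) ∧
    -- `h'₁, …, h'₆` is an orthogonal basis of `S`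
    (LinearIndependent ℝ (BilinearForms.h y x) ∧
      Submodule.span ℝ (Set.range (BilinearForms.h y x)) = BilinearForms.subspaceS x y ∧
      (∀ i j, i ≠ j → inner ℝ (BilinearForms.h y x i) (BilinearForms.h y x j) = 0) ∧
      ∀ j, ‖BilinearForms.h y x j‖ ^ 2
        = (Fintype.card (BilinearForms.Vert K D N) : ℝ)⁻¹
          * (BilinearForms.eps (Fintype.card K) D N j
            * BilinearForms.eta (Fintype.card K) D N ((BilinearForms.graph K D N).dist x y) j)) ∧
    -- the relation between the two bases
    (∀ j, BilinearForms.h x y j - BilinearForms.h y x j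
      = BilinearForms.mu x y j
        • (BilinearForms.idem K D N (BilinearForms.hat x)
          - BilinearForms.idem K D N (BilinearForms.hat y))) ∧
    (∀ j, BilinearForms.mu x y j
      = BilinearForms.muClosed (Fintype.card K) D N ((BilinearForms.graph K D N).dist x y) j) := by
  have hcomm : (BilinearForms.graph K D N).dist y x = (BilinearForms.graph K D N).dist x y :=
    SimpleGraph.dist_comm
  have hlt : (BilinearForms.graph K D N).dist x y < D := by omega
  refine ⟨BilinearForms.graphEigenvalue_one (by omega) (by omega), fun u v => ?_,
    BilinearForms.linearIndependent_EO hq hk hlt hN,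
    ⟨BilinearForms.linearIndependent_h hq hk hlt hN, BilinearForms.span_h hq hk hlt hN,
      fun i j hij => BilinearForms.inner_h_of_ne (by omega) hlt hN hij, fun j => ?_⟩,
    ⟨BilinearForms.linearIndependent_h hq (by omega) (by omega) hN,
      BilinearForms.span_h_swap hq hk hlt hN,
      fun i j hij => BilinearForms.inner_h_of_ne (by omega) (by omega) hN hij, fun j => ?_⟩,
    fun j => BilinearForms.h_sub_h (by omega) hlt hN j,
    fun j => BilinearForms.mu_eq_muClosed (by omega) hlt hN j⟩
  · rw [BilinearForms.card_mul_idem_hat_apply (by omega) (by omega), BilinearForms.dist_eq_rank]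
  · rw [← real_inner_self_eq_norm_sq, BilinearForms.inner_h_self (by omega) hlt hN]
  · rw [← real_inner_self_eq_norm_sq, BilinearForms.inner_h_self (by omega) (by omega) hN, hcomm]
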